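/- Work over $\mathbb{C}$. Let $\mathrm{Gr}(k,n)$ be the Grassmannian of $k$-dimensional subspaces of $\mathbb{C}^n$, with tautological bundle $\mathcal{U}$ (of rank $k$) and quotient bundle $\mathcal{Q}=\mathcal{O}^{\oplus n}/\mathcal{U}$ (of rank $n-k$). Let $\mathrm{Fl}(a,b,n)$ be the variety of flags $U_1\subset U_2\subset\mathbb{C}^n$ with $\dim U_1=a$ and $\dim U_2=b$; let $\mathcal{U}_1$ be the pullback of $\mathcal{U}$ from $\mathrm{Gr}(a,n)$ and $\mathcal{Q}_2$ the pullback of $\mathcal{Q}$ from $\mathrm{Gr}(b,n)$. For a vector bundle $\mathcal{F}$ on $X$, let $\mathscr{Z}(\mathcal{F})\subset X$ denote the scheme-theoretic zero locus of a generic global section of $\mathcal{F}$, where generic means: in a suitable non-empty Zariski open subset of $H^0(X,\mathcal{F})$. For a vector bundle $\mathcal{E}$ on $X$, let $\mathbb{G}\mathrm{r}_X(k,\mathcal{E})\to X$ be the Grassmann bundle of rank $k$ subbundles of $\mathcal{E}$. Let $0\le k_i\le n_i$ for $i=1,2$, let $\mathrm{Gr}_i=\mathrm{Gr}(k_i,n_i)$,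 let $\pi_1,\pi_2$ be the projections of $\mathrm{Gr}_1\times\mathrm{Gr}_2$ onto its factors, and let $$M=\mathscr{Z}(\mathcal{Q}_{\mathrm{Gr}_1}\boxtimes\mathcal{U}^\vee_{\mathrm{Gr}_2})\subset \mathrm{Gr}_1\times\mathrm{Gr}_2,\qquad \mathcal{Q}_{\mathrm{Gr}_1}\boxtimes\mathcal{U}^\vee_{\mathrm{Gr}_2}=\pi_1^*\mathcal{Q}_{\mathrm{Gr}_1}\otimes\pi_2^*\mathcal{U}_{\mathrm{Gr}_2}^\vee=\mathcal{H}om(\pi_2^*\mathcal{U}_{\mathrm{Gr}_2},\pi_1^*\mathcal{Q}_{\mathrm{Gr}_1}).$$ 1. If $k_2<k_1<n_1$ and $n_2=n_1-1$, then $M\cong\mathscr{Z}(\mathcal{U}_1^\vee)\subset\mathrm{Fl}(k_2,k_1,n_1)$. 2. If $k_2<k_1<n_1$ and $n_1=n_2-1$, then $M\cong\mathscr{Z}(\mathcal{Q}_2)\subset\mathrm{Fl}(k_2,k_1+1,n_2)$. 3. If $k_2\ge k_1$ and $n_2=n_1+c$ with $c\ge 0$, then $M\cong\mathbb{G}\mathrm{r}_{\mathrm{Gr}_1}(k_2,\mathcal{U}_{\mathrm{Gr}_1}\oplus\mathcal{O}_{\mathrm{Gr}_1}^{\oplus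 c})$ as schemes over $\mathrm{Gr}_1$ (both sides being empty if $k_2>k_1+c$). The isomorphisms are isomorphisms of schemes over $\mathbb{C}$. In 1 and 2 they exist for every choice of the two sections in non-empty Zariski open subsets of the respective spaces of global sections. -/

import Mathlib

open CategoryTheory

set_option linter.style.haveILetI false

/-! ## Base change of modules along a ring homomorphism -/

section BaseChange

variable {A B : Type} [CommRing A] [CommRing B] {f : A →+* B}
  {M M' N N' : Type} [AddCommGroup M] [AddCommGroup M'] [AddCommGroup N] [AddCommGroup N']
  [Module A M] [Module B M'] [Module A N] [Module B N']

/-- The `f`-semilinear map `τ : M → M'` exhibits `M'` as `B ⊗[A] M`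
(`B` being an `A`-algebra through `f`). -/
def IsBaseChangeAlong (f : A →+* B) (τ : M →ₛₗ[f] M') : Prop :=
  letI : Algebra A B := f.toAlgebra
  letI : Module A M' := Module.compHom M' f
  haveI : IsScalarTower A B M' := ⟨fun a b m => mul_smul (f a) b m⟩
  IsBaseChange B
    ({ toFun := τ, map_add' := τ.map_add, map_smul' := τ.map_smulₛₗ } : M →ₗ[A] M')

/-- The universal property of base change. -/
theorem isBaseChangeAlong_iff {τ : M →ₛₗ[f] M'} :
    IsBaseChangeAlong f τ ↔
      ∀ (P : Type) [AddCommGroup P] [Module B P] (σ : M →ₛₗ[f] P),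
        ∃! g : M' →ₗ[B] P, ∀ m, g (τ m) = σ m := by
  letI : Algebra A B := f.toAlgebra
  letI : Module A M' := Module.compHom M' f
  haveI : IsScalarTower A B M' := ⟨fun a b m => mul_smul (f a) b m⟩
  constructor
  · intro h P _ _ σ
    letI : Module A P := Module.compHom P f
    haveI : IsScalarTower A B P := ⟨fun a b m => mul_smul (f a) b m⟩
    have h' : IsBaseChange B
      ({ toFun := τ, map_add' := τ.map_add, map_smul' := τ.map_smulₛₗ } : M →ₗ[A] M') := h
    let σ' : M →ₗ[A] P :=
      { toFun := σ, map_add' := σ.map_add, map_smul' := σ.map_smulₛₗ }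
    refine ⟨h'.lift σ', fun m => h'.lift_eq σ' m, fun g hg => ?_⟩
    exact h'.algHom_ext _ _ fun m => (hg m).trans (h'.lift_eq σ' m).symm
  · intro h
    refine IsBaseChange.of_lift_unique _ ?_
    intro Q _ _ _ _ g
    letI : AddCommGroup Q := Module.addCommMonoidToAddCommGroup B
    obtain ⟨g', hg', hu⟩ := h Q
      { toFun := g, map_add' := g.map_add,
        map_smul' := fun a m => (g.map_smul a m).trans (algebraMap_smul B a (g m)).symm }
    refine ⟨g', LinearMap.ext hg', fun g'' hg'' => hu g'' fun m => ?_⟩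
    exact LinearMap.congr_fun hg'' m

namespace IsBaseChangeAlong

variable {τ : M →ₛₗ[f] M'} {σ : N →ₛₗ[f] N'}

/-- The `B`-linear extension of an `f`-semilinear map. -/
noncomputable def lift (h : IsBaseChangeAlong f τ) (ρ : M →ₛₗ[f] N') : M' →ₗ[B] N' :=
  (isBaseChangeAlong_iff.1 h N' ρ).choose

theorem lift_apply (h : IsBaseChangeAlong f τ) (ρ : M →ₛₗ[f] N') (m : M) :
    h.lift ρ (τ m) = ρ m :=
  (isBaseChangeAlong_iff.1 h N' ρ).choose_spec.1 m

theorem hom_ext (h : IsBaseChangeAlong f τ) {P : Type} [AddCommGroup P] [Module B P]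
    {g g' : M' →ₗ[B] P} (e : ∀ m, g (τ m) = g' (τ m)) : g = g' :=
  (isBaseChangeAlong_iff.1 h P (g'.comp τ)).unique e fun _ => rfl

/-- A retract of a base change is a base change. -/
theorem retract (h : IsBaseChangeAlong f τ) (i : N →ₗ[A] M) (r : M →ₗ[A] N)
    (i' : N' →ₗ[B] M') (r' : M' →ₗ[B] N') (hri : ∀ n, r (i n) = n)
    (hri' : ∀ n, r' (i' n) = n) (hi : ∀ n, i' (σ n) = τ (i n)) (hr : ∀ m, r' (τ m) = σ (r m)) :
    IsBaseChangeAlong f σ := by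
  rw [isBaseChangeAlong_iff]
  intro P _ _ ρ
  refine ⟨(h.lift (ρ.comp r)).comp i', fun n => ?_, fun g hg => ?_⟩
  · simp [hi, lift_apply, hri]
  · have : g.comp r' = h.lift (ρ.comp r) := h.hom_ext fun m => by
      simp [lift_apply, hr, hg]
    rw [← this]
    ext n
    simp [hri']

theorem rankAtStalk_eq (h : IsBaseChangeAlong f τ) [Module.Finite A M] [Module.Projective A M]
    (p : PrimeSpectrum B) :
    Module.rankAtStalk M' p = Module.rankAtStalk M (p.comap f) := by
  letI : Algebra A B := f.toAlgebra
  letI : Module A M' := Module.compHom M' f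
  haveI : IsScalarTower A B M' := ⟨fun a b m => mul_smul (f a) b m⟩
  have h' : IsBaseChange B
      ({ toFun := τ, map_add' := τ.map_add, map_smul' := τ.map_smulₛₗ } : M →ₗ[A] M') := h
  exact Module.rankAtStalk_isBaseChange h' p

theorem projective (h : IsBaseChangeAlong f τ) [Module.Projective A M] :
    Module.Projective B M' := by
  letI : Algebra A B := f.toAlgebra
  letI : Module A M' := Module.compHom M' f
  haveI : IsScalarTower A B M' := ⟨fun a b m => mul_smul (f a) b m⟩
  have h' : IsBaseChange B
      ({ toFun := τ, map_add' := τ.map_add, map_smul' := τ.map_smulₛₗ } : M →ₗ[A] M') := h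
  exact Module.Projective.of_equiv h'.equiv

theorem prodMap (h : IsBaseChangeAlong f τ) (k : IsBaseChangeAlong f σ)
    {ρ : (M × N) →ₛₗ[f] (M' × N')} (hρ : ∀ m n, ρ (m, n) = (τ m, σ n)) :
    IsBaseChangeAlong f ρ := by
  rw [isBaseChangeAlong_iff]
  intro P _ _ φ
  refine ⟨(h.lift (φ.comp (LinearMap.inl A M N))).coprod
    (k.lift (φ.comp (LinearMap.inr A M N))), fun x => ?_, fun g hg => ?_⟩
  · obtain ⟨m, n⟩ := x
    simp [hρ, lift_apply, ← map_add]
  · apply LinearMap.prod_ext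
    · refine h.hom_ext fun m => ?_
      have := hg (m, 0)
      simp only [hρ, map_zero] at this
      simpa [lift_apply] using this
    · refine k.hom_ext fun n => ?_
      have := hg (0, n)
      simp only [hρ, map_zero] at this
      simpa [lift_apply] using this

end IsBaseChangeAlong

/-- Coordinatewise application of a ring homomorphism, `Aⁿ → Bⁿ`. -/
def piRingHom (f : A →+* B) (n : ℕ) : (Fin n → A) →ₛₗ[f] (Fin n → B) where
  toFun v i := f (v i)
  map_add' _ _ := funext fun _ => f.map_add _ _
  map_smul' _ _ := funext fun _ => f.map_mul _ _

theorem isBaseChangeAlong_pi (f : A →+* B) (n : ℕ) : IsBaseChangeAlong f (piRingHom f n) := by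
  have hs : ∀ i : Fin n, piRingHom f n (Pi.single i 1) = Pi.single i 1 := fun i => by
    ext j
    by_cases h : j = i
    · subst h; simp [piRingHom]
    · simp [piRingHom, h]
  rw [isBaseChangeAlong_iff]
  intro P _ _ σ
  refine ⟨(Pi.basisFun B (Fin n)).constr B fun i => σ (Pi.single i 1), fun v => ?_,
    fun g hg => ?_⟩
  · rw [Module.Basis.constr_apply_fintype]
    conv_rhs => rw [← Finset.univ_sum_single v]
    rw [map_sum]
    refine Finset.sum_congr rfl fun i _ => ?_
    have : (Pi.single i (v i) : Fin n → A) = v i • Pi.single i 1 := by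
      rw [← Pi.single_smul]; simp
    rw [this, map_smulₛₗ]
    rfl
  · refine (Pi.basisFun B (Fin n)).ext fun i => ?_
    rw [Module.Basis.constr_basis, ← hg, hs, Pi.basisFun_apply]

section Hom

theorem finite_linearMap [Module.Finite A M] [Module.Projective A M] [Module.Finite A N] :
    Module.Finite A (M →ₗ[A] N) := by
  obtain ⟨n, p, hp⟩ := Module.Finite.exists_fin' A M
  obtain ⟨s, hs⟩ := Module.projective_lifting_property p LinearMap.id hp
  haveI : Module.Finite A ((Fin n → A) →ₗ[A] N) :=
    Module.Finite.equiv ((Pi.basisFun A (Fin n)).constr A (M' := N))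
  refine Module.Finite.of_surjective (LinearMap.lcomp A N s) fun g => ⟨g.comp p, ?_⟩
  ext m
  simpa using congrArg g (LinearMap.congr_fun hs m)

theorem projective_linearMap [Module.Finite A M] [Module.Projective A M]
    [Module.Projective A N] : Module.Projective A (M →ₗ[A] N) := by
  obtain ⟨n, p, hp⟩ := Module.Finite.exists_fin' A M
  obtain ⟨s, hs⟩ := Module.projective_lifting_property p LinearMap.id hp
  haveI : Module.Projective A (Fin n → N) :=
    Module.Projective.of_equiv
      (DFinsupp.linearEquivFunOnFintype : (Π₀ _ : Fin n, N) ≃ₗ[A] (Fin n → N))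
  haveI : Module.Projective A ((Fin n → A) →ₗ[A] N) :=
    Module.Projective.of_equiv ((Pi.basisFun A (Fin n)).constr A (M' := N))
  refine Module.Projective.of_split (LinearMap.lcomp A N p) (LinearMap.lcomp A N s) ?_
  ext g m
  simpa using congrArg g (LinearMap.congr_fun hs m)

variable {τ : M →ₛₗ[f] M'} {σ : N →ₛₗ[f] N'}

/-- The base change `Hom_A(M, N) → Hom_B(M', N')`. -/
noncomputable def IsBaseChangeAlong.homMap (h : IsBaseChangeAlong f τ) (σ : N →ₛₗ[f] N') :
    (M →ₗ[A] N) →ₛₗ[f] (M' →ₗ[B] N') where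
  toFun φ := h.lift (σ.comp φ)
  map_add' φ ψ := h.hom_ext fun m => by simp [h.lift_apply]
  map_smul' a φ := h.hom_ext fun m => by simp [h.lift_apply]

theorem IsBaseChangeAlong.homMap_apply (h : IsBaseChangeAlong f τ) (φ : M →ₗ[A] N) (m : M) :
    h.homMap σ φ (τ m) = σ (φ m) :=
  h.lift_apply _ m

theorem IsBaseChangeAlong.isBaseChangeAlong_homMap [Module.Finite A M] [Module.Projective A M]
    (h : IsBaseChangeAlong f τ) (k : IsBaseChangeAlong f σ) :
    IsBaseChangeAlong f (h.homMap σ) := by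
  obtain ⟨n, p, hp⟩ := Module.Finite.exists_fin' A M
  obtain ⟨s, hs⟩ := Module.projective_lifting_property p LinearMap.id hp
  -- dual basis
  let e : Fin n → M := fun i => p (Pi.single i 1)
  let c : Fin n → M →ₗ[A] A := fun i => (LinearMap.proj i).comp s
  have hec : ∀ m, ∑ i, c i m • e i = m := fun m => by
    have h1 := LinearMap.congr_fun hs m
    simp only [LinearMap.comp_apply, LinearMap.id_apply] at h1
    conv_rhs => rw [← h1, pi_eq_sum_univ' (s m)]
    simp only [map_sum, map_smul]
    refine Finset.sum_congr rfl fun i _ => ?_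
    simp only [c, e, LinearMap.comp_apply, LinearMap.proj_apply]
  have hφ : ∀ φ : M →ₗ[A] N, ∑ i, (c i).smulRight (φ (e i)) = φ := fun φ => by
    ext m
    simp only [LinearMap.sum_apply, LinearMap.smulRight_apply]
    conv_rhs => rw [← hec m, map_sum]
    simp
  rw [isBaseChangeAlong_iff]
  intro P _ _ ρ
  -- the extension on the summand generated by the `i`-th coordinate
  let L : Fin n → N' →ₗ[B] P := fun i => k.lift
    (ρ.comp (LinearMap.smulRightₗ (c i) : N →ₗ[A] (M →ₗ[A] N)))
  have hL : ∀ i x, L i (σ x) = ρ ((c i).smulRight x) := fun i x => k.lift_apply _ x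
  refine ⟨∑ i, (L i).comp (LinearMap.applyₗ (τ (e i))), fun φ => ?_, fun g hg => ?_⟩
  · conv_rhs => rw [← hφ φ, map_sum]
    simp [h.homMap_apply, hL]
  · ext ψ
    -- rank one homomorphisms `M' → N'`
    let c' : Fin n → M' →ₗ[B] B := fun i => h.lift
      ({ toFun := fun m => f (c i m), map_add' := by simp, map_smul' := by simp } : M →ₛₗ[f] B)
    have hc' : ∀ i m, c' i (τ m) = f (c i m) := fun i m => h.lift_apply _ m
    have hψ : ψ = ∑ i, (c' i).smulRight (ψ (τ (e i))) := h.hom_ext fun m => by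
      conv_lhs => rw [← hec m]
      simp [hc']
    have key : ∀ i, g ∘ₗ (LinearMap.smulRightₗ (c' i) : N' →ₗ[B] (M' →ₗ[B] N')) = L i := by
      intro i
      refine k.hom_ext fun x => ?_
      rw [hL, ← hg]
      refine congrArg g (h.hom_ext fun m => ?_)
      rw [h.homMap_apply]
      simp [hc']
    conv_lhs => rw [hψ, map_sum]
    simp only [LinearMap.sum_apply, LinearMap.comp_apply, LinearMap.applyₗ_apply_apply]
    refine Finset.sum_congr rfl fun i _ => ?_
    exact LinearMap.congr_fun (key i) (ψ (τ (e i)))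

end Hom

section Submodule

variable {τ : M →ₛₗ[f] M'}

/-- The `B`-submodule of `M'` generated by the image of `S ⊆ M`. -/
def Submodule.extend (τ : M →ₛₗ[f] M') (S : Submodule A M) : Submodule B M' :=
  Submodule.span B (τ '' S)

theorem Submodule.mem_extend (S : Submodule A M) {m : M} (hm : m ∈ S) : τ m ∈ S.extend τ :=
  Submodule.subset_span ⟨m, hm, rfl⟩

theorem Submodule.extend_le (S : Submodule A M) {T : Submodule B M'} (h : ∀ m ∈ S, τ m ∈ T) :
    S.extend τ ≤ T :=
  Submodule.span_le.2 fun _ ⟨m, hm, e⟩ => e ▸ h m hm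

theorem Submodule.extend_extend {C M'' : Type} [CommRing C] [AddCommGroup M''] [Module C M'']
    {g : B →+* C} {f' : A →+* C} (τ' : M' →ₛₗ[g] M'') (τ'' : M →ₛₗ[f'] M'')
    (h : ∀ m, τ' (τ m) = τ'' m) (S : Submodule A M) :
    (S.extend τ).extend τ' = S.extend τ'' := by
  apply le_antisymm
  · refine Submodule.extend_le _ fun m hm => ?_
    induction hm using Submodule.span_induction with
    | mem x hx => obtain ⟨m, hm, rfl⟩ := hx; rw [h]; exact S.mem_extend hm
    | zero => simp
    | add x y _ _ hx hy => rw [map_add]; exact add_mem hx hy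
    | smul a x _ hx => rw [map_smulₛₗ]; exact Submodule.smul_mem _ _ hx
  · refine Submodule.extend_le _ fun m hm => ?_
    rw [← h]
    exact Submodule.mem_extend _ (S.mem_extend hm)

/-- The restriction of `τ` to a submodule, with values in a submodule. -/
def subMap (τ : M →ₛₗ[f] M') (S : Submodule A M) (T : Submodule B M')
    (h : ∀ m ∈ S, τ m ∈ T) : S →ₛₗ[f] T where
  toFun m := ⟨τ m, h m m.2⟩
  map_add' x y := Subtype.ext (by simp)
  map_smul' a x := Subtype.ext (by simp)

theorem isBaseChangeAlong_quotient (h : IsBaseChangeAlong f τ) (S : Submodule A M)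
    [Module.Projective A (M ⧸ S)] {T : Submodule B M'} (hT : S.extend τ = T)
    (hle : S ≤ T.comap τ) : IsBaseChangeAlong f (S.mapQ T τ hle) := by
  obtain ⟨s, hs⟩ := Module.projective_lifting_property S.mkQ LinearMap.id S.mkQ_surjective
  have hs' : ∀ q, S.mkQ (s q) = q := fun q => LinearMap.congr_fun hs q
  have hd : ∀ m, s (S.mkQ m) - m ∈ S := fun m => by
    rw [← Submodule.Quotient.eq]; exact hs' _
  let i₀ : M' →ₗ[B] M' := h.lift (τ.comp (s.comp S.mkQ))
  have hi₀ : ∀ m, i₀ (τ m) = τ (s (S.mkQ m)) := fun m => h.lift_apply _ m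
  have hker : T ≤ LinearMap.ker i₀ := by
    rw [← hT]
    refine Submodule.extend_le _ fun m hm => ?_
    have : S.mkQ m = 0 := by simpa using hm
    rw [LinearMap.mem_ker, hi₀, this]
    simp
  refine h.retract s S.mkQ (T.liftQ i₀ hker) T.mkQ hs' ?_ ?_ ?_
  · intro q
    have : T.mkQ ∘ₗ i₀ = T.mkQ := h.hom_ext fun m => by
      rw [LinearMap.comp_apply, hi₀]
      refine (Submodule.Quotient.eq T).2 ?_
      rw [← map_sub]
      exact hle (hd m)
    obtain ⟨m, rfl⟩ := T.mkQ_surjective q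
    exact LinearMap.congr_fun this m
  · intro q
    obtain ⟨m, rfl⟩ := S.mkQ_surjective q
    exact hi₀ m
  · intro m
    rfl

theorem isBaseChangeAlong_subMap (h : IsBaseChangeAlong f τ) (S : Submodule A M)
    [Module.Projective A (M ⧸ S)] {T : Submodule B M'} (hT : S.extend τ = T)
    (hle : ∀ m ∈ S, τ m ∈ T) : IsBaseChangeAlong f (subMap τ S T hle) := by
  obtain ⟨s, hs⟩ := Module.projective_lifting_property S.mkQ LinearMap.id S.mkQ_surjective
  have hs' : ∀ q, S.mkQ (s q) = q := fun q => LinearMap.congr_fun hs q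
  have hd : ∀ m, m - s (S.mkQ m) ∈ S := fun m => by
    rw [← Submodule.Quotient.eq]; exact (hs' _).symm
  let r : M →ₗ[A] S := (LinearMap.id - s.comp S.mkQ).codRestrict S hd
  have hr : ∀ m : S, r m = m := fun m => by
    have : S.mkQ (m : M) = 0 := by simp
    apply Subtype.ext
    change (m : M) - s (S.mkQ m) = m
    rw [this]; simp
  let r' : M' →ₗ[B] T := h.lift ((subMap τ S T hle).comp r)
  have hr' : ∀ m, r' (τ m) = subMap τ S T hle (r m) := fun m => h.lift_apply _ m
  refine h.retract S.subtype r T.subtype r' hr ?_ (fun _ => rfl) hr'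
  have : T ≤ LinearMap.eqLocus (T.subtype ∘ₗ r') LinearMap.id := by
    conv_lhs => rw [← hT]
    refine Submodule.extend_le _ fun m hm => ?_
    change ((r' (τ m) : T) : M') = τ m
    rw [hr', hr ⟨m, hm⟩]
    rfl
  intro n
  exact Subtype.ext (this n.2)

end Submodule

end BaseChange

/-! ## Vector bundles on functors of points

A complex scheme is given by its functor of points on commutative `ℂ`-algebras. -/

/-- Functors of points of complex schemes: `X.obj A` is the set of `A`-points of `X`. -/
abbrev PointFunctor := CommAlgCat.{0, 0} ℂ ⥤ Type

/-- The functor of points of `Spec ℂ`. -/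
def specC : PointFunctor := (Functor.const _).obj PUnit

/-- A vector bundle on `X`: to every point `x ∈ X(A)` it assigns a finitely generated projective
`A`-module (its pullback to `Spec A`), compatibly with base change. -/
structure VBundle (X : PointFunctor) where
  fiber : ∀ {A : CommAlgCat.{0, 0} ℂ}, X.obj A → Type
  [addCommGroup : ∀ {A : CommAlgCat.{0, 0} ℂ} (x : X.obj A), AddCommGroup (fiber x)]
  [module : ∀ {A : CommAlgCat.{0, 0} ℂ} (x : X.obj A), Module A (fiber x)]
  [finite : ∀ {A : CommAlgCat.{0, 0} ℂ} (x : X.obj A), Module.Finite A (fiber x)]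
  [projective : ∀ {A : CommAlgCat.{0, 0} ℂ} (x : X.obj A), Module.Projective A (fiber x)]
  res : ∀ {A B : CommAlgCat.{0, 0} ℂ} (f : A ⟶ B) {x : X.obj A} {y : X.obj B}, X.map f x = y →
    fiber x →ₛₗ[f.hom.toRingHom] fiber y
  res_id : ∀ {A : CommAlgCat.{0, 0} ℂ} {x : X.obj A} (h : X.map (𝟙 A) x = x) (v : fiber x),
    res (𝟙 A) h v = v
  res_comp : ∀ {A B C : CommAlgCat.{0, 0} ℂ} (f : A ⟶ B) (g : B ⟶ C) {x : X.obj A} {y : X.obj B}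
    {z : X.obj C} (hf : X.map f x = y) (hg : X.map g y = z) (hfg : X.map (f ≫ g) x = z)
    (v : fiber x), res (f ≫ g) hfg v = res g hg (res f hf v)
  isBaseChange : ∀ {A B : CommAlgCat.{0, 0} ℂ} (f : A ⟶ B) {x : X.obj A} {y : X.obj B}
    (h : X.map f x = y), IsBaseChangeAlong f.hom.toRingHom (res f h)

attribute [instance] VBundle.addCommGroup VBundle.module VBundle.finite
  VBundle.projective

namespace VBundle

variable {X Y : PointFunctor}

/-- The trivial bundle `𝒪^n`. -/
def trivial (X : PointFunctor) (n : ℕ) : VBundle X where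
  fiber {A} _ := Fin n → A
  res f _ _ _ := piRingHom f.hom.toRingHom n
  res_id _ _ := rfl
  res_comp _ _ _ _ _ _ _ _ _ := rfl
  isBaseChange f _ _ _ := isBaseChangeAlong_pi f.hom.toRingHom n

/-- The pullback of `E` along `φ : Y ⟶ X`. -/
def pullback (φ : Y ⟶ X) (E : VBundle X) : VBundle Y where
  fiber y := E.fiber (φ.app _ y)
  res f _ _ h := E.res f (by rw [← h, NatTrans.naturality_apply])
  res_id _ v := E.res_id _ v
  res_comp f g _ _ _ _ _ _ v := E.res_comp f g _ _ _ v
  isBaseChange f _ _ _ := E.isBaseChange f _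

/-- The direct sum `E ⊕ F`. -/
def directSum (E F : VBundle X) : VBundle X where
  fiber x := E.fiber x × F.fiber x
  res f _ _ h :=
    { toFun := fun v => (E.res f h v.1, F.res f h v.2)
      map_add' := fun _ _ => Prod.ext ((E.res f h).map_add _ _) ((F.res f h).map_add _ _)
      map_smul' := fun _ _ =>
        Prod.ext ((E.res f h).map_smulₛₗ _ _) ((F.res f h).map_smulₛₗ _ _) }
  res_id h v := Prod.ext (E.res_id h v.1) (F.res_id h v.2)
  res_comp f g _ _ _ hf hg hfg v :=
    Prod.ext (E.res_comp f g hf hg hfg v.1) (F.res_comp f g hf hg hfg v.2)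
  isBaseChange f _ _ h := (E.isBaseChange f h).prodMap (F.isBaseChange f h) fun _ _ => rfl

/-- The bundle `Hom(E, F) = E^∨ ⊗ F`. -/
noncomputable def hom (E F : VBundle X) : VBundle X where
  fiber {A} x := E.fiber x →ₗ[A] F.fiber x
  finite _ := finite_linearMap
  projective _ := projective_linearMap
  res f _ _ h := (E.isBaseChange f h).homMap (F.res f h)
  res_id h φ := (E.isBaseChange _ h).hom_ext fun v => by
    rw [IsBaseChangeAlong.homMap_apply, E.res_id, F.res_id]
  res_comp f g _ _ _ hf hg hfg φ := (E.isBaseChange _ hfg).hom_ext fun v => by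
    rw [IsBaseChangeAlong.homMap_apply, E.res_comp f g hf hg hfg, F.res_comp f g hf hg hfg,
      IsBaseChangeAlong.homMap_apply, IsBaseChangeAlong.homMap_apply]
  isBaseChange f _ _ h := (E.isBaseChange f h).isBaseChangeAlong_homMap (F.isBaseChange f h)

/-- The dual bundle `E^∨ = Hom(E, 𝒪)`. -/
noncomputable def dual (E : VBundle X) : VBundle X := E.hom (trivial X 1)

/-- The additive group of global sections of `E`. -/
def sections (E : VBundle X) :
    AddSubgroup (∀ (A : CommAlgCat.{0, 0} ℂ) (x : X.obj A), E.fiber x) where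
  carrier := {s | ∀ {A B : CommAlgCat.{0, 0} ℂ} (f : A ⟶ B) {x : X.obj A} {y : X.obj B}
    (h : X.map f x = y), E.res f h (s A x) = s B y}
  zero_mem' f _ _ h := map_zero (E.res f h)
  add_mem' hs ht _ _ f _ _ h := ((E.res f h).map_add _ _).trans (congrArg₂ _ (hs f h) (ht f h))
  neg_mem' hs _ _ f _ _ h := (map_neg (E.res f h) _).trans (congrArg _ (hs f h))

/-- The space `H⁰(X, E)` of global sections of `E`. -/
abbrev H0 (E : VBundle X) : Type 1 := E.sections

/-- The complex vector space structure of `H⁰(X, E)`, defined pointwise. -/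
noncomputable instance (E : VBundle X) : Module ℂ E.H0 where
  smul c s := ⟨fun A x => algebraMap ℂ A c • s.1 A x, fun f x y h => by
    rw [LinearMap.map_smulₛₗ, s.2 f h]
    exact congrArg (· • s.1 _ y) (f.hom.commutes c)⟩
  one_smul s := Subtype.ext <| funext fun A => funext fun x =>
    show algebraMap ℂ A 1 • s.1 A x = s.1 A x by rw [map_one, one_smul]
  mul_smul c d s := Subtype.ext <| funext fun A => funext fun x =>
    show algebraMap ℂ A (c * d) • s.1 A x = algebraMap ℂ A c • algebraMap ℂ A d • s.1 A x by
      rw [map_mul, mul_smul]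
  smul_zero c := Subtype.ext <| funext fun A => funext fun x =>
    show algebraMap ℂ A c • (0 : E.fiber x) = 0 from smul_zero _
  smul_add c s t := Subtype.ext <| funext fun A => funext fun x =>
    show algebraMap ℂ A c • (s.1 A x + t.1 A x) = _ from smul_add _ _ _
  add_smul c d s := Subtype.ext <| funext fun A => funext fun x =>
    show algebraMap ℂ A (c + d) • s.1 A x
      = algebraMap ℂ A c • s.1 A x + algebraMap ℂ A d • s.1 A x by rw [map_add, add_smul]
  zero_smul s := Subtype.ext <| funext fun A => funext fun x =>
    show algebraMap ℂ A 0 • s.1 A x = 0 by rw [map_zero, zero_smul]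

/-- The scheme-theoretic zero locus of a global section `s` of `E`: the points at which the
pullback of `s` vanishes. -/
def zeroLocus (E : VBundle X) (s : E.H0) : PointFunctor where
  obj A := {x : X.obj A // s.1 A x = 0}
  map f := ↾fun x => ⟨X.map f x.1, by rw [← s.2 f rfl, x.2, map_zero]⟩
  map_id A := ConcreteCategory.hom_ext _ _ fun x => Subtype.ext <|
    show X.map (𝟙 A) x.1 = x.1 by simp
  map_comp f g := ConcreteCategory.hom_ext _ _ fun x => Subtype.ext <|
    show X.map (f ≫ g) x.1 = X.map g (X.map f x.1) by simp

/-- The inclusion of the zero locus. -/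
def zeroLocusι (E : VBundle X) (s : E.H0) : E.zeroLocus s ⟶ X where
  app _ := ↾fun x => x.1

end VBundle

/-! ## Generic sections -/

/-- The algebra of polynomial functions on a complex vector space. -/
def polyFunctions (V : Type*) [AddCommGroup V] [Module ℂ V] : Subalgebra ℂ (V → ℂ) :=
  Algebra.adjoin ℂ (Set.range fun l : Module.Dual ℂ V => (l : V → ℂ))

/-- Zariski open subsets of a complex vector space: complements of common zero sets of families of
polynomial functions. -/
def IsZariskiOpen {V : Type*} [AddCommGroup V] [Module ℂ V] (W : Set V) : Prop :=
  ∃ P ⊆ (polyFunctions V : Set (V → ℂ)), W = {v | ∃ p ∈ P, p v ≠ 0}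

/-! ## Grassmannians and flag varieties -/

/-- A rank `k` subbundle of the `A`-module `M`: a submodule of constant rank `k` with projective
quotient. -/
structure Subbundle (A M : Type) [CommRing A] [AddCommGroup M] [Module A M] (k : ℕ) where
  sub : Submodule A M
  projective_quotient : Module.Projective A (M ⧸ sub)
  rank_eq : ∀ p : PrimeSpectrum A, Module.rankAtStalk sub p = k

namespace Subbundle

attribute [instance] Subbundle.projective_quotient

section

variable {A B M M' : Type} [CommRing A] [CommRing B] [AddCommGroup M] [AddCommGroup M']
  [Module A M] [Module B M'] {f : A →+* B} {k : ℕ}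

@[ext]
theorem ext {S T : Subbundle A M k} (h : S.sub = T.sub) : S = T := by
  cases S; cases T; congr

theorem exists_retraction (S : Subbundle A M k) : ∃ r : M →ₗ[A] S.sub, ∀ m : S.sub, r m = m := by
  obtain ⟨s, hs⟩ :=
    Module.projective_lifting_property S.sub.mkQ LinearMap.id S.sub.mkQ_surjective
  have hd : ∀ m, m - s (S.sub.mkQ m) ∈ S.sub := fun m => by
    rw [← Submodule.Quotient.eq]; exact (LinearMap.congr_fun hs (S.sub.mkQ m)).symm
  refine ⟨(LinearMap.id - s.comp S.sub.mkQ).codRestrict S.sub hd, fun m => Subtype.ext ?_⟩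
  have : S.sub.mkQ (m : M) = 0 := by simp
  change (m : M) - s (S.sub.mkQ m) = m
  rw [this]; simp

theorem finite_sub [Module.Finite A M] (S : Subbundle A M k) : Module.Finite A S.sub := by
  obtain ⟨r, hr⟩ := S.exists_retraction
  exact Module.Finite.of_surjective r fun m => ⟨m, hr m⟩

theorem projective_sub [Module.Projective A M] (S : Subbundle A M k) :
    Module.Projective A S.sub := by
  obtain ⟨r, hr⟩ := S.exists_retraction
  exact Module.Projective.of_split S.sub.subtype r (LinearMap.ext hr)

/-- Base change of subbundles: `S ⊆ M` is sent to the image of `B ⊗[A] S` in `B ⊗[A] M = M'`. -/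
def map [Module.Finite A M] [Module.Projective A M] {τ : M →ₛₗ[f] M'}
    (h : IsBaseChangeAlong f τ) (S : Subbundle A M k) : Subbundle B M' k where
  sub := S.sub.extend τ
  projective_quotient :=
    (isBaseChangeAlong_quotient h S.sub rfl fun _ hm => S.sub.mem_extend hm).projective
  rank_eq p := by
    haveI := S.finite_sub
    haveI := S.projective_sub
    rw [(isBaseChangeAlong_subMap h S.sub rfl fun _ hm => S.sub.mem_extend hm).rankAtStalk_eq,
      S.rank_eq]

end

end Subbundle

section Grassmann

variable {X : PointFunctor} {k : ℕ} {E : VBundle X}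

theorem grassmannBundle_map_eq {A B : CommAlgCat.{0, 0} ℂ} (f : A ⟶ B) {x : X.obj A} {y : X.obj B}
    (h : X.map f x = y) (S : Subbundle A (E.fiber x) k) :
    (⟨X.map f x, S.map (E.isBaseChange f rfl)⟩ : Σ y : X.obj B, Subbundle B (E.fiber y) k) =
      ⟨y, S.map (E.isBaseChange f h)⟩ := by
  subst h; rfl

/-- The Grassmann bundle `Gr_X(k, E)` of rank `k` subbundles of `E`: an `A`-point is an `A`-point
`x` of `X` together with a rank `k` subbundle of the pullback of `E` along `x`. -/
def grassmannBundle (k : ℕ) (E : VBundle X) : PointFunctor where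
  obj A := Σ x : X.obj A, Subbundle A (E.fiber x) k
  map f := ↾fun x => ⟨X.map f x.1, x.2.map (E.isBaseChange f rfl)⟩
  map_id A := by
    refine ConcreteCategory.hom_ext _ _ fun ⟨x, S⟩ => ?_
    refine (grassmannBundle_map_eq (𝟙 A) (y := x) (by simp) S).trans ?_
    refine congrArg (Sigma.mk x) (Subbundle.ext (le_antisymm ?_ ?_))
    · exact Submodule.extend_le _ fun m hm => by rw [E.res_id]; exact hm
    · intro m hm
      rw [← E.res_id (by simp) m]
      exact Submodule.mem_extend _ hm
  map_comp f g := by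
    refine ConcreteCategory.hom_ext _ _ fun ⟨x, S⟩ => ?_
    refine (grassmannBundle_map_eq (f ≫ g) (y := X.map g (X.map f x)) (by simp) S).trans ?_
    refine congrArg (Sigma.mk _) (Subbundle.ext ?_)
    exact (Submodule.extend_extend _ _ (fun m => (E.res_comp f g rfl rfl _ m).symm) S.sub).symm

/-- The projection `Gr_X(k, E) ⟶ X`. -/
def grassmannBundleProj (k : ℕ) (E : VBundle X) : grassmannBundle k E ⟶ X where
  app _ := ↾fun x => x.1

theorem fst_eq_of_map_eq {A B : CommAlgCat.{0, 0} ℂ} {f : A ⟶ B} {x : (grassmannBundle k E).obj A}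
    {y : (grassmannBundle k E).obj B} (h : (grassmannBundle k E).map f x = y) :
    X.map f x.1 = y.1 := by
  subst h; rfl

theorem extend_eq_of_map_eq {A B : CommAlgCat.{0, 0} ℂ} {f : A ⟶ B}
    {x : (grassmannBundle k E).obj A} {y : (grassmannBundle k E).obj B}
    (h : (grassmannBundle k E).map f x = y) :
    x.2.sub.extend (E.res f (fst_eq_of_map_eq h)) = y.2.sub := by
  subst h; rfl

theorem res_mem_of_map_eq {A B : CommAlgCat.{0, 0} ℂ} {f : A ⟶ B}
    {x : (grassmannBundle k E).obj A} {y : (grassmannBundle k E).obj B}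
    (h : (grassmannBundle k E).map f x = y) :
    ∀ v ∈ x.2.sub, E.res f (fst_eq_of_map_eq h) v ∈ y.2.sub := fun v hv => by
  rw [← extend_eq_of_map_eq h]; exact Submodule.mem_extend _ hv

/-- The tautological subbundle on `Gr_X(k, E)`. -/
def tautological (k : ℕ) (E : VBundle X) : VBundle (grassmannBundle k E) where
  fiber x := x.2.sub
  finite x := x.2.finite_sub
  projective x := x.2.projective_sub
  res f x y h := subMap (E.res f (fst_eq_of_map_eq h)) x.2.sub y.2.sub (res_mem_of_map_eq h)
  res_id h v := Subtype.ext (E.res_id (fst_eq_of_map_eq h) v.1)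
  res_comp f g _ _ _ hf hg hfg v := Subtype.ext
    (E.res_comp f g (fst_eq_of_map_eq hf) (fst_eq_of_map_eq hg) (fst_eq_of_map_eq hfg) v.1)
  isBaseChange f x y h := isBaseChangeAlong_subMap (E.isBaseChange f (fst_eq_of_map_eq h)) x.2.sub
    (extend_eq_of_map_eq h) (res_mem_of_map_eq h)

/-- The tautological quotient bundle on `Gr_X(k, E)`. -/
def quotientBundle (k : ℕ) (E : VBundle X) : VBundle (grassmannBundle k E) where
  fiber {A} x := E.fiber x.1 ⧸ x.2.sub
  res f x _ h := x.2.sub.mapQ _ (E.res f (fst_eq_of_map_eq h)) (res_mem_of_map_eq h)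
  res_id {A x} h v := by
    obtain ⟨v, rfl⟩ := x.2.sub.mkQ_surjective v
    exact congrArg x.2.sub.mkQ (E.res_id (fst_eq_of_map_eq h) v)
  res_comp {A B C} f g {x y z} hf hg hfg v := by
    obtain ⟨v, rfl⟩ := x.2.sub.mkQ_surjective v
    exact congrArg z.2.sub.mkQ
      (E.res_comp f g (fst_eq_of_map_eq hf) (fst_eq_of_map_eq hg) (fst_eq_of_map_eq hfg) v)
  isBaseChange f x _ h := isBaseChangeAlong_quotient (E.isBaseChange f (fst_eq_of_map_eq h))
    x.2.sub (extend_eq_of_map_eq h) (res_mem_of_map_eq h)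

/-- The Grassmannian `Gr(k, n)` of `k`-dimensional subspaces of `ℂⁿ`. -/
def Gr (k n : ℕ) : PointFunctor := grassmannBundle k (VBundle.trivial specC n)

/-- The tautological bundle `𝒰` on `Gr(k, n)`, of rank `k`. -/
def tautU (k n : ℕ) : VBundle (Gr k n) := tautological k (VBundle.trivial specC n)

/-- The quotient bundle `𝒬 = 𝒪ⁿ / 𝒰` on `Gr(k, n)`, of rank `n - k`. -/
def tautQ (k n : ℕ) : VBundle (Gr k n) := quotientBundle k (VBundle.trivial specC n)

/-- The submodule of `Aⁿ` given by an `A`-point of `Gr(k, n)`. -/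
def Gr.sub {k n : ℕ} {A : CommAlgCat.{0, 0} ℂ} (x : (Gr k n).obj A) : Submodule A (Fin n → A) :=
  x.2.sub

/-- The flag variety `Fl(a, b, n)` of flags `U₁ ⊆ U₂ ⊆ ℂⁿ` with `dim U₁ = a`, `dim U₂ = b`. -/
def Fl (a b n : ℕ) : PointFunctor where
  obj A := {x : (FunctorToTypes.prod (Gr a n) (Gr b n)).obj A // Gr.sub x.1 ≤ Gr.sub x.2}
  map f := ↾fun x => ⟨(FunctorToTypes.prod (Gr a n) (Gr b n)).map f x.1,
    Submodule.extend_le _ fun _ hm => Submodule.mem_extend _ (x.2 hm)⟩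
  map_id A := ConcreteCategory.hom_ext _ _ fun x => Subtype.ext <|
    ConcreteCategory.congr_hom ((FunctorToTypes.prod (Gr a n) (Gr b n)).map_id A) x.1
  map_comp f g := ConcreteCategory.hom_ext _ _ fun x => Subtype.ext <|
    ConcreteCategory.congr_hom ((FunctorToTypes.prod (Gr a n) (Gr b n)).map_comp f g) x.1

/-- The projection `Fl(a, b, n) ⟶ Gr(a, n)`, `(U₁ ⊆ U₂) ↦ U₁`. -/
def Fl.proj₁ (a b n : ℕ) : Fl a b n ⟶ Gr a n where
  app _ := ↾fun x => x.1.1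

/-- The projection `Fl(a, b, n) ⟶ Gr(b, n)`, `(U₁ ⊆ U₂) ↦ U₂`. -/
def Fl.proj₂ (a b n : ℕ) : Fl a b n ⟶ Gr b n where
  app _ := ↾fun x => x.1.2

/-- The dual `𝒰₁^∨` of the first (rank `a`) tautological bundle on `Fl(a, b, n)`. -/
noncomputable def Fl.dualU₁ (a b n : ℕ) : VBundle (Fl a b n) :=
  ((tautU a n).pullback (Fl.proj₁ a b n)).dual

/-- The second quotient bundle `𝒬₂ = 𝒪ⁿ / 𝒰₂` (of rank `n - b`) on `Fl(a, b, n)`. -/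
def Fl.Q₂ (a b n : ℕ) : VBundle (Fl a b n) :=
  (tautQ b n).pullback (Fl.proj₂ a b n)

/-- The product `Gr(k₁, n₁) × Gr(k₂, n₂)`. -/
abbrev GrProd (k₁ n₁ k₂ n₂ : ℕ) : PointFunctor := FunctorToTypes.prod (Gr k₁ n₁) (Gr k₂ n₂)

/-- The bundle `𝒬 ⊠ 𝒰^∨ = Hom(pr₂^* 𝒰, pr₁^* 𝒬)` on `Gr(k₁, n₁) × Gr(k₂, n₂)`. -/
noncomputable def QboxUdual (k₁ n₁ k₂ n₂ : ℕ) : VBundle (GrProd k₁ n₁ k₂ n₂) :=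
  ((tautU k₂ n₂).pullback FunctorToTypes.prod.snd).hom
    ((tautQ k₁ n₁).pullback FunctorToTypes.prod.fst)

end Grassmann

/-! A complex `n₁ × n₂` matrix `M` gives a section of `Hom(𝒰, 𝒬)` on `Gr(k₁, n₁) × Gr(k₂, n₂)`, the
composite `𝒰 → 𝒪^{n₂} → 𝒪^{n₁} → 𝒬`. Its zero locus consists of the pairs `(U₁, U₂)` with
`M U₂ ⊆ U₁`. In the same way row vectors `t` give sections of `𝒰₁^∨` and column vectors `v` give
sections of `𝒬₂` on a flag variety, with zero loci `t U₁ = 0` and `v ∈ U₂`.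

For matrices of maximal rank the isomorphisms are linear algebra over any `ℂ`-algebra, compatible
with base change.

* If `n₁ = n₂ + 1`, then `M` is injective. An automorphism of `ℂ^{n₁}` moves its image to the
  hyperplane `t = 0`, and `(U₁, U₂)` corresponds to the flag `M U₂ ⊆ U₁`, whose smaller member lies
  in the hyperplane (`nonempty_iso_zeroLocus_dualSection`).
* If `n₂ = n₁ + 1`, then `M` is surjective. An automorphism of `ℂ^{n₂}` moves its kernel to the line
  spanned by `v`, and `(U₁, U₂)` corresponds to the flag `U₂ ⊆ M⁻¹ U₁`, whose larger member contains
  that line (`nonempty_iso_zeroLocus_quotSection`).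
* If `n₂ = n₁ + c`, then `M` is surjective with kernel `ℂ^c`, and `M⁻¹ U₁ ≅ U₁ ⊕ ℂ^c`, so that `U₂`
  is a subbundle of the latter (`exists_iso_zeroLocus_grassmannBundle`).

It remains to see that these sections are generic. Matrices of maximal rank form a Zariski open set,
and a surjective linear map sends Zariski open sets to Zariski open sets (`IsZariskiOpen.image`).
Hence it suffices that every global section comes from a matrix (`homSection_surjective`,
`dualSection_surjective`, `quotSection_surjective`), which is an instance of the Borel–Weil theorem.

A section is determined by its values at complex points: it vanishes if it does so at all local
rings, whose points are spanned by columns of invertible matrices, and these are specializations of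
a universal matrix over a reduced finitely generated algebra (`VBundle.section_eq_zero`). So a
section amounts to functions on `GL_n(ℂ)`, its entries in the bases given by the columns, which
transform by a character under diagonal matrices and are invariant under a Borel subgroup. On each
curve `a ↦ g (1 + a E_{ij})`, which is a point or a projective line minus a point in the flag
variety, such a function is a polynomial of degree at most `0` or `1` according to its weight. Hence
its translates by permutation matrices transform under `GL_n(ℂ)` like coordinate functions, and the
function is a linear form in one column (`exists_eq_sum_col`) or in one row of the inverse
(`exists_eq_sum_row_inv`). -/

/-! ### Functions on the general linear group -/

section BorelWeil

open Matrix Polynomial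

variable {ι R : Type*} [Fintype ι] [DecidableEq ι] [CommRing R]

/-- The elementary matrix `1 + a E_{ij}` as an element of the general linear group. -/
def elemGL {i j : ι} (h : i ≠ j) (a : R) : GL ι R where
  val := transvection i j a
  inv := transvection i j (-a)
  val_inv := by rw [transvection_mul_transvection_same _ _ h]; simp
  inv_val := by rw [transvection_mul_transvection_same _ _ h]; simp

/-- The diagonal matrix with entries `d` as an element of the general linear group. -/
def diagGL (d : ι → Rˣ) : GL ι R where
  val := diagonal fun i => (d i : R)
  inv := diagonal fun i => ((d i)⁻¹ : Rˣ)
  val_inv := by simp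
  inv_val := by simp

@[simp] theorem elemGL_val {i j : ι} (h : i ≠ j) (a : R) :
    (elemGL h a : GL ι R).val = transvection i j a := rfl

@[simp] theorem diagGL_val (d : ι → Rˣ) :
    (diagGL d).val = diagonal fun i => (d i : R) := rfl

theorem swapGL_val (i j : ι) :
    (GeneralLinearGroup.swap R i j).val = Matrix.swap R i j := rfl

theorem mul_swap_apply (g : Matrix ι ι R) (i j k l : ι) :
    (g * Matrix.swap R i j) k l = g k (Equiv.swap i j l) := by
  rcases eq_or_ne l i with rfl | hi
  · simp
  rcases eq_or_ne l j with rfl | hj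
  · simp
  rw [mul_swap_of_ne hi hj, Equiv.swap_apply_of_ne_of_ne hi hj]

theorem mul_transvection_apply (g : Matrix ι ι R) (i j k l : ι) (a : R) :
    (g * transvection i j a) k l = g k l + if l = j then a * g k i else 0 := by
  split_ifs with h
  · subst h; simp
  · simp [h]

/-- Moving a diagonal matrix across a transposition permutes its entries. -/
theorem diagGL_mul_swap (d : ι → Rˣ) (i j : ι) :
    diagGL d * GeneralLinearGroup.swap R i j =
      GeneralLinearGroup.swap R i j * diagGL (d ∘ Equiv.swap i j) := by
  ext k l
  simp only [Units.val_mul, diagGL_val, swapGL_val, mul_swap_apply,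
    mul_diagonal, diagonal_apply, Function.comp_apply]
  rw [← Matrix.one_mul (Matrix.swap R i j), mul_swap_apply, Matrix.one_apply]
  split_ifs with h <;> simp [h]

/-- Moving an elementary matrix across a transposition permutes its indices. -/
theorem elemGL_mul_swap {k l : ι} (h : k ≠ l) (a : R) (i j : ι) :
    elemGL h a * GeneralLinearGroup.swap R i j =
      GeneralLinearGroup.swap R i j *
        elemGL ((Equiv.swap i j).injective.ne h) a := by
  ext p q
  simp only [Units.val_mul, elemGL_val, swapGL_val, mul_swap_apply,
    mul_transvection_apply]
  rw [← Matrix.one_mul (Matrix.swap R i j), mul_swap_apply, mul_swap_apply,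
    ← Matrix.one_mul (transvection k l a), mul_transvection_apply]
  have hq : Equiv.swap i j q = l ↔ q = Equiv.swap i j l := by
    rw [Equiv.swap_apply_eq_iff]
  simp only [hq]
  rw [Equiv.swap_apply_self]

/-- The rational curve `a ↦ g (1 + a E_{ij})` in the flag variety, seen near infinity. -/
theorem elemGL_mul_eq_swap {K : Type*} [Field K] {i j : ι} (h : i ≠ j) (u : Kˣ) :
    elemGL h (u : K) * diagGL (Function.update 1 j u⁻¹) * elemGL h.symm (-1) *
      diagGL (Function.update 1 i (-u)) =
      GeneralLinearGroup.swap K i j * elemGL h ((u⁻¹ : Kˣ) : K) := by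
  ext k l
  simp only [Units.val_mul, elemGL_val, swapGL_val, diagGL_val, mul_diagonal,
    mul_transvection_apply]
  rw [← Matrix.one_mul (Matrix.swap K i j), mul_swap_apply, mul_swap_apply,
    ← Matrix.one_mul (transvection i j (u : K)), mul_transvection_apply, mul_transvection_apply]
  rcases eq_or_ne l j with rfl | hj
  · have := h.symm
    simp [h.symm, Function.update_of_ne, Matrix.one_apply]
    split_ifs <;> simp_all
  rcases eq_or_ne l i with rfl | hi
  · simp [h, Function.update_of_ne, Matrix.one_apply]
    split_ifs <;> simp_all
  · rw [Equiv.swap_apply_of_ne_of_ne hi hj]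
    simp [hi, hj, Function.update_of_ne]

/-- A polynomial `p` with `p(a) = a^e q(1/a)` for a polynomial `q` has degree at most `e`:
sections of `𝒪(e)` on the projective line. -/
theorem natDegree_le_of_eval_eq {K : Type*} [Field K] [Infinite K] {p q : K[X]} {e : ℕ}
    (h : ∀ a : K, a ≠ 0 → p.eval a = a ^ e * q.eval a⁻¹) : p.natDegree ≤ e := by
  have key : X ^ q.natDegree * p = X ^ e * q.reverse := by
    refine Polynomial.eq_of_infinite_eval_eq _ _ (Set.Infinite.mono (s := {0}ᶜ) ?_
      (Set.finite_singleton 0).infinite_compl)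
    intro a ha
    have ha : a ≠ 0 := ha
    letI := invertibleOfNonzero (inv_ne_zero ha)
    have h1 := Polynomial.eval₂_reverse_mul_pow (RingHom.id K) a⁻¹ q
    rw [invOf_eq_inv, inv_inv, ← Polynomial.eval, ← Polynomial.eval] at h1
    change Polynomial.eval a (X ^ q.natDegree * p) = Polynomial.eval a (X ^ e * q.reverse)
    rw [eval_mul, eval_mul, h a ha, ← h1]
    simp only [eval_pow, eval_X, inv_pow]
    field_simp
  rcases eq_or_ne p 0 with rfl | hp
  · simp
  have hd := congrArg natDegree key
  rw [natDegree_mul (by simp) hp, natDegree_X_pow] at hd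
  have h2 := (Polynomial.natDegree_mul_le (p := X ^ e) (q := q.reverse))
  rw [natDegree_X_pow] at h2
  have h3 := q.reverse_natDegree_le
  omega

variable {K : Type*} [Field K]

/-- Right translation by `1 + a E_{ij}`, for all `a`, leaves `c` invariant. -/
def IsElemInvariant (c : GL ι K → K) (i j : ι) : Prop :=
  ∀ (h : i ≠ j) (a : K) (g : GL ι K), c (g * elemGL h a) = c g

/-- `c` restricts to a polynomial function on each curve `a ↦ g (1 + a E_{ij})`. -/
def IsPolynomialOnCurves (c : GL ι K → K) : Prop :=
  ∀ (i j : ι) (h : i ≠ j) (g : GL ι K), ∃ p : K[X], ∀ a, c (g * elemGL h a) = p.eval a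

theorem elemGL_zero {i j : ι} (h : i ≠ j) : (elemGL h 0 : GL ι R) = 1 := by
  ext1; simp

variable {c : GL ι K → K} {m : ι}

/-- The gluing of the two charts of the rational curve `g (1 + a E_{ij})`. -/
theorem apply_mul_elemGL
    (hd : ∀ (g : GL ι K) (d : ι → Kˣ), c (g * diagGL d) = (d m : K) * c g)
    {i j : ι} (h : i ≠ j) (hm : m ≠ i) (hinv : IsElemInvariant c j i) (g : GL ι K) (u : Kˣ) :
    c (g * elemGL h (u : K)) = (if m = j then (u : K) else 1) *
      c (g * GeneralLinearGroup.swap K i j * elemGL h ((u⁻¹ : Kˣ) : K)) := by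
  rw [mul_assoc g, ← elemGL_mul_eq_swap h u, ← mul_assoc, ← mul_assoc, ← mul_assoc, hd,
    hinv h.symm, hd, Function.update_of_ne hm]
  split_ifs with hj
  · subst hj; simp
  · simp [Function.update_of_ne hj]

variable [Infinite K]

/-- A function of weight zero on the curve `g (1 + a E_{ij})` is constant. -/
theorem apply_mul_elemGL_eq_swap (hp : IsPolynomialOnCurves c)
    (hd : ∀ (g : GL ι K) (d : ι → Kˣ), c (g * diagGL d) = (d m : K) * c g)
    {i j : ι} (h : i ≠ j) (hmi : m ≠ i) (hmj : m ≠ j) (hinv : IsElemInvariant c j i)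
    (g : GL ι K) (a : K) : c (g * elemGL h a) = c (g * GeneralLinearGroup.swap K i j) := by
  obtain ⟨p, hp'⟩ := hp i j h g
  obtain ⟨q, hq'⟩ := hp i j h (g * GeneralLinearGroup.swap K i j)
  have hpq : ∀ a : K, a ≠ 0 → p.eval a = a ^ 0 * q.eval a⁻¹ := fun a ha => by
    have := apply_mul_elemGL hd h hmi hinv g (Units.mk0 a ha)
    rw [if_neg hmj, Units.val_inv_eq_inv_val, hq', Units.val_mk0, hp'] at this
    simpa using this
  have hqp : ∀ a : K, a ≠ 0 → q.eval a = a ^ 0 * p.eval a⁻¹ := fun a ha => by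
    rw [hpq _ (inv_ne_zero ha), inv_inv]; simp
  obtain ⟨x, rfl⟩ := natDegree_eq_zero.1 (Nat.le_zero.1 (natDegree_le_of_eval_eq hpq))
  obtain ⟨y, rfl⟩ := natDegree_eq_zero.1 (Nat.le_zero.1 (natDegree_le_of_eval_eq hqp))
  have h0 := hq' 0
  rw [elemGL_zero, mul_one] at h0
  rw [hp', h0]
  simpa using hpq 1 one_ne_zero

/-- A function of weight one on the curve `g (1 + a E_{im})` is linear. -/
theorem apply_mul_elemGL_of_weight_one (hp : IsPolynomialOnCurves c)
    (hd : ∀ (g : GL ι K) (d : ι → Kˣ), c (g * diagGL d) = (d m : K) * c g) {i : ι} (h : i ≠ m)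
    (hinv : IsElemInvariant c m i) (g : GL ι K) (a : K) :
    c (g * elemGL h a) = c g + a * c (g * GeneralLinearGroup.swap K i m) := by
  obtain ⟨p, hp'⟩ := hp i m h g
  obtain ⟨q, hq'⟩ := hp i m h (g * GeneralLinearGroup.swap K i m)
  have hpq : ∀ a : K, a ≠ 0 → p.eval a = a ^ 1 * q.eval a⁻¹ := fun a ha => by
    have := apply_mul_elemGL hd h h.symm hinv g (Units.mk0 a ha)
    rw [if_pos rfl, Units.val_inv_eq_inv_val, hq', Units.val_mk0, hp'] at this
    simpa using this
  have hqp : ∀ a : K, a ≠ 0 → q.eval a = a ^ 1 * p.eval a⁻¹ := fun a ha => by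
    rw [hpq _ (inv_ne_zero ha), inv_inv]; field_simp
  obtain ⟨x, y, rfl⟩ := exists_eq_X_add_C_of_natDegree_le_one (natDegree_le_of_eval_eq hpq)
  obtain ⟨z, w, rfl⟩ := exists_eq_X_add_C_of_natDegree_le_one (natDegree_le_of_eval_eq hqp)
  have h0 := hq' 0
  have h1 := hp' 0
  rw [elemGL_zero, mul_one] at h0 h1
  rw [hp', h0, h1]
  have key : C x * X + C y = C w * X + C z := by
    refine Polynomial.eq_of_infinite_eval_eq _ _ (Set.Infinite.mono (s := {0}ᶜ) ?_
      (Set.finite_singleton 0).infinite_compl)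
    intro a ha
    have ha : a ≠ 0 := ha
    have := hpq a ha
    change Polynomial.eval a (C x * X + C y) = Polynomial.eval a (C w * X + C z)
    rw [this]
    simp only [eval_add, eval_mul, eval_C, eval_X]
    field_simp
    ring
  have hx : x = w := by simpa using congrArg (coeff · 1) key
  simp [hx]
  ring

/-- If one of `1 + a E_{ij}`, `1 + a E_{ji}` leaves `c` invariant and `c` has weight zero at `i`
and `j`, then `c` is invariant under all permutation and elementary matrices in `i` and `j`. -/
theorem isElemInvariant_of_or (hp : IsPolynomialOnCurves c)
    (hd : ∀ (g : GL ι K) (d : ι → Kˣ), c (g * diagGL d) = (d m : K) * c g)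
    {i j : ι} (h : i ≠ j) (hmi : m ≠ i) (hmj : m ≠ j)
    (hinv : IsElemInvariant c i j ∨ IsElemInvariant c j i) :
    IsElemInvariant c i j ∧ ∀ g, c (g * GeneralLinearGroup.swap K i j) = c g := by
  have aux : ∀ {i j : ι}, i ≠ j → m ≠ i → m ≠ j → IsElemInvariant c j i →
      IsElemInvariant c i j ∧ ∀ g, c (g * GeneralLinearGroup.swap K i j) = c g := by
    intro i j h hmi hmj hinv
    have h0 : ∀ g, c (g * GeneralLinearGroup.swap K i j) = c g := fun g => by
      rw [← apply_mul_elemGL_eq_swap hp hd h hmi hmj hinv g 0, elemGL_zero, mul_one]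
    exact ⟨fun h' a g => by rw [apply_mul_elemGL_eq_swap hp hd h' hmi hmj hinv, h0], h0⟩
  rcases hinv with hinv | hinv
  · have := aux h.symm hmj hmi hinv
    refine ⟨hinv, fun g => ?_⟩
    rw [← this.2 g]
    congr 2
    ext1
    exact Matrix.swap_comm i j
  · exact aux h hmi hmj hinv

/-- The space of global sections of `𝒪(1)` on a projective space, in terms of functions on the
general linear group: a function with the weight of the `m`-th column, invariant under a Borel
subgroup that fixes the line spanned by that column, is a linear form in the `m`-th column. -/
theorem exists_eq_sum_col (hp : IsPolynomialOnCurves c)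
    (hd : ∀ (g : GL ι K) (d : ι → Kˣ), c (g * diagGL d) = (d m : K) * c g)
    (hm : ∀ j, IsElemInvariant c m j)
    (hinv : ∀ i j, i ≠ j → m ≠ i → m ≠ j → IsElemInvariant c i j ∨ IsElemInvariant c j i) :
    ∃ φ : ι → K, ∀ g : GL ι K, c g = ∑ j, φ j * g j m := by
  have hinv' : ∀ i j, m ≠ j → IsElemInvariant c i j := fun i j hj => by
    by_cases hi : m = i
    · subst hi; exact hm j
    · exact fun h => (isElemInvariant_of_or hp hd h hi hj (hinv i j h hi hj)).1 h
  have hswap : ∀ i j, m ≠ i → m ≠ j → ∀ g, c (g * GeneralLinearGroup.swap K i j) = c g := by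
    intro i j hi hj g
    by_cases h : i = j
    · subst h
      congr 1
      ext k l
      simp [mul_swap_apply]
    · exact (isElemInvariant_of_or hp hd h hi hj (hinv i j h hi hj)).2 g
  let T : ι → GL ι K → K := fun i g => c (g * GeneralLinearGroup.swap K i m)
  -- The functions `T i` span a copy of the standard representation; this is checked on
  -- diagonal and elementary matrices.
  have key : ∀ M : Matrix ι ι K, M.det ≠ 0 → ∀ h : GL ι K, h.val = M →
      ∀ g i, T i (g * h) = ∑ j, M j i * T j g := by
    intro M hM
    refine diagonal_transvection_induction_of_det_ne_zero
      (fun M => ∀ h : GL ι K, h.val = M → ∀ g i, T i (g * h) = ∑ j, M j i * T j g)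
      M hM ?_ ?_ ?_
    · intro D hD h hh g i
      have hDi : ∀ i, D i ≠ 0 := by
        rw [det_diagonal] at hD
        exact fun i => Finset.prod_ne_zero_iff.1 hD i (Finset.mem_univ i)
      obtain rfl : h = diagGL fun i => Units.mk0 (D i) (hDi i) := by
        ext1; rw [hh]; simp
      rw [Finset.sum_eq_single i (by intro j _ hj; simp [hj]) (by simp)]
      simp only [T]
      rw [mul_assoc, diagGL_mul_swap, ← mul_assoc, hd]
      simp
    · rintro ⟨k, l, hkl, a⟩ h hh g i
      obtain rfl : h = elemGL hkl a := by
        ext1; rw [hh]; rfl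
      have hsum : ∑ j, (TransvectionStruct.mk k l hkl a).toMatrix j i * T j g =
          T i g + if i = l then a * T k g else 0 := by
        have h1 : ∀ j, (TransvectionStruct.mk k l hkl a).toMatrix j i =
            (1 : Matrix ι ι K) j i + if i = l then a * (1 : Matrix ι ι K) j k else 0 := by
          intro j
          rw [TransvectionStruct.toMatrix_mk, ← Matrix.one_mul (transvection k l a),
            mul_transvection_apply]
        simp only [h1]
        split_ifs <;> simp [add_mul, Finset.sum_add_distrib, Matrix.one_apply]
      rw [hsum]
      simp only [T]
      rw [mul_assoc, elemGL_mul_swap, ← mul_assoc]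
      by_cases hil : i = l
      · subst hil
        rw [if_pos rfl]
        have hne : Equiv.swap i m k ≠ m := fun e => hkl (by
          rwa [Equiv.swap_apply_eq_iff, Equiv.swap_apply_right] at e)
        have h2 : ∀ (x : ι) (hx : Equiv.swap i m k ≠ x), x = m → ∀ g,
            c (g * elemGL hx a) =
              c g + a * c (g * GeneralLinearGroup.swap K (Equiv.swap i m k) m) := by
          rintro x hx rfl g
          exact apply_mul_elemGL_of_weight_one hp hd hx (hm _) g a
        rw [h2 _ _ (Equiv.swap_apply_left i m)]
        congr 2
        by_cases hkm : k = m
        · subst hkm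
          rw [Equiv.swap_apply_right, mul_assoc]
          refine congrArg c (congrArg (g * ·) (Units.ext ?_))
          exact (Matrix.swap_mul_self i k).trans (by simp [Matrix.swap])
        · rw [Equiv.swap_apply_of_ne_of_ne hkl hkm]
          by_cases him : i = m
          · subst him
            congr 2
            ext p q
            simp [mul_swap_apply]
          · rw [← hswap i k (Ne.symm him) (Ne.symm hkm) (g * GeneralLinearGroup.swap K k m)]
            refine congrArg c (Units.ext (Matrix.ext fun p q => ?_))
            simp only [Units.val_mul, swapGL_val, mul_swap_apply]
            have h3 : i ≠ k := hkl.symm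
            simp only [Equiv.swap_apply_def]
            split_ifs <;> simp_all
      · rw [if_neg hil, add_zero]
        refine hinv' _ _ (fun e => hil ?_) _ a _
        rw [eq_comm, Equiv.swap_apply_eq_iff, Equiv.swap_apply_right] at e
        exact e.symm
    · intro A B hA hB ihA ihB h hh g i
      obtain ⟨x, hx⟩ : ∃ x : GL ι K, x.val = A := ⟨GeneralLinearGroup.mkOfDetNeZero A hA, rfl⟩
      obtain ⟨y, hy⟩ : ∃ y : GL ι K, y.val = B := ⟨GeneralLinearGroup.mkOfDetNeZero B hB, rfl⟩
      obtain rfl : h = x * y := by ext1; rw [hh, Units.val_mul, hx, hy]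
      rw [← mul_assoc, ihB y hy]
      simp only [ihA x hx, Matrix.mul_apply, Finset.sum_mul, Finset.mul_sum]
      rw [Finset.sum_comm]
      exact Finset.sum_congr rfl fun _ _ => Finset.sum_congr rfl fun _ _ => by ring
  refine ⟨fun j => T j 1, fun g => ?_⟩
  have h1 := key g.val g.det_ne_zero g rfl 1 m
  have h2 : T m (1 * g) = c g := by
    simp only [T, one_mul]
    congr 1
    ext p q
    simp [mul_swap_apply]
  rw [← h2, h1]
  exact Finset.sum_congr rfl fun _ _ => mul_comm _ _

/-- The contragredient `(g⁻¹)ᵀ` of an invertible matrix. -/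
def contragredient (g : GL ι R) : GL ι R where
  val := g⁻¹.valᵀ
  inv := g.valᵀ
  val_inv := by rw [← transpose_mul, g.mul_inv, transpose_one]
  inv_val := by rw [← transpose_mul, g.inv_mul, transpose_one]

theorem contragredient_contragredient (g : GL ι R) :
    contragredient (contragredient g) = g := rfl

theorem contragredient_mul (g h : GL ι R) :
    contragredient (g * h) = contragredient g * contragredient h := by
  refine Units.ext ?_
  change ((g * h)⁻¹).valᵀ = _
  rw [_root_.mul_inv_rev, Units.val_mul, transpose_mul]
  rfl

theorem contragredient_elemGL {i j : ι} (h : i ≠ j) (a : R) :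
    contragredient (elemGL h a) = elemGL h.symm (-a) := by
  refine Units.ext ?_
  change (transvection i j (-a))ᵀ = transvection j i (-a)
  simp [transvection, transpose_add]

theorem contragredient_diagGL (d : ι → Rˣ) :
    contragredient (diagGL d) = diagGL fun i => (d i)⁻¹ := by
  refine Units.ext ?_
  change (diagonal fun i => (((d i)⁻¹ : Rˣ) : R))ᵀ = _
  simp

/-- The dual form of `exists_eq_sum_col`: a function with the weight of the `m`-th row of the
inverse, invariant under a Borel subgroup that fixes the line spanned by that row, is a linear
form in the `m`-th row of the inverse. -/
theorem exists_eq_sum_row_inv (hp : IsPolynomialOnCurves c)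
    (hd : ∀ (g : GL ι K) (d : ι → Kˣ), c (g * diagGL d) = ((d m)⁻¹ : Kˣ) * c g)
    (hm : ∀ j, IsElemInvariant c j m)
    (hinv : ∀ i j, i ≠ j → m ≠ i → m ≠ j → IsElemInvariant c i j ∨ IsElemInvariant c j i) :
    ∃ φ : ι → K, ∀ g : GL ι K, c g = ∑ j, g⁻¹.val m j * φ j := by
  have htr : ∀ i j, IsElemInvariant c j i →
      IsElemInvariant (fun g => c (contragredient g)) i j := by
    intro i j hij h a g
    simp only
    rw [contragredient_mul, contragredient_elemGL]
    exact hij h.symm (-a) _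
  obtain ⟨φ, hφ⟩ := exists_eq_sum_col (c := fun g => c (contragredient g)) (m := m)
    (fun i j h g => by
      obtain ⟨p, hp'⟩ := hp j i h.symm (contragredient g)
      refine ⟨p.comp (-X), fun a => ?_⟩
      change c (contragredient (g * elemGL h a)) = _
      rw [contragredient_mul, contragredient_elemGL, hp']
      simp)
    (fun g d => by
      rw [contragredient_mul, contragredient_diagGL, hd, inv_inv])
    (fun j => htr m j (hm j))
    (fun i j h hi hj => (hinv i j h hi hj).symm.imp (htr i j) (htr j i))
  refine ⟨φ, fun g => ?_⟩
  have := hφ (contragredient g)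
  simp only [contragredient_contragredient] at this
  rw [this]
  exact Finset.sum_congr rfl fun _ _ => mul_comm _ _

end BorelWeil

/-! ### Subbundles spanned by the columns of an invertible matrix -/

section Frames

variable {A B M : Type} [CommRing A] [CommRing B] [AddCommGroup M] [Module A M]

theorem projective_quotient_of_retraction [Module.Projective A M] {S : Submodule A M}
    (p : M →ₗ[A] M) (hp : ∀ m, p m ∈ S) (hp' : ∀ m ∈ S, p m = m) :
    Module.Projective A (M ⧸ S) := by
  refine Module.Projective.of_split (S.liftQ (LinearMap.id - p) fun m hm => ?_) S.mkQ ?_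
  · simp [hp' m hm]
  · ext m
    simp [hp m]

theorem Module.Basis.rankAtStalk_span {n k : ℕ} (b : Module.Basis (Fin n) A M) (hk : k ≤ n)
    (p : PrimeSpectrum A) :
    Module.rankAtStalk
      (Submodule.span A (Set.range fun j : Fin k => b (Fin.castLE hk j))) p = k := by
  haveI : Nontrivial A := p.nontrivial
  have hli := b.linearIndependent.comp (Fin.castLE hk) (Fin.castLE_injective hk)
  haveI := Module.Free.of_basis (Module.Basis.span hli)
  have hfr := finrank_span_eq_card hli
  change Module.rankAtStalk
      (Submodule.span A (Set.range (b ∘ Fin.castLE hk))) p = k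
  haveI : Module.Finite A (Submodule.span A (Set.range (b ∘ Fin.castLE hk))) :=
    Module.Finite.of_basis (Module.Basis.span hli)
  rw [Module.rankAtStalk_eq_finrank_of_free]
  simpa using hfr

/-- The subbundle spanned by the first `k` vectors of a basis. -/
def Subbundle.ofBasis {n k : ℕ} (b : Module.Basis (Fin n) A M) (hk : k ≤ n) :
    Subbundle A M k where
  sub := Submodule.span A (Set.range fun j : Fin k => b (Fin.castLE hk j))
  projective_quotient := by
    haveI := Module.Projective.of_basis b
    refine projective_quotient_of_retraction
      (b.constr A fun j => if (j : ℕ) < k then b j else 0) (fun m => ?_) fun m hm => ?_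
    · rw [b.constr_apply_fintype A]
      refine Submodule.sum_mem _ fun j _ => Submodule.smul_mem _ _ ?_
      split_ifs with h
      · exact Submodule.subset_span ⟨⟨j, h⟩, rfl⟩
      · exact zero_mem _
    · induction hm using Submodule.span_induction with
      | mem x hx => obtain ⟨j, rfl⟩ := hx; rw [b.constr_basis]; exact if_pos j.2
      | zero => simp
      | add x y _ _ hx hy => rw [map_add, hx, hy]
      | smul a x _ hx => rw [map_smul, hx]
  rank_eq := b.rankAtStalk_span hk

variable {n k : ℕ}

/-- The basis of `Aⁿ` given by the columns of an invertible matrix. -/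
noncomputable def colBasis (g : GL (Fin n) A) : Module.Basis (Fin n) A (Fin n → A) :=
  (Pi.basisFun A (Fin n)).map
    (Matrix.toLin'OfInv (M := g⁻¹.val) (M' := g.val) g.inv_mul g.mul_inv)

theorem colBasis_apply (g : GL (Fin n) A) (j : Fin n) : colBasis g j = g.val.col j := by
  simp [colBasis, Matrix.toLin'OfInv]

theorem colBasis_repr (g : GL (Fin n) A) (v : Fin n → A) (i : Fin n) :
    (colBasis g).repr v i = (g⁻¹.val.mulVec v) i := by
  simp [colBasis, Matrix.toLin'OfInv]

/-- The subbundle of `Aⁿ` spanned by the first `k` columns of `g`. -/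
noncomputable def frame (hk : k ≤ n) (g : GL (Fin n) A) : Subbundle A (Fin n → A) k :=
  .ofBasis (colBasis g) hk

theorem frame_sub (hk : k ≤ n) (g : GL (Fin n) A) :
    (frame hk g).sub =
      Submodule.span A (Set.range fun j : Fin k => g.val.col (Fin.castLE hk j)) := by
  simp only [frame, Subbundle.ofBasis, colBasis_apply]

theorem col_mem_frame (hk : k ≤ n) (g : GL (Fin n) A) {j : Fin n} (hj : (j : ℕ) < k) :
    g.val.col j ∈ (frame hk g).sub := by
  rw [frame_sub]
  exact Submodule.subset_span ⟨⟨j, hj⟩, rfl⟩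

theorem frame_le_iff (hk : k ≤ n) (g : GL (Fin n) A) (S : Submodule A (Fin n → A)) :
    (frame hk g).sub ≤ S ↔ ∀ j : Fin n, (j : ℕ) < k → g.val.col j ∈ S := by
  rw [frame_sub, Submodule.span_le]
  constructor
  · exact fun h j hj => h ⟨⟨j, hj⟩, rfl⟩
  · rintro h _ ⟨j, rfl⟩
    exact h _ j.2

theorem frame_le_frame {l : ℕ} (hk : k ≤ n) (hl : l ≤ n) (hkl : k ≤ l) (g : GL (Fin n) A) :
    (frame hk g).sub ≤ (frame hl g).sub :=
  (frame_le_iff hk g _).2 fun _ hj => col_mem_frame hl g (hj.trans_le hkl)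

theorem frame_extend (f : A →+* B) (hk : k ≤ n) (g : GL (Fin n) A) :
    (frame hk g).sub.extend (piRingHom f n) =
      (frame hk (Matrix.GeneralLinearGroup.map f g)).sub := by
  apply le_antisymm
  · have h := (frame_le_iff hk g (Submodule.comap (piRingHom f n)
      (frame hk (Matrix.GeneralLinearGroup.map f g)).sub)).2
      fun j hj => col_mem_frame hk (Matrix.GeneralLinearGroup.map f g) hj
    exact Submodule.extend_le _ fun m hm => h hm
  · rw [frame_le_iff]
    exact fun j hj => Submodule.mem_extend (τ := piRingHom f n) _ (col_mem_frame hk g hj)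

theorem frame_mul_le (hk : k ≤ n) (g h : GL (Fin n) A)
    (hh : ∀ i j : Fin n, (j : ℕ) < k → k ≤ i → h.val i j = 0) :
    (frame hk (g * h)).sub ≤ (frame hk g).sub := by
  rw [frame_le_iff]
  intro j hj
  have : (g * h).val.col j = ∑ i, h.val i j • g.val.col i := by
    ext l
    simp [Matrix.mul_apply, mul_comm, Matrix.col]
  rw [this]
  refine Submodule.sum_mem _ fun i _ => ?_
  by_cases hi : (i : ℕ) < k
  · exact Submodule.smul_mem _ _ (col_mem_frame hk g hi)
  · rw [hh i j hj (not_lt.1 hi), zero_smul]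
    exact zero_mem _

/-- Block triangular matrices stabilize the standard subspaces. -/
theorem frame_mul (hk : k ≤ n) (g h : GL (Fin n) A)
    (hh : ∀ i j : Fin n, (j : ℕ) < k → k ≤ i → h.val i j = 0 ∧ h⁻¹.val i j = 0) :
    frame hk (g * h) = frame hk g := by
  refine Subbundle.ext (le_antisymm (frame_mul_le hk g h fun i j hj hi => (hh i j hj hi).1) ?_)
  have := frame_mul_le hk (g * h) h⁻¹ fun i j hj hi => (hh i j hj hi).2
  rwa [mul_inv_cancel_right] at this

theorem frame_mul_elemGL (hk : k ≤ n) (g : GL (Fin n) A) {i j : Fin n} (h : i ≠ j) (a : A)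
    (hij : (j : ℕ) < k → (i : ℕ) < k) : frame hk (g * elemGL h a) = frame hk g := by
  refine frame_mul hk g _ fun i' j' hj hi => ?_
  have h1 : ∀ a : A, Matrix.transvection i j a i' j' = 0 := fun a => by
    have h2 : i' ≠ j' := by rintro rfl; omega
    have h3 : ¬ (i = i' ∧ j = j') := by rintro ⟨rfl, rfl⟩; have := hij hj; omega
    simp [Matrix.transvection, h2, h3]
  exact ⟨h1 a, h1 (-a)⟩

theorem frame_mul_diagGL (hk : k ≤ n) (g : GL (Fin n) A) (d : Fin n → Aˣ) :
    frame hk (g * diagGL d) = frame hk g := by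
  refine frame_mul hk g _ fun i' j' hj hi => ?_
  have h2 : i' ≠ j' := by rintro rfl; omega
  exact ⟨Matrix.diagonal_apply_ne _ h2, Matrix.diagonal_apply_ne _ h2⟩

theorem frame_mul_swap (hk : k ≤ n) (g : GL (Fin n) A) {i j : Fin n}
    (hij : (i : ℕ) < k ↔ (j : ℕ) < k) :
    frame hk (g * Matrix.GeneralLinearGroup.swap A i j) = frame hk g := by
  refine frame_mul hk g _ fun i' j' hj hi => ?_
  have h1 : Matrix.swap A i j i' j' = 0 := by
    rw [← Matrix.one_mul (Matrix.swap A i j), mul_swap_apply]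
    refine Matrix.one_apply_ne ?_
    rintro rfl
    rw [Equiv.swap_apply_def] at hi
    split_ifs at hi <;> subst_vars <;> omega
  exact ⟨h1, h1⟩

/-- The linear form on `Aⁿ` that reads off the `l`-th coordinate with respect to the columns
of `g`. -/
noncomputable def rowInv (g : GL (Fin n) A) (l : Fin n) : (Fin n → A) →ₗ[A] A :=
  (LinearMap.proj l).comp g⁻¹.val.mulVecLin

theorem rowInv_apply (g : GL (Fin n) A) (l : Fin n) (v : Fin n → A) :
    rowInv g l v = ∑ j, g⁻¹.val l j * v j := rfl

theorem rowInv_col (g : GL (Fin n) A) (l j : Fin n) :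
    rowInv g l (g.val.col j) = (1 : Matrix (Fin n) (Fin n) A) l j := by
  rw [← g.inv_mul, Matrix.mul_apply]
  rfl

theorem rowInv_eq_zero (hk : k ≤ n) (g : GL (Fin n) A) {l : Fin n} (hl : k ≤ l)
    {v : Fin n → A} (hv : v ∈ (frame hk g).sub) : rowInv g l v = 0 := by
  have : (frame hk g).sub ≤ LinearMap.ker (rowInv g l) := by
    rw [frame_le_iff]
    intro j hj
    rw [LinearMap.mem_ker, rowInv_col, Matrix.one_apply_ne]
    rintro rfl; omega
  exact this hv

theorem mem_frame_iff (hk : k ≤ n) (g : GL (Fin n) A) (v : Fin n → A) :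
    v ∈ (frame hk g).sub ↔ ∀ l : Fin n, k ≤ l → rowInv g l v = 0 := by
  refine ⟨fun h l hl => rowInv_eq_zero hk g hl h, fun h => ?_⟩
  rw [← (colBasis g).sum_repr v]
  refine Submodule.sum_mem _ fun i _ => ?_
  by_cases hi : (i : ℕ) < k
  · rw [colBasis_apply]
    exact Submodule.smul_mem _ _ (col_mem_frame hk g hi)
  · rw [colBasis_repr]
    have := h i (not_lt.1 hi)
    change g⁻¹.val.mulVec v i = 0 at this
    rw [this, zero_smul]
    exact zero_mem _

theorem exists_GL_of_basis (b : Module.Basis (Fin n) A (Fin n → A)) :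
    ∃ g : GL (Fin n) A, colBasis g = b := by
  refine ⟨⟨(Pi.basisFun A (Fin n)).toMatrix b, b.toMatrix (Pi.basisFun A (Fin n)),
    Module.Basis.toMatrix_mul_toMatrix_flip _ _, Module.Basis.toMatrix_mul_toMatrix_flip _ _⟩,
    Module.Basis.eq_of_apply_eq fun j => ?_⟩
  rw [colBasis_apply]
  ext i
  simp [Matrix.col, Module.Basis.toMatrix_apply]

section Local

variable [IsLocalRing A]

/-- Over a local ring a basis of a direct summand extends to a basis. -/
theorem exists_basis_extending [Module.Finite A M] [Module.Projective A M]
    (hn : Module.finrank A M = n) {S : Submodule A M} (r : M →ₗ[A] S) (hr : ∀ m : S, r m = m)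
    (bS : Module.Basis (Fin k) A S) :
    ∃ (hkn : k ≤ n) (b : Module.Basis (Fin n) A M), ∀ i : Fin k, b (Fin.castLE hkn i) = bS i := by
  have hc : IsCompl S (LinearMap.ker r) := LinearMap.isCompl_of_proj hr
  let e := Submodule.prodEquivOfIsCompl _ _ hc
  haveI : Module.Projective A (LinearMap.ker r) :=
    Module.Projective.of_split (LinearMap.ker r).subtype
      (LinearMap.snd A _ _ ∘ₗ e.symm.toLinearMap) (by ext m; simp [e])
  haveI : Module.Finite A (LinearMap.ker r) :=
    Module.Finite.of_surjective (LinearMap.snd A _ _ ∘ₗ e.symm.toLinearMap)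
      (Prod.snd_surjective.comp e.symm.surjective)
  haveI : Module.Free A (LinearMap.ker r) := Module.free_of_flat_of_isLocalRing
  let b := ((bS.prod (Module.finBasis A (LinearMap.ker r))).map e).reindex finSumFinEquiv
  have hcard : k + Module.finrank A (LinearMap.ker r) = n := by
    rw [← hn, Module.finrank_eq_card_basis b, Fintype.card_fin]
  refine ⟨by omega, b.reindex (finCongr hcard), fun i => ?_⟩
  have : (finCongr hcard).symm (Fin.castLE (by omega) i) = Fin.castAdd _ i := rfl
  rw [Module.Basis.reindex_apply, this, Module.Basis.reindex_apply,
    finSumFinEquiv_symm_apply_castAdd]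
  simp [e]

theorem Subbundle.finrank_sub [Module.Finite A M] [Module.Projective A M] (S : Subbundle A M k) :
    Module.finrank A S.sub = k := by
  haveI := S.finite_sub
  haveI := S.projective_sub
  haveI : Module.Free A S.sub := Module.free_of_flat_of_isLocalRing
  have h := S.rank_eq (IsLocalRing.closedPoint A)
  rw [Module.rankAtStalk_eq_finrank_of_free] at h
  simpa using h

/-- Over a local ring a flag of subbundles has an adapted basis. -/
theorem exists_basis_flag {l : ℕ} [Module.Finite A M] [Module.Projective A M]
    (hn : Module.finrank A M = n) (S : Subbundle A M k) (T : Subbundle A M l) (h : S.sub ≤ T.sub) :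
    ∃ (hk : k ≤ n) (hl : l ≤ n) (b : Module.Basis (Fin n) A M),
      S.sub = (Subbundle.ofBasis b hk).sub ∧ T.sub = (Subbundle.ofBasis b hl).sub := by
  haveI := S.finite_sub
  haveI := S.projective_sub
  haveI : Module.Free A S.sub := Module.free_of_flat_of_isLocalRing
  haveI := T.finite_sub
  haveI := T.projective_sub
  obtain ⟨r, hr⟩ := S.exists_retraction
  obtain ⟨r', hr'⟩ := T.exists_retraction
  let bS : Module.Basis (Fin k) A S.sub := Module.finBasisOfFinrankEq A _ S.finrank_sub
  let e := Submodule.submoduleOfEquivOfLe h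
  obtain ⟨hkl, bT, hbT⟩ := exists_basis_extending T.finrank_sub
    (e.symm.toLinearMap ∘ₗ r ∘ₗ T.sub.subtype)
    (fun m => by
      change e.symm (r (e m : M)) = m
      rw [hr, e.symm_apply_apply])
    (bS.map e.symm)
  obtain ⟨hln, b, hb⟩ := exists_basis_extending hn r' hr' bT
  have hspan : ∀ {j : ℕ} {U : Submodule A M} (bU : Module.Basis (Fin j) A U) (c : Fin j → M),
      (∀ i, c i = bU i) → U = Submodule.span A (Set.range c) := by
    intro j U bU c hc
    have h1 := congrArg (Submodule.map U.subtype) bU.span_eq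
    rw [Submodule.map_span, Submodule.map_top, Submodule.range_subtype, ← Set.range_comp] at h1
    rw [← h1]
    congr 2
    exact funext fun i => (hc i).symm
  refine ⟨hkl.trans hln, hln, b, hspan bS _ fun i => ?_, hspan bT _ hb⟩
  have h1 := hb (Fin.castLE hkl i)
  rw [hbT] at h1
  exact h1

/-- Over a local ring every flag is spanned by initial columns of an invertible matrix. -/
theorem exists_frame_flag {l : ℕ} (S : Subbundle A (Fin n → A) k) (T : Subbundle A (Fin n → A) l)
    (h : S.sub ≤ T.sub) : ∃ (hk : k ≤ n) (hl : l ≤ n) (g : GL (Fin n) A),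
      S = frame hk g ∧ T = frame hl g := by
  obtain ⟨hk, hl, b, hS, hT⟩ := exists_basis_flag (n := n) (by simp) S T h
  obtain ⟨g, rfl⟩ := exists_GL_of_basis b
  exact ⟨hk, hl, g, Subbundle.ext hS, Subbundle.ext hT⟩

end Local

end Frames

/-! ### Sections are determined by their values at complex points -/

section Points

variable {A B : CommAlgCat.{0, 0} ℂ} {k n : ℕ}

/-- The base change of an invertible matrix. -/
def mapGL (f : A ⟶ B) (g : GL (Fin n) A) : GL (Fin n) B :=
  Matrix.GeneralLinearGroup.map f.hom.toRingHom g

theorem mapGL_inv (f : A ⟶ B) (g : GL (Fin n) A) : mapGL f g⁻¹ = (mapGL f g)⁻¹ :=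
  map_inv _ g

/-- The point of `Gr(k, n)` given by the span of the first `k` columns of `g`. -/
noncomputable def grPt (hk : k ≤ n) (g : GL (Fin n) A) : (Gr k n).obj A :=
  ⟨PUnit.unit, frame hk g⟩

theorem map_grPt (hk : k ≤ n) (f : A ⟶ B) (g : GL (Fin n) A) :
    (Gr k n).map f (grPt hk g) = grPt hk (mapGL f g) :=
  congrArg (Sigma.mk PUnit.unit) (Subbundle.ext (frame_extend f.hom.toRingHom hk g))

/-- The point of `Fl(a, b, n)` given by the spans of the first `a` and the first `b` columns
of `g`. -/
noncomputable def flPt {a b : ℕ} (hab : a ≤ b) (hb : b ≤ n) (g : GL (Fin n) A) :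
    (Fl a b n).obj A :=
  ⟨(grPt (hab.trans hb) g, grPt hb g), frame_le_frame (hab.trans hb) hb hab g⟩

theorem map_flPt {a b : ℕ} (hab : a ≤ b) (hb : b ≤ n) (f : A ⟶ B) (g : GL (Fin n) A) :
    (Fl a b n).map f (flPt hab hb g) = flPt hab hb (mapGL f g) :=
  Subtype.ext (Prod.ext (map_grPt (hab.trans hb) f g) (map_grPt hb f g))

theorem exists_eq_flPt {a b : ℕ} (hab : a ≤ b) (hb : b ≤ n) [IsLocalRing A]
    (x : (Fl a b n).obj A) : ∃ g : GL (Fin n) A, x = flPt hab hb g := by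
  obtain ⟨⟨⟨⟨⟩, S⟩, ⟨⟨⟩, T⟩⟩, h⟩ := x
  obtain ⟨_, _, g, rfl, rfl⟩ := exists_frame_flag S T h
  exact ⟨g, rfl⟩

theorem exists_eq_grPt (hk : k ≤ n) [IsLocalRing A] (x : (Gr k n).obj A) :
    ∃ g : GL (Fin n) A, x = grPt hk g := by
  obtain ⟨⟨⟩, S⟩ := x
  obtain ⟨_, _, g, rfl, _⟩ := exists_frame_flag S S le_rfl
  exact ⟨g, rfl⟩

end Points

section Vanishing

variable {X : PointFunctor}

/-- A jointly injective family of ring homomorphisms detects the vanishing of elements of a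
finitely generated projective module. -/
theorem VBundle.eq_zero_of_res_eq_zero (E : VBundle X) {A : CommAlgCat.{0, 0} ℂ} (x : X.obj A)
    {J : Type*} (B : J → CommAlgCat.{0, 0} ℂ) (f : ∀ j, A ⟶ B j)
    (hf : ∀ a : A, (∀ j, (f j).hom a = 0) → a = 0) (v : E.fiber x)
    (hv : ∀ j, E.res (f j) rfl v = 0) : v = 0 := by
  obtain ⟨n, p, hp⟩ := Module.Finite.exists_fin' A (E.fiber x)
  obtain ⟨s, hs⟩ := Module.projective_lifting_property p LinearMap.id hp
  have h0 : s v = 0 := by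
    ext i
    refine hf _ fun j => ?_
    have h1 := (E.isBaseChange (f j) rfl).lift_apply
      ((piRingHom (f j).hom.toRingHom n).comp s) v
    rw [hv, map_zero] at h1
    exact (congrFun h1 i).symm
  rw [← LinearMap.id_apply (R := A) v, ← hs, LinearMap.comp_apply, h0, map_zero]

/-- The coordinate ring `R` of `GL_{n₁} × GL_{n₂}`: it carries a universal pair of invertible
matrices, and its elements are determined by their values at the complex points. -/
theorem exists_universal_GL (n₁ n₂ : ℕ) :
    ∃ (R : CommAlgCat.{0, 0} ℂ) (u₁ : GL (Fin n₁) R) (u₂ : GL (Fin n₂) R),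
      (∀ (A : CommAlgCat.{0, 0} ℂ) (g₁ : GL (Fin n₁) A) (g₂ : GL (Fin n₂) A),
        ∃ f : R ⟶ A, mapGL f u₁ = g₁ ∧ mapGL f u₂ = g₂) ∧
      ∀ r : R, (∀ f : R ⟶ CommAlgCat.of ℂ ℂ, f.hom r = 0) → r = 0 := by
  let σ := (Fin n₁ × Fin n₁) ⊕ (Fin n₂ × Fin n₂)
  let M₁ : Matrix (Fin n₁) (Fin n₁) (MvPolynomial σ ℂ) :=
    .of fun i j => MvPolynomial.X (Sum.inl (i, j))
  let M₂ : Matrix (Fin n₂) (Fin n₂) (MvPolynomial σ ℂ) :=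
    .of fun i j => MvPolynomial.X (Sum.inr (i, j))
  let d : MvPolynomial σ ℂ := M₁.det * M₂.det
  let R := Localization.Away d
  -- homomorphisms out of `R`
  have hlift : ∀ (A : Type) [CommRing A] [Algebra ℂ A] (v : σ → A),
      IsUnit (MvPolynomial.aeval v d) →
      ∃ f : R →ₐ[ℂ] A, ∀ p, f (algebraMap (MvPolynomial σ ℂ) R p) = MvPolynomial.aeval v p := by
    intro A _ _ v hv
    have hu : ∀ y : Submonoid.powers d, IsUnit (MvPolynomial.aeval v (y : MvPolynomial σ ℂ)) := by
      rintro ⟨_, m, rfl⟩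
      simpa using hv.pow m
    exact ⟨IsLocalization.liftAlgHom (S := R) hu, fun p => IsLocalization.lift_eq _ p⟩
  have hd : IsUnit (algebraMap _ R d) := IsLocalization.Away.algebraMap_isUnit d
  have hd' : IsUnit (algebraMap (MvPolynomial σ ℂ) R M₁.det) ∧
      IsUnit (algebraMap (MvPolynomial σ ℂ) R M₂.det) := by
    rw [map_mul] at hd
    exact IsUnit.mul_iff.1 hd
  have hdet : ∀ (A : Type) [CommRing A] [Algebra ℂ A] (g₁ : Matrix (Fin n₁) (Fin n₁) A)
      (g₂ : Matrix (Fin n₂) (Fin n₂) A), MvPolynomial.aeval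
        (Sum.elim (fun p => g₁ p.1 p.2) fun p => g₂ p.1 p.2 : σ → A) d = g₁.det * g₂.det := by
    intro A _ _ g₁ g₂
    rw [map_mul, AlgHom.map_det, AlgHom.map_det]
    congr 2 <;> ext i j <;> simp [M₁, M₂]
  have hne : d ≠ 0 := fun h => by
    have := hdet ℂ 1 1
    rw [h] at this
    simp at this
  refine ⟨CommAlgCat.of ℂ R,
    Matrix.GeneralLinearGroup.mk'' (M₁.map (algebraMap _ R))
      (by rw [← RingHom.mapMatrix_apply, ← RingHom.map_det]; exact hd'.1),
    Matrix.GeneralLinearGroup.mk'' (M₂.map (algebraMap _ R))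
      (by rw [← RingHom.mapMatrix_apply, ← RingHom.map_det]; exact hd'.2),
    fun A g₁ g₂ => ?_, fun r hr => ?_⟩
  · obtain ⟨f, hf⟩ := hlift A _ (by
      rw [hdet A g₁.val g₂.val]
      exact ((Matrix.isUnit_iff_isUnit_det _).1 g₁.isUnit).mul
        ((Matrix.isUnit_iff_isUnit_det _).1 g₂.isUnit))
    refine ⟨CommAlgCat.ofHom f, ?_, ?_⟩
    · refine Units.ext (Matrix.ext fun i j => ?_)
      exact (hf (M₁ i j)).trans (by simp [M₁])
    · refine Units.ext (Matrix.ext fun i j => ?_)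
      exact (hf (M₂ i j)).trans (by simp [M₂])
  · obtain ⟨p, ⟨y, hy⟩, rfl⟩ := IsLocalization.exists_mk'_eq (Submonoid.powers d) r
    have hp : p * d = 0 := by
      refine MvPolynomial.funext fun v => ?_
      rw [map_mul, map_zero]
      by_cases hv : MvPolynomial.eval v d = 0
      · rw [hv, mul_zero]
      have hev : ∀ q : MvPolynomial σ ℂ, MvPolynomial.aeval v q = MvPolynomial.eval v q :=
        fun q => congrArg (fun f : MvPolynomial σ ℂ →+* ℂ => f q) (MvPolynomial.coe_aeval_eq_eval v)
      obtain ⟨f, hf⟩ := hlift ℂ v (by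
        rw [hev]; exact isUnit_iff_ne_zero.2 hv)
      have h1 : f (algebraMap _ R p) = 0 := by
        rw [← IsLocalization.mk'_spec R p ⟨y, hy⟩, map_mul]
        rw [show f (IsLocalization.mk' R p ⟨y, hy⟩) = 0 from hr (CommAlgCat.ofHom f), zero_mul]
      rw [hf, hev] at h1
      rw [h1, zero_mul]
    rw [(mul_eq_zero.1 hp).resolve_right hne]
    exact IsLocalization.mk'_zero _

/-- Let every point of `X` with values in a local ring be given by a pair of invertible matrices.
Then a section that vanishes at the complex points vanishes. -/
theorem VBundle.section_eq_zero (E : VBundle X) {n₁ n₂ : ℕ}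
    (P : ∀ {A : CommAlgCat.{0, 0} ℂ}, GL (Fin n₁) A → GL (Fin n₂) A → X.obj A)
    (hP : ∀ {A B : CommAlgCat.{0, 0} ℂ} (f : A ⟶ B) (g₁ : GL (Fin n₁) A) (g₂ : GL (Fin n₂) A),
      X.map f (P g₁ g₂) = P (mapGL f g₁) (mapGL f g₂))
    (hloc : ∀ {A : CommAlgCat.{0, 0} ℂ} [IsLocalRing A] (x : X.obj A), ∃ g₁ g₂, x = P g₁ g₂)
    (s : E.H0)
    (h0 : ∀ (g₁ : GL (Fin n₁) ℂ) (g₂ : GL (Fin n₂) ℂ),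
      s.1 (CommAlgCat.of ℂ ℂ) (P (A := CommAlgCat.of ℂ ℂ) g₁ g₂) = 0) : s = 0 := by
  obtain ⟨R, u₁, u₂, hR, hR'⟩ := exists_universal_GL n₁ n₂
  -- the section vanishes at the universal pair, hence at all local rings, hence everywhere
  have huniv : s.1 R (P u₁ u₂) = 0 := by
    refine E.eq_zero_of_res_eq_zero _ (fun _ : R ⟶ CommAlgCat.of ℂ ℂ => CommAlgCat.of ℂ ℂ)
      (fun f => f) hR' _ fun f => ?_
    rw [s.2 f rfl, hP]
    exact h0 _ _
  refine Subtype.ext (funext fun A => funext fun x => ?_)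
  refine E.eq_zero_of_res_eq_zero x
    (fun p : PrimeSpectrum A => CommAlgCat.of ℂ (Localization.AtPrime p.asIdeal))
    (fun p => CommAlgCat.ofHom (IsScalarTower.toAlgHom ℂ A (Localization.AtPrime p.asIdeal)))
    (fun a ha => ?_) _ fun p => ?_
  · refine Module.eq_zero_of_localization_maximal
      (fun P _ => Localization.AtPrime P) (fun P _ => Algebra.linearMap A _) a fun P hP => ?_
    exact ha ⟨P, hP.isPrime⟩
  · rw [s.2 _ rfl]
    haveI : IsLocalRing (CommAlgCat.of ℂ (Localization.AtPrime p.asIdeal)) :=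
      inferInstanceAs (IsLocalRing (Localization.AtPrime p.asIdeal))
    obtain ⟨g₁, g₂, h⟩ := hloc (X.map (CommAlgCat.ofHom
      (IsScalarTower.toAlgHom ℂ A (Localization.AtPrime p.asIdeal))) x)
    rw [h]
    obtain ⟨f, rfl, rfl⟩ := hR _ g₁ g₂
    rw [← hP, ← s.2 f rfl, huniv, map_zero]

end Vanishing

/-! ### Global sections given by matrices -/

section MatrixSections

variable {A B : CommAlgCat.{0, 0} ℂ} {p q r : ℕ}

/-- The linear map `A^q → A^p` given by a complex matrix. -/
noncomputable def extMat (A : CommAlgCat.{0, 0} ℂ) (M : Matrix (Fin p) (Fin q) ℂ) :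
    (Fin q → A) →ₗ[A] (Fin p → A) :=
  (M.map (algebraMap ℂ A)).mulVecLin

theorem extMat_apply (M : Matrix (Fin p) (Fin q) ℂ) (v : Fin q → A) (i : Fin p) :
    extMat A M v i = ∑ j, algebraMap ℂ A (M i j) * v j := rfl

theorem extMat_res (f : A ⟶ B) (M : Matrix (Fin p) (Fin q) ℂ) (v : Fin q → A) :
    piRingHom f.hom.toRingHom p (extMat A M v) =
      extMat B M (piRingHom f.hom.toRingHom q v) := by
  ext i
  change f.hom (extMat A M v i) = _
  rw [extMat_apply, extMat_apply, map_sum]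
  refine Finset.sum_congr rfl fun j _ => ?_
  rw [map_mul, AlgHom.commutes]
  rfl

theorem extMat_mul (M : Matrix (Fin p) (Fin q) ℂ) (N : Matrix (Fin q) (Fin r) ℂ)
    (v : Fin r → A) : extMat A (M * N) v = extMat A M (extMat A N v) := by
  simp [extMat, Matrix.map_mul]

theorem extMat_one (v : Fin p → A) : extMat A (1 : Matrix (Fin p) (Fin p) ℂ) v = v := by
  simp [extMat, Matrix.map_one]

theorem extMat_add (M N : Matrix (Fin p) (Fin q) ℂ) (v : Fin q → A) :
    extMat A (M + N) v = extMat A M v + extMat A N v := by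
  simp [extMat, Matrix.map_add]

theorem extMat_smul (c : ℂ) (M : Matrix (Fin p) (Fin q) ℂ) (v : Fin q → A) :
    extMat A (c • M) v = algebraMap ℂ A c • extMat A M v := by
  ext i
  simp [extMat_apply, Finset.mul_sum, mul_assoc]

theorem extMat_zero (v : Fin q → A) : extMat A (0 : Matrix (Fin p) (Fin q) ℂ) v = 0 := by
  ext i
  simp [extMat_apply]

/-- The map from matrices to global sections of `𝒬 ⊠ 𝒰^∨`: a matrix gives the composite
`𝒰 → 𝒪^{n₂} → 𝒪^{n₁} → 𝒬`. -/
noncomputable def homSection (k₁ n₁ k₂ n₂ : ℕ) :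
    Matrix (Fin n₁) (Fin n₂) ℂ →ₗ[ℂ] (QboxUdual k₁ n₁ k₂ n₂).H0 where
  toFun M := ⟨fun A x => (Gr.sub x.1).mkQ ∘ₗ extMat A M ∘ₗ (Gr.sub x.2).subtype, fun f x y h => by
    subst h
    refine (((tautU k₂ n₂).pullback FunctorToTypes.prod.snd).isBaseChange f rfl).hom_ext
      fun u => (IsBaseChangeAlong.homMap_apply _ _ u).trans ?_
    exact congrArg (Submodule.mkQ _) (extMat_res f M u.1)⟩
  map_add' M N := Subtype.ext <| funext fun A => funext fun x => LinearMap.ext fun u =>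
    (congrArg (Gr.sub x.1).mkQ (extMat_add M N u.1)).trans
      (map_add (Gr.sub x.1).mkQ _ _)
  map_smul' c M := Subtype.ext <| funext fun A => funext fun x => LinearMap.ext fun u =>
    (congrArg (Gr.sub x.1).mkQ (extMat_smul c M u.1)).trans
      (map_smul (Gr.sub x.1).mkQ _ _)

theorem homSection_apply {k₁ n₁ k₂ n₂ : ℕ} (M : Matrix (Fin n₁) (Fin n₂) ℂ)
    (x : (GrProd k₁ n₁ k₂ n₂).obj A) :
    (homSection k₁ n₁ k₂ n₂ M).1 A x = (Gr.sub x.1).mkQ ∘ₗ extMat A M ∘ₗ (Gr.sub x.2).subtype := rfl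

theorem homSection_eq_zero_iff {k₁ n₁ k₂ n₂ : ℕ} (M : Matrix (Fin n₁) (Fin n₂) ℂ)
    (x : (GrProd k₁ n₁ k₂ n₂).obj A) :
    (homSection k₁ n₁ k₂ n₂ M).1 A x = 0 ↔ ∀ u ∈ Gr.sub x.2, extMat A M u ∈ Gr.sub x.1 := by
  rw [homSection_apply]
  constructor
  · exact fun h u hu => (Submodule.Quotient.mk_eq_zero _).1 (LinearMap.congr_fun h ⟨u, hu⟩)
  · exact fun h => LinearMap.ext fun u => (Submodule.Quotient.mk_eq_zero _).2 (h u.1 u.2)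

/-- The map from row vectors to global sections of `𝒰₁^∨` on a flag variety. -/
noncomputable def dualSection (a b n : ℕ) :
    Matrix (Fin 1) (Fin n) ℂ →ₗ[ℂ] (Fl.dualU₁ a b n).H0 where
  toFun t := ⟨fun A x => extMat A t ∘ₗ (Gr.sub x.1.1).subtype, fun f x y h => by
    subst h
    refine (((tautU a n).pullback (Fl.proj₁ a b n)).isBaseChange f rfl).hom_ext
      fun u => (IsBaseChangeAlong.homMap_apply _ _ u).trans ?_
    exact extMat_res f t u.1⟩
  map_add' M N := Subtype.ext <| funext fun A => funext fun x => LinearMap.ext fun u =>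
    extMat_add M N u.1
  map_smul' c M := Subtype.ext <| funext fun A => funext fun x => LinearMap.ext fun u =>
    extMat_smul c M u.1

theorem dualSection_apply {a b n : ℕ} (t : Matrix (Fin 1) (Fin n) ℂ) (x : (Fl a b n).obj A) :
    (dualSection a b n t).1 A x = extMat A t ∘ₗ (Gr.sub x.1.1).subtype := rfl

theorem dualSection_eq_zero_iff {a b n : ℕ} (t : Matrix (Fin 1) (Fin n) ℂ)
    (x : (Fl a b n).obj A) :
    (dualSection a b n t).1 A x = 0 ↔ ∀ u ∈ Gr.sub x.1.1, extMat A t u = 0 := by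
  rw [dualSection_apply]
  constructor
  · exact fun h u hu => LinearMap.congr_fun h ⟨u, hu⟩
  · exact fun h => LinearMap.ext fun u => h u.1 u.2

/-- The map from column vectors to global sections of `𝒬₂` on a flag variety. -/
noncomputable def quotSection (a b n : ℕ) :
    Matrix (Fin n) (Fin 1) ℂ →ₗ[ℂ] (Fl.Q₂ a b n).H0 where
  toFun v := ⟨fun A x => (Gr.sub x.1.2).mkQ (extMat A v 1), fun f x y h => by
    subst h
    refine congrArg (Submodule.mkQ _) ((extMat_res f v 1).trans (congrArg _ ?_))
    exact funext fun _ => map_one f.hom⟩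
  map_add' M N := Subtype.ext <| funext fun A => funext fun x =>
    (congrArg (Gr.sub x.1.2).mkQ (extMat_add M N 1)).trans
      (map_add (Gr.sub x.1.2).mkQ _ _)
  map_smul' c M := Subtype.ext <| funext fun A => funext fun x =>
    (congrArg (Gr.sub x.1.2).mkQ (extMat_smul c M 1)).trans
      (map_smul (Gr.sub x.1.2).mkQ _ _)

theorem quotSection_apply {a b n : ℕ} (v : Matrix (Fin n) (Fin 1) ℂ) (x : (Fl a b n).obj A) :
    (quotSection a b n v).1 A x = (Gr.sub x.1.2).mkQ (extMat A v 1) := rfl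

theorem quotSection_eq_zero_iff {a b n : ℕ} (v : Matrix (Fin n) (Fin 1) ℂ)
    (x : (Fl a b n).obj A) :
    (quotSection a b n v).1 A x = 0 ↔ extMat A v 1 ∈ Gr.sub x.1.2 := by
  rw [quotSection_apply]
  exact Submodule.Quotient.mk_eq_zero _

end MatrixSections

/-! ### Global sections on products of Grassmannians -/

section Surjectivity

variable {A B : CommAlgCat.{0, 0} ℂ} {n k : ℕ}

/-- A morphism from `GL_n` to the affine line is polynomial on the curves `a ↦ g (1 + a E_{ij})`. -/
theorem isPolynomialOnCurves_of_natural (F : ∀ A : CommAlgCat.{0, 0} ℂ, GL (Fin n) A → A)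
    (hF : ∀ {A B : CommAlgCat.{0, 0} ℂ} (f : A ⟶ B) (g : GL (Fin n) A),
      F B (mapGL f g) = f.hom (F A g)) :
    IsPolynomialOnCurves (K := ℂ) (F (CommAlgCat.of ℂ ℂ)) := by
  intro i j h g
  let R := CommAlgCat.of ℂ (Polynomial ℂ)
  let u : GL (Fin n) R := Matrix.GeneralLinearGroup.map Polynomial.C g *
    elemGL (R := Polynomial ℂ) h Polynomial.X
  refine ⟨F R u, fun a => ?_⟩
  let f : R ⟶ CommAlgCat.of ℂ ℂ := CommAlgCat.ofHom (Polynomial.aeval a)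
  have hu : mapGL f u = g * elemGL h a := by
    refine Units.ext (Matrix.ext fun k l => ?_)
    change Polynomial.aeval a (((Matrix.GeneralLinearGroup.map Polynomial.C g).val *
      Matrix.transvection i j (Polynomial.X : Polynomial ℂ)) k l) =
      (g.val * Matrix.transvection i j a) k l
    rw [mul_transvection_apply, mul_transvection_apply]
    split_ifs
    · simp
      ring
    · simp
  rw [← hu]
  refine (hF f u).trans ?_
  exact congrFun (Polynomial.coe_aeval_eq_eval a) _

theorem col_mul_elemGL_of_ne (g : GL (Fin n) A) {i j m : Fin n} (h : i ≠ j) (hm : m ≠ j) (a : A) :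
    (g * elemGL h a).val.col m = g.val.col m := by
  ext i
  simp [Matrix.col, hm]

theorem col_mul_diagGL (g : GL (Fin n) A) (d : Fin n → Aˣ) (m : Fin n) :
    (g * diagGL d).val.col m = (d m : A) • g.val.col m := by
  ext i
  simp [Matrix.col, mul_comm]

theorem col_mul_swap (g : GL (Fin n) A) (i j : Fin n) :
    (g * Matrix.GeneralLinearGroup.swap A i j).val.col j = g.val.col i := by
  ext i
  simp [Matrix.col]

theorem rowInv_mul_elemGL_of_ne (g : GL (Fin n) A) {i j l : Fin n} (h : i ≠ j) (hl : l ≠ i)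
    (a : A) : rowInv (g * elemGL h a) l = rowInv g l := by
  refine LinearMap.ext fun v => ?_
  rw [rowInv_apply, rowInv_apply, _root_.mul_inv_rev]
  refine Finset.sum_congr rfl fun k _ => congrArg (· * v k) ?_
  change (Matrix.transvection i j (-a) * g⁻¹.val) l k = _
  rw [Matrix.transvection_mul_apply_of_ne _ _ _ _ hl]

theorem rowInv_mul_diagGL (g : GL (Fin n) A) (d : Fin n → Aˣ) (l : Fin n) :
    rowInv (g * diagGL d) l = (((d l)⁻¹ : Aˣ) : A) • rowInv g l := by
  refine LinearMap.ext fun v => ?_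
  rw [LinearMap.smul_apply, rowInv_apply, rowInv_apply, _root_.mul_inv_rev, smul_eq_mul,
    Finset.mul_sum]
  refine Finset.sum_congr rfl fun k _ => ?_
  change (Matrix.diagonal (fun i => (((d i)⁻¹ : Aˣ) : A)) * g⁻¹.val) l k * v k = _
  rw [Matrix.diagonal_mul, mul_assoc]

theorem rowInv_mul_swap (g : GL (Fin n) A) (i j : Fin n) :
    rowInv (g * Matrix.GeneralLinearGroup.swap A i j) j = rowInv g i := by
  refine LinearMap.ext fun v => ?_
  rw [rowInv_apply, rowInv_apply, _root_.mul_inv_rev]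
  refine Finset.sum_congr rfl fun k _ => congrArg (· * v k) ?_
  change (Matrix.swap A i j * g⁻¹.val) j k = _
  simp

theorem rowInv_mapGL (f : A ⟶ B) (g : GL (Fin n) A) (l : Fin n) (v : Fin n → A) :
    rowInv (mapGL f g) l (piRingHom f.hom.toRingHom n v) = f.hom (rowInv g l v) := by
  rw [rowInv_apply, rowInv_apply, map_sum]
  refine Finset.sum_congr rfl fun k _ => ?_
  rw [map_mul, ← mapGL_inv]
  rfl

/-- A linear map on the span of the first `k` columns is determined by its values on them. -/
theorem frame_hom_ext {N : Type} [AddCommGroup N] [Module A N] (hk : k ≤ n) (g : GL (Fin n) A)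
    (φ : (frame hk g).sub →ₗ[A] N)
    (h : ∀ (j : Fin n) (hj : (j : ℕ) < k), φ ⟨g.val.col j, col_mem_frame hk g hj⟩ = 0) :
    φ = 0 := by
  have h1 : (frame hk g).sub ≤ (LinearMap.ker φ).map (frame hk g).sub.subtype := by
    rw [frame_le_iff]
    exact fun j hj => ⟨_, h j hj, rfl⟩
  refine LinearMap.ext fun u => ?_
  obtain ⟨u', hu', e⟩ := h1 u.2
  rw [← Subtype.ext e]
  exact hu'

/-- Elements of the quotient by the span of the first `k` columns are detected by the remaining
coordinates. -/
theorem frame_quotient_ext (hk : k ≤ n) (g : GL (Fin n) A) (q : (Fin n → A) ⧸ (frame hk g).sub)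
    (h : ∀ (l : Fin n) (hl : k ≤ l), (frame hk g).sub.liftQ (rowInv g l)
      (fun _ hv => rowInv_eq_zero hk g hl hv) q = 0) : q = 0 := by
  obtain ⟨v, rfl⟩ := Submodule.mkQ_surjective _ q
  exact (Submodule.Quotient.mk_eq_zero _).2 ((mem_frame_iff hk g v).2 fun l hl => h l hl)

section Hom

variable {k₁ n₁ k₂ n₂ : ℕ}

/-- The value of a section of `Hom(𝒰, 𝒬)` at a point. -/
noncomputable def homValue (s : (QboxUdual k₁ n₁ k₂ n₂).H0) (x : (GrProd k₁ n₁ k₂ n₂).obj A) :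
    Gr.sub x.2 →ₗ[A] (Fin n₁ → A) ⧸ Gr.sub x.1 :=
  s.1 A x

/-- The matrix coefficient `ξ(s(u))` of a section `s` of `Hom(𝒰, 𝒬)`. -/
noncomputable def homCoeff (s : (QboxUdual k₁ n₁ k₂ n₂).H0) (x : (GrProd k₁ n₁ k₂ n₂).obj A)
    (u : Fin n₂ → A) (hu : u ∈ Gr.sub x.2) (ξ : (Fin n₁ → A) →ₗ[A] A)
    (hξ : ∀ v ∈ Gr.sub x.1, ξ v = 0) : A :=
  (Gr.sub x.1).liftQ ξ hξ (homValue s x ⟨u, hu⟩)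

theorem homCoeff_congr (s : (QboxUdual k₁ n₁ k₂ n₂).H0) {x y : (GrProd k₁ n₁ k₂ n₂).obj A}
    (h : x = y) {u u' : Fin n₂ → A} {hu : u ∈ Gr.sub x.2} {hu' : u' ∈ Gr.sub y.2} (e : u = u')
    {ξ ξ' : (Fin n₁ → A) →ₗ[A] A} {hξ : ∀ v ∈ Gr.sub x.1, ξ v = 0}
    {hξ' : ∀ v ∈ Gr.sub y.1, ξ' v = 0} (e' : ξ = ξ') :
    homCoeff s x u hu ξ hξ = homCoeff s y u' hu' ξ' hξ' := by
  subst h e e'; rfl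

theorem homCoeff_smul_left (s : (QboxUdual k₁ n₁ k₂ n₂).H0) {x : (GrProd k₁ n₁ k₂ n₂).obj A}
    {u : Fin n₂ → A} (hu : u ∈ Gr.sub x.2) {ξ : (Fin n₁ → A) →ₗ[A] A}
    (hξ : ∀ v ∈ Gr.sub x.1, ξ v = 0) (a : A) :
    homCoeff s x (a • u) (Submodule.smul_mem _ a hu) ξ hξ = a * homCoeff s x u hu ξ hξ := by
  have h1 : homValue s x ⟨a • u, Submodule.smul_mem _ a hu⟩ = a • homValue s x ⟨u, hu⟩ :=
    map_smul (homValue s x) a ⟨u, hu⟩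
  rw [homCoeff, h1, map_smul, smul_eq_mul, homCoeff]

theorem homCoeff_smul_right (s : (QboxUdual k₁ n₁ k₂ n₂).H0) {x : (GrProd k₁ n₁ k₂ n₂).obj A}
    {u : Fin n₂ → A} (hu : u ∈ Gr.sub x.2) {ξ : (Fin n₁ → A) →ₗ[A] A}
    (hξ : ∀ v ∈ Gr.sub x.1, ξ v = 0) (a : A) :
    homCoeff s x u hu (a • ξ) (fun v hv => by rw [LinearMap.smul_apply, hξ v hv, smul_zero]) =
      a * homCoeff s x u hu ξ hξ := by
  unfold homCoeff
  obtain ⟨v, hv⟩ := (Gr.sub x.1).mkQ_surjective (homValue s x ⟨u, hu⟩)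
  rw [← hv]
  rfl

theorem homCoeff_res (s : (QboxUdual k₁ n₁ k₂ n₂).H0) (f : A ⟶ B)
    {x : (GrProd k₁ n₁ k₂ n₂).obj A} {y : (GrProd k₁ n₁ k₂ n₂).obj B}
    (h : (GrProd k₁ n₁ k₂ n₂).map f x = y) {u : Fin n₂ → A} (hu : u ∈ Gr.sub x.2)
    {ξ : (Fin n₁ → A) →ₗ[A] A} (hξ : ∀ v ∈ Gr.sub x.1, ξ v = 0)
    {u' : Fin n₂ → B} (hu' : u' ∈ Gr.sub y.2) {ξ' : (Fin n₁ → B) →ₗ[B] B}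
    (hξ' : ∀ v ∈ Gr.sub y.1, ξ' v = 0) (e : u' = piRingHom f.hom.toRingHom n₂ u)
    (e' : ∀ v, ξ' (piRingHom f.hom.toRingHom n₁ v) = f.hom (ξ v)) :
    homCoeff s y u' hu' ξ' hξ' = f.hom (homCoeff s x u hu ξ hξ) := by
  subst h e
  have h1 := LinearMap.congr_fun (s.2 f (x := x) rfl)
    (⟨piRingHom f.hom.toRingHom n₂ u, hu'⟩ : Gr.sub _)
  have h2 := IsBaseChangeAlong.homMap_apply
    (σ := ((tautQ k₁ n₁).pullback FunctorToTypes.prod.fst).res f (x := x) rfl)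
    (((tautU k₂ n₂).pullback FunctorToTypes.prod.snd).isBaseChange f (x := x) rfl)
    (homValue s x) (⟨u, hu⟩ : Gr.sub x.2)
  refine (congrArg (Submodule.liftQ _ ξ' hξ') (h1.symm.trans h2)).trans ?_
  have key : ∀ q : (Fin n₁ → A) ⧸ Gr.sub x.1, Submodule.liftQ _ ξ' hξ'
      (((tautQ k₁ n₁).pullback FunctorToTypes.prod.fst).res f (x := x) rfl q) =
      f.hom ((Gr.sub x.1).liftQ ξ hξ q) := fun q => by
    obtain ⟨v, rfl⟩ := (Gr.sub x.1).mkQ_surjective q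
    exact e' v
  exact key _

/-- The point of the product of Grassmannians given by a pair of invertible matrices. -/
noncomputable def prodPt (h₁ : k₁ ≤ n₁) (h₂ : k₂ ≤ n₂) (g₁ : GL (Fin n₁) A) (g₂ : GL (Fin n₂) A) :
    (GrProd k₁ n₁ k₂ n₂).obj A :=
  (grPt h₁ g₁, grPt h₂ g₂)

theorem prodPt_congr {h₁ : k₁ ≤ n₁} {h₂ : k₂ ≤ n₂} {g₁ g₁' : GL (Fin n₁) A}
    {g₂ g₂' : GL (Fin n₂) A} (e₁ : frame h₁ g₁ = frame h₁ g₁')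
    (e₂ : frame h₂ g₂ = frame h₂ g₂') : prodPt h₁ h₂ g₁ g₂ = prodPt h₁ h₂ g₁' g₂' :=
  congrArg₂ (fun S T => ((⟨PUnit.unit, S⟩, ⟨PUnit.unit, T⟩) : (GrProd k₁ n₁ k₂ n₂).obj A)) e₁ e₂

theorem map_prodPt (h₁ : k₁ ≤ n₁) (h₂ : k₂ ≤ n₂) (f : A ⟶ B) (g₁ : GL (Fin n₁) A)
    (g₂ : GL (Fin n₂) A) : (GrProd k₁ n₁ k₂ n₂).map f (prodPt h₁ h₂ g₁ g₂) =
      prodPt h₁ h₂ (mapGL f g₁) (mapGL f g₂) :=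
  Prod.ext (map_grPt h₁ f g₁) (map_grPt h₂ f g₂)

/-- The entries of the matrix of a section of `Hom(𝒰, 𝒬)` in the bases given by the columns of
invertible matrices. -/
noncomputable def homEntry (h₁ : k₁ ≤ n₁) (h₂ : k₂ ≤ n₂) (s : (QboxUdual k₁ n₁ k₂ n₂).H0)
    (l : Fin n₁) (hl : k₁ ≤ l) (m : Fin n₂) (hm : (m : ℕ) < k₂) (A : CommAlgCat.{0, 0} ℂ)
    (g₁ : GL (Fin n₁) A) (g₂ : GL (Fin n₂) A) : A :=
  homCoeff s (prodPt h₁ h₂ g₁ g₂) (g₂.val.col m) (col_mem_frame h₂ g₂ hm) (rowInv g₁ l)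
    fun _ hv => rowInv_eq_zero h₁ g₁ hl hv

section

variable (h₁ : k₁ ≤ n₁) (h₂ : k₂ ≤ n₂) (s : (QboxUdual k₁ n₁ k₂ n₂).H0)
  (l : Fin n₁) (hl : k₁ ≤ l) (m : Fin n₂) (hm : (m : ℕ) < k₂)

theorem homEntry_res (f : A ⟶ B) (g₁ : GL (Fin n₁) A) (g₂ : GL (Fin n₂) A) :
    homEntry h₁ h₂ s l hl m hm B (mapGL f g₁) (mapGL f g₂) =
      f.hom (homEntry h₁ h₂ s l hl m hm A g₁ g₂) := by
  unfold homEntry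
  exact homCoeff_res s f (map_prodPt h₁ h₂ f g₁ g₂) _ _ _ _ rfl (rowInv_mapGL f g₁ l)

theorem homEntry_mul_elemGL_left {i j : Fin n₁} (h : i ≠ j) (hli : l ≠ i)
    (hij : (j : ℕ) < k₁ → (i : ℕ) < k₁) (a : A) (g₁ : GL (Fin n₁) A) (g₂ : GL (Fin n₂) A) :
    homEntry h₁ h₂ s l hl m hm A (g₁ * elemGL h a) g₂ = homEntry h₁ h₂ s l hl m hm A g₁ g₂ := by
  unfold homEntry
  exact homCoeff_congr s (prodPt_congr (frame_mul_elemGL h₁ g₁ h a hij) rfl) rfl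
    (rowInv_mul_elemGL_of_ne g₁ h hli a)

theorem homEntry_mul_elemGL_right {i j : Fin n₂} (h : i ≠ j) (hmj : m ≠ j)
    (hij : (j : ℕ) < k₂ → (i : ℕ) < k₂) (a : A) (g₁ : GL (Fin n₁) A) (g₂ : GL (Fin n₂) A) :
    homEntry h₁ h₂ s l hl m hm A g₁ (g₂ * elemGL h a) = homEntry h₁ h₂ s l hl m hm A g₁ g₂ := by
  unfold homEntry
  exact homCoeff_congr s (prodPt_congr rfl (frame_mul_elemGL h₂ g₂ h a hij))
    (col_mul_elemGL_of_ne g₂ h hmj a) rfl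

theorem homEntry_mul_diagGL_left (d : Fin n₁ → Aˣ) (g₁ : GL (Fin n₁) A) (g₂ : GL (Fin n₂) A) :
    homEntry h₁ h₂ s l hl m hm A (g₁ * diagGL d) g₂ =
      (((d l)⁻¹ : Aˣ) : A) * homEntry h₁ h₂ s l hl m hm A g₁ g₂ := by
  unfold homEntry
  refine Eq.trans ?_ (homCoeff_smul_right s _ _ _)
  exact homCoeff_congr s (prodPt_congr (frame_mul_diagGL h₁ g₁ d) rfl) rfl
    (rowInv_mul_diagGL g₁ d l)

theorem homEntry_mul_diagGL_right (d : Fin n₂ → Aˣ) (g₁ : GL (Fin n₁) A) (g₂ : GL (Fin n₂) A) :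
    homEntry h₁ h₂ s l hl m hm A g₁ (g₂ * diagGL d) =
      (d m : A) * homEntry h₁ h₂ s l hl m hm A g₁ g₂ := by
  unfold homEntry
  refine Eq.trans ?_ (homCoeff_smul_left s _ _ _)
  exact homCoeff_congr s (prodPt_congr rfl (frame_mul_diagGL h₂ g₂ d)) (col_mul_diagGL g₂ d m) rfl

theorem homEntry_swap (l' : Fin n₁) (hl' : k₁ ≤ l') (m' : Fin n₂) (hm' : (m' : ℕ) < k₂)
    (g₁ : GL (Fin n₁) A) (g₂ : GL (Fin n₂) A) :
    homEntry h₁ h₂ s l hl m hm A (g₁ * Matrix.GeneralLinearGroup.swap A l' l)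
      (g₂ * Matrix.GeneralLinearGroup.swap A m' m) = homEntry h₁ h₂ s l' hl' m' hm' A g₁ g₂ := by
  unfold homEntry
  refine homCoeff_congr s (prodPt_congr (frame_mul_swap h₁ g₁ ?_) (frame_mul_swap h₂ g₂ ?_))
    (col_mul_swap g₂ m' m) (rowInv_mul_swap g₁ l' l)
  · exact iff_of_false (not_lt.2 hl') (not_lt.2 hl)
  · exact iff_of_true hm' hm

theorem homEntry_sub (t : (QboxUdual k₁ n₁ k₂ n₂).H0) (g₁ : GL (Fin n₁) A)
    (g₂ : GL (Fin n₂) A) :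
    homEntry h₁ h₂ (s - t) l hl m hm A g₁ g₂ =
      homEntry h₁ h₂ s l hl m hm A g₁ g₂ - homEntry h₁ h₂ t l hl m hm A g₁ g₂ := by
  unfold homEntry homCoeff
  have h : homValue (s - t) (prodPt h₁ h₂ g₁ g₂) =
    homValue s (prodPt h₁ h₂ g₁ g₂) - homValue t (prodPt h₁ h₂ g₁ g₂) := rfl
  rw [h, LinearMap.sub_apply, map_sub]

theorem homEntry_homSection (M : Matrix (Fin n₁) (Fin n₂) ℂ) (g₁ : GL (Fin n₁) A)
    (g₂ : GL (Fin n₂) A) :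
    homEntry h₁ h₂ (homSection k₁ n₁ k₂ n₂ M) l hl m hm A g₁ g₂ =
      rowInv g₁ l (extMat A M (g₂.val.col m)) := rfl

theorem homValue_eq_zero (g₁ : GL (Fin n₁) A) (g₂ : GL (Fin n₂) A)
    (h : ∀ l hl m hm, homEntry h₁ h₂ s l hl m hm A g₁ g₂ = 0) :
    homValue s (prodPt h₁ h₂ g₁ g₂) = 0 :=
  frame_hom_ext h₂ g₂ (homValue s (prodPt h₁ h₂ g₁ g₂)) fun m hm =>
    frame_quotient_ext h₁ g₁ _ fun l hl => h l hl m hm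

/-- The entries of a section of `Hom(𝒰, 𝒬)` are bilinear in a row and a column. -/
theorem exists_homEntry_eq : ∃ M : Matrix (Fin n₁) (Fin n₂) ℂ,
    ∀ (g₁ : GL (Fin n₁) ℂ) (g₂ : GL (Fin n₂) ℂ),
      homEntry h₁ h₂ s l hl m hm (CommAlgCat.of ℂ ℂ) g₁ g₂ =
        ∑ i, g₁⁻¹.val l i * ∑ j, M i j * g₂.val j m := by
  let F := homEntry h₁ h₂ s l hl m hm
  let C := CommAlgCat.of ℂ ℂ
  -- complex matrices as matrices over an arbitrary algebra
  let ι : ∀ {r : ℕ} (A : CommAlgCat.{0, 0} ℂ), GL (Fin r) ℂ → GL (Fin r) A := fun A g =>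
    Matrix.GeneralLinearGroup.map (algebraMap ℂ A) g
  have hι : ∀ {r : ℕ} {A B : CommAlgCat.{0, 0} ℂ} (f : A ⟶ B) (g : GL (Fin r) ℂ),
      mapGL f (ι A g) = ι B g := fun f g =>
    Units.ext (Matrix.ext fun i j => f.hom.commutes (g.val i j))
  have hιC : ∀ {r : ℕ} (g : GL (Fin r) ℂ), ι C g = g := fun g => rfl
  have hleft : ∀ g₂ : GL (Fin n₂) ℂ, ∃ φ : Fin n₁ → ℂ, ∀ g₁ : GL (Fin n₁) ℂ,
      F C g₁ g₂ = ∑ j, g₁⁻¹.val l j * φ j := by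
    intro g₂
    refine exists_eq_sum_row_inv (c := fun g₁ => F C g₁ g₂) (m := l)
      (isPolynomialOnCurves_of_natural (fun A g₁ => F A g₁ (ι A g₂)) fun f g => ?_)
      (fun g d => homEntry_mul_diagGL_left h₁ h₂ s l hl m hm (A := C) d g g₂)
      (fun j h a g => homEntry_mul_elemGL_left h₁ h₂ s l hl m hm (A := C) h h.symm
        (fun h' => absurd h' (not_lt.2 hl)) a g g₂) fun i j h hli hlj => ?_
    · rw [← homEntry_res, hι]
    · rcases em ((j : ℕ) < k₁ → (i : ℕ) < k₁) with hij | hij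
      · exact .inl fun h a g =>
          homEntry_mul_elemGL_left h₁ h₂ s l hl m hm (A := C) h hli hij a g g₂
      · exact .inr fun h a g =>
          homEntry_mul_elemGL_left h₁ h₂ s l hl m hm (A := C) h hlj (by tauto) a g g₂
  have hright : ∀ g₁ : GL (Fin n₁) ℂ, ∃ φ : Fin n₂ → ℂ, ∀ g₂ : GL (Fin n₂) ℂ,
      F C g₁ g₂ = ∑ j, φ j * g₂.val j m := by
    intro g₁
    refine exists_eq_sum_col (c := fun g₂ => F C g₁ g₂) (m := m)
      (isPolynomialOnCurves_of_natural (fun A g₂ => F A (ι A g₁) g₂) fun f g => ?_)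
      (fun g d => homEntry_mul_diagGL_right h₁ h₂ s l hl m hm (A := C) d g₁ g)
      (fun j h a g => homEntry_mul_elemGL_right h₁ h₂ s l hl m hm (A := C) h h
        (fun _ => hm) a g₁ g) fun i j h hmi hmj => ?_
    · rw [← homEntry_res, hι]
    · rcases em ((j : ℕ) < k₂ → (i : ℕ) < k₂) with hij | hij
      · exact .inl fun h a g =>
          homEntry_mul_elemGL_right h₁ h₂ s l hl m hm (A := C) h hmj hij a g₁ g
      · exact .inr fun h a g =>
          homEntry_mul_elemGL_right h₁ h₂ s l hl m hm (A := C) h hmi (by tauto) a g₁ g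
  choose φ hφ using hleft
  choose ψ hψ using hright
  refine ⟨.of fun i j => ψ (Matrix.GeneralLinearGroup.swap ℂ i l) j, fun g₁ g₂ => ?_⟩
  change F C g₁ g₂ = _
  rw [hφ]
  refine Finset.sum_congr rfl fun i _ => congrArg _ ?_
  -- the `i`-th coefficient is the value at a permutation matrix
  have h1 := hφ g₂ (Matrix.GeneralLinearGroup.swap ℂ i l)
  have h2 : ∀ j, (Matrix.GeneralLinearGroup.swap ℂ i l)⁻¹.val l j =
      (1 : Matrix (Fin n₁) (Fin n₁) ℂ) i j := fun j => by
    change Matrix.swap ℂ i l l j = _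
    rw [← Matrix.mul_one (Matrix.swap ℂ i l), Matrix.swap_mul_apply_right]
  simp only [h2, Matrix.one_apply, ite_mul, one_mul, zero_mul, Finset.sum_ite_eq,
    Finset.mem_univ, if_true] at h1
  rw [← h1, hψ]
  rfl

end

/-- Every global section of `𝒬 ⊠ 𝒰^∨` is given by a matrix. All entries of a section are conjugate
under permutation matrices, so that one bilinear form describes all of them. -/
theorem homSection_surjective (h₁ : k₁ ≤ n₁) (h₂ : k₂ ≤ n₂) :
    Function.Surjective (homSection k₁ n₁ k₂ n₂) := by
  intro s
  suffices h : ∃ M : Matrix (Fin n₁) (Fin n₂) ℂ, ∀ l hl m hm (g₁ : GL (Fin n₁) ℂ)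
      (g₂ : GL (Fin n₂) ℂ), homEntry h₁ h₂ s l hl m hm (CommAlgCat.of ℂ ℂ) g₁ g₂ =
        ∑ i, g₁⁻¹.val l i * ∑ j, M i j * g₂.val j m by
    obtain ⟨M, hM⟩ := h
    refine ⟨M, (sub_eq_zero.1 ?_).symm⟩
    refine VBundle.section_eq_zero _ (fun g₁ g₂ => prodPt h₁ h₂ g₁ g₂)
      (fun f g₁ g₂ => map_prodPt h₁ h₂ f g₁ g₂) (fun x => ?_) _
      fun g₁ g₂ => homValue_eq_zero (A := CommAlgCat.of ℂ ℂ) h₁ h₂ _ g₁ g₂ fun l hl m hm => ?_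
    · obtain ⟨g₁, hg₁⟩ := exists_eq_grPt h₁ x.1
      obtain ⟨g₂, hg₂⟩ := exists_eq_grPt h₂ x.2
      exact ⟨g₁, g₂, Prod.ext hg₁ hg₂⟩
    · rw [homEntry_sub, homEntry_homSection, hM l hl m hm g₁ g₂]
      exact sub_self _
  by_cases h : ∃ (l : Fin n₁) (m : Fin n₂), k₁ ≤ l ∧ (m : ℕ) < k₂
  · obtain ⟨l, m, hl, hm⟩ := h
    obtain ⟨M, hM⟩ := exists_homEntry_eq h₁ h₂ s l hl m hm
    refine ⟨M, fun l' hl' m' hm' g₁ g₂ => ?_⟩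
    rw [← homEntry_swap (A := CommAlgCat.of ℂ ℂ) h₁ h₂ s l hl m hm l' hl' m' hm' g₁ g₂]
    refine (hM _ _).trans ?_
    refine Finset.sum_congr rfl fun i _ => congrArg₂ _ ?_
      (Finset.sum_congr rfl fun j _ => congrArg _ ?_)
    · rw [_root_.mul_inv_rev]
      change (Matrix.swap ℂ l' l * g₁⁻¹.val) l i = _
      simp
    · change (g₂.val * Matrix.swap ℂ m' m) j m = _
      simp
  -- without an entry the bundle has rank zero
  · exact ⟨0, fun l hl m hm => absurd ⟨l, m, hl, hm⟩ h⟩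

end Hom

end Surjectivity

/-! ### Global sections on flag varieties -/

section FlagSections

variable {A B : CommAlgCat.{0, 0} ℂ} {a b n : ℕ}

theorem flPt_congr {hab : a ≤ b} {hb : b ≤ n} {g g' : GL (Fin n) A}
    (e₁ : frame (hab.trans hb) g = frame (hab.trans hb) g') (e₂ : frame hb g = frame hb g') :
    flPt hab hb g = flPt hab hb g' :=
  Subtype.ext <| congrArg₂
    (fun S T => ((⟨PUnit.unit, S⟩, ⟨PUnit.unit, T⟩) : (GrProd a n b n).obj A)) e₁ e₂

theorem flPt_mul_elemGL (hab : a ≤ b) (hb : b ≤ n) (g : GL (Fin n) A) {i j : Fin n} (h : i ≠ j)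
    (ha' : (j : ℕ) < a → (i : ℕ) < a) (hb' : (j : ℕ) < b → (i : ℕ) < b) (c : A) :
    flPt hab hb (g * elemGL h c) = flPt hab hb g :=
  flPt_congr (frame_mul_elemGL _ g h c ha') (frame_mul_elemGL _ g h c hb')

theorem flPt_mul_diagGL (hab : a ≤ b) (hb : b ≤ n) (g : GL (Fin n) A) (d : Fin n → Aˣ) :
    flPt hab hb (g * diagGL d) = flPt hab hb g :=
  flPt_congr (frame_mul_diagGL _ g d) (frame_mul_diagGL _ g d)

/-! #### The bundle `𝒰₁^∨` -/

/-- The value of a section of `𝒰₁^∨` at a vector of `𝒰₁`. -/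
noncomputable def dualCoeff (s : (Fl.dualU₁ a b n).H0) (x : (Fl a b n).obj A) :
    Gr.sub x.1.1 →ₗ[A] A :=
  LinearMap.proj 0 ∘ₗ (s.1 A x : Gr.sub x.1.1 →ₗ[A] (Fin 1 → A))

theorem dualCoeff_congr (s : (Fl.dualU₁ a b n).H0) {x y : (Fl a b n).obj A} (h : x = y)
    {u u' : Fin n → A} (hu : u ∈ Gr.sub x.1.1) (hu' : u' ∈ Gr.sub y.1.1) (e : u = u') :
    dualCoeff s x ⟨u, hu⟩ = dualCoeff s y ⟨u', hu'⟩ := by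
  subst h e; rfl

theorem dualCoeff_res (s : (Fl.dualU₁ a b n).H0) (f : A ⟶ B) {x : (Fl a b n).obj A}
    {y : (Fl a b n).obj B} (h : (Fl a b n).map f x = y) {u : Fin n → A} (hu : u ∈ Gr.sub x.1.1)
    {u' : Fin n → B} (hu' : u' ∈ Gr.sub y.1.1) (e : u' = piRingHom f.hom.toRingHom n u) :
    dualCoeff s y ⟨u', hu'⟩ = f.hom (dualCoeff s x ⟨u, hu⟩) := by
  subst h e
  have h1 := LinearMap.congr_fun (s.2 f (x := x) rfl)
    (⟨piRingHom f.hom.toRingHom n u, hu'⟩ : Gr.sub _)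
  have h2 := IsBaseChangeAlong.homMap_apply
    (σ := (VBundle.trivial (Fl a b n) 1).res f (x := x) rfl)
    (((tautU a n).pullback (Fl.proj₁ a b n)).isBaseChange f (x := x) rfl)
    (s.1 A x) (⟨u, hu⟩ : Gr.sub x.1.1)
  exact congrFun (h1.symm.trans h2) 0

/-- The entries of a section of `𝒰₁^∨` in the basis given by the columns of an invertible
matrix. -/
noncomputable def dualEntry (hab : a ≤ b) (hb : b ≤ n) (s : (Fl.dualU₁ a b n).H0) (m : Fin n)
    (hm : (m : ℕ) < a) (A : CommAlgCat.{0, 0} ℂ) (g : GL (Fin n) A) : A :=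
  dualCoeff s (flPt hab hb g) ⟨g.val.col m, col_mem_frame (hab.trans hb) g hm⟩

section

variable (hab : a ≤ b) (hb : b ≤ n) (s : (Fl.dualU₁ a b n).H0)

theorem dualEntry_mul_elemGL (m : Fin n) (hm : (m : ℕ) < a) (g : GL (Fin n) A) {i j : Fin n}
    (h : i ≠ j) (hmj : m ≠ j) (ha' : (j : ℕ) < a → (i : ℕ) < a)
    (hb' : (j : ℕ) < b → (i : ℕ) < b) (c : A) :
    dualEntry hab hb s m hm A (g * elemGL h c) = dualEntry hab hb s m hm A g :=
  dualCoeff_congr s (flPt_mul_elemGL hab hb g h ha' hb' c) _ _ (col_mul_elemGL_of_ne g h hmj c)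

theorem dualEntry_mul_diagGL (m : Fin n) (hm : (m : ℕ) < a) (g : GL (Fin n) A)
    (d : Fin n → Aˣ) :
    dualEntry hab hb s m hm A (g * diagGL d) = (d m : A) * dualEntry hab hb s m hm A g := by
  have hu : g.val.col m ∈ Gr.sub (flPt hab hb g).1.1 := col_mem_frame (hab.trans hb) g hm
  refine Eq.trans ?_ (map_smul (dualCoeff s (flPt hab hb g)) (d m : A) ⟨_, hu⟩)
  exact dualCoeff_congr s (flPt_mul_diagGL hab hb g d) _ (Submodule.smul_mem _ _ hu)
    (col_mul_diagGL g d m)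

theorem dualEntry_swap (m : Fin n) (hm : (m : ℕ) < a) (m' : Fin n) (hm' : (m' : ℕ) < a)
    (g : GL (Fin n) A) :
    dualEntry hab hb s m hm A (g * Matrix.GeneralLinearGroup.swap A m' m) =
      dualEntry hab hb s m' hm' A g :=
  dualCoeff_congr s (flPt_congr (frame_mul_swap _ g (iff_of_true hm' hm))
    (frame_mul_swap _ g (iff_of_true (hm'.trans_le hab) (hm.trans_le hab)))) _ _
    (col_mul_swap g m' m)

theorem exists_dualEntry_eq (m : Fin n) (hm : (m : ℕ) < a) : ∃ φ : Fin n → ℂ,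
    ∀ g : GL (Fin n) ℂ, dualEntry hab hb s m hm (CommAlgCat.of ℂ ℂ) g =
      ∑ j, φ j * g.val j m := by
  refine exists_eq_sum_col (c := dualEntry hab hb s m hm (CommAlgCat.of ℂ ℂ)) (m := m)
    (isPolynomialOnCurves_of_natural (dualEntry hab hb s m hm) fun f g =>
      dualCoeff_res s f (map_flPt hab hb f g) _ _ rfl)
    (fun g d => dualEntry_mul_diagGL (A := CommAlgCat.of ℂ ℂ) hab hb s m hm g d)
    (fun j h c g => dualEntry_mul_elemGL (A := CommAlgCat.of ℂ ℂ) hab hb s m hm g h h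
      (fun _ => hm) (fun _ => hm.trans_le hab) c) fun i j h hmi hmj => ?_
  -- of the two elementary subgroups, the upper triangular one preserves the standard flag
  rcases le_total (i : ℕ) j with hij | hij
  · exact .inl fun h c g => dualEntry_mul_elemGL (A := CommAlgCat.of ℂ ℂ) hab hb s m hm g h hmj
      hij.trans_lt hij.trans_lt c
  · exact .inr fun h c g => dualEntry_mul_elemGL (A := CommAlgCat.of ℂ ℂ) hab hb s m hm g h hmi
      hij.trans_lt hij.trans_lt c

end

/-- Every global section of `𝒰₁^∨` is given by a row vector. -/
theorem dualSection_surjective (hab : a ≤ b) (hb : b ≤ n) :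
    Function.Surjective (dualSection a b n) := by
  intro s
  suffices h : ∃ φ : Fin n → ℂ, ∀ m hm (g : GL (Fin n) ℂ),
      dualEntry hab hb s m hm (CommAlgCat.of ℂ ℂ) g = ∑ j, φ j * g.val j m by
    obtain ⟨φ, hφ⟩ := h
    refine ⟨.of fun _ j => φ j, (sub_eq_zero.1 ?_).symm⟩
    -- a single invertible matrix is enough: the second one has size zero
    refine VBundle.section_eq_zero _ (n₂ := 0) (fun g _ => flPt hab hb g)
      (fun f g _ => map_flPt hab hb f g) (fun x => ?_) _ fun g _ => ?_
    · obtain ⟨g, hg⟩ := exists_eq_flPt hab hb x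
      exact ⟨g, 1, hg⟩
    · refine frame_hom_ext (A := CommAlgCat.of ℂ ℂ) (hab.trans hb) g
        (N := Fin 1 → ℂ) _ fun m hm => funext fun i => ?_
      obtain rfl := Subsingleton.elim i 0
      exact sub_eq_zero.2 (hφ m hm g)
  by_cases h : ∃ m : Fin n, (m : ℕ) < a
  · obtain ⟨m, hm⟩ := h
    obtain ⟨φ, hφ⟩ := exists_dualEntry_eq hab hb s m hm
    refine ⟨φ, fun m' hm' g => ?_⟩
    rw [← dualEntry_swap (A := CommAlgCat.of ℂ ℂ) hab hb s m hm m' hm' g]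
    refine (hφ _).trans (Finset.sum_congr rfl fun j _ => congrArg _ ?_)
    change (g.val * Matrix.swap ℂ m' m) j m = _
    simp
  · exact ⟨0, fun m hm => absurd ⟨m, hm⟩ h⟩

/-! #### The bundle `𝒬₂` -/

/-- The value of a linear form on `𝒬₂` at a section. -/
noncomputable def quotCoeff (s : (Fl.Q₂ a b n).H0) (x : (Fl a b n).obj A)
    (ξ : (Fin n → A) →ₗ[A] A) (hξ : ∀ v ∈ Gr.sub x.1.2, ξ v = 0) : A :=
  (Gr.sub x.1.2).liftQ ξ hξ (s.1 A x)

theorem quotCoeff_congr (s : (Fl.Q₂ a b n).H0) {x y : (Fl a b n).obj A} (h : x = y)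
    {ξ ξ' : (Fin n → A) →ₗ[A] A} {hξ : ∀ v ∈ Gr.sub x.1.2, ξ v = 0}
    {hξ' : ∀ v ∈ Gr.sub y.1.2, ξ' v = 0} (e : ξ = ξ') :
    quotCoeff s x ξ hξ = quotCoeff s y ξ' hξ' := by
  subst h e; rfl

theorem quotCoeff_smul (s : (Fl.Q₂ a b n).H0) {x : (Fl a b n).obj A}
    {ξ : (Fin n → A) →ₗ[A] A} (hξ : ∀ v ∈ Gr.sub x.1.2, ξ v = 0) (c : A) :
    quotCoeff s x (c • ξ) (fun v hv => by rw [LinearMap.smul_apply, hξ v hv, smul_zero]) =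
      c * quotCoeff s x ξ hξ := by
  have key : ∀ q : (Fin n → A) ⧸ Gr.sub x.1.2, (Gr.sub x.1.2).liftQ (c • ξ)
      (fun v hv => by rw [LinearMap.mem_ker, LinearMap.smul_apply, hξ v hv, smul_zero]) q =
      c * (Gr.sub x.1.2).liftQ ξ hξ q := fun q => by
    obtain ⟨v, rfl⟩ := (Gr.sub x.1.2).mkQ_surjective q
    rfl
  exact key _

theorem quotCoeff_res (s : (Fl.Q₂ a b n).H0) (f : A ⟶ B) {x : (Fl a b n).obj A}
    {y : (Fl a b n).obj B} (h : (Fl a b n).map f x = y) {ξ : (Fin n → A) →ₗ[A] A}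
    (hξ : ∀ v ∈ Gr.sub x.1.2, ξ v = 0) {ξ' : (Fin n → B) →ₗ[B] B}
    (hξ' : ∀ v ∈ Gr.sub y.1.2, ξ' v = 0)
    (e : ∀ v, ξ' (piRingHom f.hom.toRingHom n v) = f.hom (ξ v)) :
    quotCoeff s y ξ' hξ' = f.hom (quotCoeff s x ξ hξ) := by
  subst h
  refine (congrArg (Submodule.liftQ _ ξ' hξ') (s.2 f (x := x) rfl).symm).trans ?_
  have key : ∀ q : (Fin n → A) ⧸ Gr.sub x.1.2, Submodule.liftQ _ ξ' hξ'
      ((Fl.Q₂ a b n).res f (x := x) rfl q) = f.hom ((Gr.sub x.1.2).liftQ ξ hξ q) := fun q => by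
    obtain ⟨v, rfl⟩ := (Gr.sub x.1.2).mkQ_surjective q
    exact e v
  exact key _

/-- The coordinates of a section of `𝒬₂` in the basis given by the columns of an invertible
matrix. -/
noncomputable def quotEntry (hab : a ≤ b) (hb : b ≤ n) (s : (Fl.Q₂ a b n).H0) (l : Fin n)
    (hl : b ≤ l) (A : CommAlgCat.{0, 0} ℂ) (g : GL (Fin n) A) : A :=
  quotCoeff s (flPt hab hb g) (rowInv g l) fun _ hv => rowInv_eq_zero hb g hl hv

section

variable (hab : a ≤ b) (hb : b ≤ n) (s : (Fl.Q₂ a b n).H0)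

theorem quotEntry_mul_elemGL (l : Fin n) (hl : b ≤ l) (g : GL (Fin n) A) {i j : Fin n}
    (h : i ≠ j) (hli : l ≠ i) (ha' : (j : ℕ) < a → (i : ℕ) < a)
    (hb' : (j : ℕ) < b → (i : ℕ) < b) (c : A) :
    quotEntry hab hb s l hl A (g * elemGL h c) = quotEntry hab hb s l hl A g :=
  quotCoeff_congr s (flPt_mul_elemGL hab hb g h ha' hb' c) (rowInv_mul_elemGL_of_ne g h hli c)

theorem quotEntry_mul_diagGL (l : Fin n) (hl : b ≤ l) (g : GL (Fin n) A) (d : Fin n → Aˣ) :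
    quotEntry hab hb s l hl A (g * diagGL d) =
      (((d l)⁻¹ : Aˣ) : A) * quotEntry hab hb s l hl A g :=
  (quotCoeff_congr s (flPt_mul_diagGL hab hb g d) (rowInv_mul_diagGL g d l)).trans
    (quotCoeff_smul s _ _)

theorem quotEntry_swap (l : Fin n) (hl : b ≤ l) (l' : Fin n) (hl' : b ≤ l') (g : GL (Fin n) A) :
    quotEntry hab hb s l hl A (g * Matrix.GeneralLinearGroup.swap A l' l) =
      quotEntry hab hb s l' hl' A g :=
  quotCoeff_congr s (flPt_congr
    (frame_mul_swap _ g (iff_of_false (not_lt.2 (hab.trans hl')) (not_lt.2 (hab.trans hl))))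
    (frame_mul_swap _ g (iff_of_false (not_lt.2 hl') (not_lt.2 hl)))) (rowInv_mul_swap g l' l)

theorem exists_quotEntry_eq (l : Fin n) (hl : b ≤ l) : ∃ φ : Fin n → ℂ,
    ∀ g : GL (Fin n) ℂ, quotEntry hab hb s l hl (CommAlgCat.of ℂ ℂ) g =
      ∑ j, g⁻¹.val l j * φ j := by
  refine exists_eq_sum_row_inv (c := quotEntry hab hb s l hl (CommAlgCat.of ℂ ℂ)) (m := l)
    (isPolynomialOnCurves_of_natural (quotEntry hab hb s l hl) fun f g =>
      quotCoeff_res s f (map_flPt hab hb f g) _ _ (rowInv_mapGL f g l))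
    (fun g d => quotEntry_mul_diagGL (A := CommAlgCat.of ℂ ℂ) hab hb s l hl g d)
    (fun j h c g => quotEntry_mul_elemGL (A := CommAlgCat.of ℂ ℂ) hab hb s l hl g h h.symm
      (fun h' => absurd h' (not_lt.2 (hab.trans hl))) (fun h' => absurd h' (not_lt.2 hl)) c)
    fun i j h hli hlj => ?_
  rcases le_total (i : ℕ) j with hij | hij
  · exact .inl fun h c g => quotEntry_mul_elemGL (A := CommAlgCat.of ℂ ℂ) hab hb s l hl g h hli
      hij.trans_lt hij.trans_lt c
  · exact .inr fun h c g => quotEntry_mul_elemGL (A := CommAlgCat.of ℂ ℂ) hab hb s l hl g h hlj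
      hij.trans_lt hij.trans_lt c

end

/-- Every global section of `𝒬₂` is given by a column vector. -/
theorem quotSection_surjective (hab : a ≤ b) (hb : b ≤ n) :
    Function.Surjective (quotSection a b n) := by
  intro s
  suffices h : ∃ φ : Fin n → ℂ, ∀ l hl (g : GL (Fin n) ℂ),
      quotEntry hab hb s l hl (CommAlgCat.of ℂ ℂ) g = ∑ j, g⁻¹.val l j * φ j by
    obtain ⟨φ, hφ⟩ := h
    refine ⟨.of fun j _ => φ j, (sub_eq_zero.1 ?_).symm⟩
    -- a single invertible matrix is enough: the second one has size zero
    refine VBundle.section_eq_zero _ (n₂ := 0) (fun g _ => flPt hab hb g)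
      (fun f g _ => map_flPt hab hb f g) (fun x => ?_) _ fun g _ => ?_
    · obtain ⟨g, hg⟩ := exists_eq_flPt hab hb x
      exact ⟨g, 1, hg⟩
    · refine frame_quotient_ext (A := CommAlgCat.of ℂ ℂ) hb g _ fun l hl => ?_
      refine (map_sub ((frame hb g).sub.liftQ (rowInv g l) fun _ hv => rowInv_eq_zero hb g hl hv)
        _ _).trans (sub_eq_zero.2 ((hφ l hl g).trans ?_))
      refine Finset.sum_congr rfl fun j _ => congrArg _ ?_
      change φ j = extMat (CommAlgCat.of ℂ ℂ) (.of fun j _ => φ j) 1 j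
      rw [extMat_apply]
      simp
  by_cases h : ∃ l : Fin n, b ≤ l
  · obtain ⟨l, hl⟩ := h
    obtain ⟨φ, hφ⟩ := exists_quotEntry_eq hab hb s l hl
    refine ⟨φ, fun l' hl' g => ?_⟩
    rw [← quotEntry_swap (A := CommAlgCat.of ℂ ℂ) hab hb s l hl l' hl' g]
    refine (hφ _).trans (Finset.sum_congr rfl fun i _ => congrArg (· * φ i) ?_)
    rw [_root_.mul_inv_rev]
    change (Matrix.swap ℂ l' l * g⁻¹.val) l i = _
    simp
  · exact ⟨0, fun l hl => absurd ⟨l, hl⟩ h⟩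

end FlagSections

/-! ### Zariski open sets of sections -/

section Zariski

variable {V V' : Type*} [AddCommGroup V] [Module ℂ V] [AddCommGroup V'] [Module ℂ V']

theorem polyFunctions_comp_affine (L : V' →ₗ[ℂ] V) (k : V) {p : V → ℂ}
    (hp : p ∈ polyFunctions V) : (fun v => p (L v + k)) ∈ polyFunctions V' := by
  induction hp using Algebra.adjoin_induction with
  | mem x hx =>
    obtain ⟨l, rfl⟩ := hx
    have : (fun v => l (L v + k)) = ((l ∘ₗ L : Module.Dual ℂ V') : V' → ℂ) +
        algebraMap ℂ (V' → ℂ) (l k) := by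
      ext v; simp
    rw [this]
    exact add_mem (Algebra.subset_adjoin ⟨_, rfl⟩) (Subalgebra.algebraMap_mem _ _)
  | algebraMap r => exact Subalgebra.algebraMap_mem _ r
  | add x y _ _ hx hy => exact add_mem hx hy
  | mul x y _ _ hx hy => exact mul_mem hx hy

/-- A surjective linear map is open in the Zariski topology. -/
theorem IsZariskiOpen.image {O : Set V} (hO : IsZariskiOpen O) (Φ : V →ₗ[ℂ] V')
    (hΦ : Function.Surjective Φ) : IsZariskiOpen (Φ '' O) := by
  obtain ⟨P, hP, rfl⟩ := hO
  obtain ⟨σ, hσ⟩ := Φ.exists_rightInverse_of_surjective (LinearMap.range_eq_top.2 hΦ)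
  have hσ' : ∀ v, Φ (σ v) = v := fun v => LinearMap.congr_fun hσ v
  -- the fibre of `Φ` over `v` is `σ v + ker Φ`, so it meets `O` where some `p (σ v + k)` is nonzero
  refine ⟨{q | ∃ p ∈ P, ∃ k ∈ LinearMap.ker Φ, q = fun v => p (σ v + k)}, ?_, ?_⟩
  · rintro _ ⟨p, hp, k, _, rfl⟩
    exact polyFunctions_comp_affine σ k (hP hp)
  · ext v
    constructor
    · rintro ⟨w, ⟨p, hp, hw⟩, rfl⟩
      exact ⟨_, ⟨p, hp, w - σ (Φ w), by simp [hσ'], rfl⟩, by simpa using hw⟩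
    · rintro ⟨_, ⟨p, hp, k, hk, rfl⟩, hv⟩
      exact ⟨σ v + k, ⟨p, hp, hv⟩, by rw [map_add, hσ', LinearMap.mem_ker.1 hk, add_zero]⟩

theorem det_mem_polyFunctions {p : ℕ} (L : V →ₗ[ℂ] Matrix (Fin p) (Fin p) ℂ) :
    (fun v => (L v).det) ∈ polyFunctions V := by
  have : (fun v => (L v).det) = ∑ σ : Equiv.Perm (Fin p), algebraMap ℂ (V → ℂ)
      ((Equiv.Perm.sign σ : ℤ) : ℂ) * ∏ i, fun v => L v (σ i) i := by
    ext v
    simp [Matrix.det_apply']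
  rw [this]
  refine sum_mem fun σ _ => mul_mem (Subalgebra.algebraMap_mem _ _) (prod_mem fun i _ => ?_)
  exact Algebra.subset_adjoin ⟨(LinearMap.proj i ∘ₗ LinearMap.proj (σ i) :
    (Fin p → Fin p → ℂ) →ₗ[ℂ] ℂ) ∘ₗ L, rfl⟩

variable {p q c : ℕ}

/-- `M` is right invertible iff `det (M N) ≠ 0` for some `N`. -/
theorem isZariskiOpen_rightInvertible (p q : ℕ) :
    IsZariskiOpen {M : Matrix (Fin p) (Fin q) ℂ | ∃ N : Matrix (Fin q) (Fin p) ℂ, M * N = 1} := by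
  refine ⟨{f | ∃ N : Matrix (Fin q) (Fin p) ℂ, f = fun M => (M * N).det}, ?_, ?_⟩
  · rintro _ ⟨N, rfl⟩
    exact det_mem_polyFunctions (LinearMap.mk (AddHom.mk (fun M => M * N) fun _ _ =>
      Matrix.add_mul _ _ _) fun _ _ => Matrix.smul_mul _ _ _)
  · ext M
    constructor
    · rintro ⟨N, hN⟩
      exact ⟨_, ⟨N, rfl⟩, by simp [hN]⟩
    · rintro ⟨_, ⟨N, rfl⟩, h⟩
      refine ⟨N * (M * N)⁻¹, ?_⟩
      rw [← Matrix.mul_assoc, Matrix.mul_nonsing_inv _ (isUnit_iff_ne_zero.2 h)]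

/-- `M` is left invertible iff `det (N M) ≠ 0` for some `N`. -/
theorem isZariskiOpen_leftInvertible (p q : ℕ) :
    IsZariskiOpen {M : Matrix (Fin p) (Fin q) ℂ | ∃ N : Matrix (Fin q) (Fin p) ℂ, N * M = 1} := by
  refine ⟨{f | ∃ N : Matrix (Fin q) (Fin p) ℂ, f = fun M => (N * M).det}, ?_, ?_⟩
  · rintro _ ⟨N, rfl⟩
    exact det_mem_polyFunctions (LinearMap.mk (AddHom.mk (fun M => N * M) fun _ _ =>
      Matrix.mul_add _ _ _) fun _ _ => Matrix.mul_smul _ _ _)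
  · ext M
    constructor
    · rintro ⟨N, hN⟩
      exact ⟨_, ⟨N, rfl⟩, by simp [hN]⟩
    · rintro ⟨_, ⟨N, rfl⟩, h⟩
      refine ⟨(N * M)⁻¹ * N, ?_⟩
      rw [Matrix.mul_assoc, Matrix.nonsing_inv_mul _ (isUnit_iff_ne_zero.2 h)]

theorem exists_rightInvertible (h : p ≤ q) :
    ∃ (M : Matrix (Fin p) (Fin q) ℂ) (N : Matrix (Fin q) (Fin p) ℂ), M * N = 1 := by
  refine ⟨(1 : Matrix (Fin q) (Fin q) ℂ).submatrix (Fin.castLE h) id,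
    (1 : Matrix (Fin q) (Fin q) ℂ).submatrix id (Fin.castLE h), ?_⟩
  rw [← Matrix.submatrix_mul _ _ _ _ _ Function.bijective_id, Matrix.one_mul]
  exact Matrix.submatrix_one _ (Fin.castLE_injective h)

/-- A split surjection is the projection onto a direct summand: its kernel is split by `C` and
spanned by the columns of `D`. -/
theorem exists_complement (hq : q = p + c) {M : Matrix (Fin p) (Fin q) ℂ}
    {N : Matrix (Fin q) (Fin p) ℂ} (h : M * N = 1) :
    ∃ (C : Matrix (Fin c) (Fin q) ℂ) (D : Matrix (Fin q) (Fin c) ℂ),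
      M * D = 0 ∧ C * N = 0 ∧ C * D = 1 ∧ N * M + D * C = 1 := by
  have h' : ∀ v, M.mulVecLin (N.mulVecLin v) = v := fun v => by simp [h]
  let K := LinearMap.ker M.mulVecLin
  have hK : Module.finrank ℂ K = c := by
    have h1 := M.mulVecLin.finrank_range_add_finrank_ker
    rw [LinearMap.range_eq_top.2 fun v => ⟨_, h' v⟩, finrank_top] at h1
    simp only [Module.finrank_fin_fun] at h1
    change p + Module.finrank ℂ K = q at h1
    omega
  let e : K ≃ₗ[ℂ] (Fin c → ℂ) := LinearEquiv.ofFinrankEq _ _ (by simpa using hK)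
  let r : (Fin q → ℂ) →ₗ[ℂ] K :=
    (LinearMap.id - N.mulVecLin ∘ₗ M.mulVecLin).codRestrict K fun v => by
      simp only [K, LinearMap.mem_ker, LinearMap.sub_apply, map_sub, LinearMap.comp_apply, h',
        LinearMap.id_apply, sub_self]
  have hr : ∀ k : K, r k = k := fun k => Subtype.ext <| by
    change (k : Fin q → ℂ) - N.mulVecLin (M.mulVecLin k) = k
    rw [LinearMap.mem_ker.1 k.2, map_zero, sub_zero]
  refine ⟨LinearMap.toMatrix' (e.toLinearMap ∘ₗ r),
    LinearMap.toMatrix' (K.subtype ∘ₗ e.symm.toLinearMap), ?_, ?_, ?_, ?_⟩ <;>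
    refine Matrix.toLin'.injective (LinearMap.ext fun v => ?_)
  · simp only [Matrix.toLin'_mul, Matrix.toLin'_toMatrix', map_zero, LinearMap.zero_apply]
    exact LinearMap.mem_ker.1 (e.symm v).2
  · simp only [Matrix.toLin'_mul, Matrix.toLin'_toMatrix', map_zero, LinearMap.zero_apply]
    change e (r (N.mulVecLin v)) = 0
    rw [LinearEquiv.map_eq_zero_iff]
    refine Subtype.ext ?_
    change N.mulVecLin v - N.mulVecLin (M.mulVecLin (N.mulVecLin v)) = 0
    rw [h', sub_self]
  · simp only [Matrix.toLin'_mul, Matrix.toLin'_toMatrix', Matrix.toLin'_one, LinearMap.id_apply]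
    change e (r (e.symm v : K)) = v
    rw [hr, e.apply_symm_apply]
  · simp only [map_add, Matrix.toLin'_mul, Matrix.toLin'_toMatrix', Matrix.toLin'_one,
      LinearMap.id_apply, LinearMap.add_apply]
    change N.mulVecLin (M.mulVecLin v) + ((e.symm (e (r v)) : K) : Fin q → ℂ) = v
    rw [e.symm_apply_apply]
    change N.mulVecLin (M.mulVecLin v) + (v - N.mulVecLin (M.mulVecLin v)) = v
    abel

end Zariski

/-! ### Images of subbundles under split injections and surjections -/

section SubbundleImages

variable {A N M : Type} [CommRing A] [AddCommGroup N] [Module A N] [AddCommGroup M] [Module A M]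
  {k : ℕ}

/-- The image of a subbundle under a split injection. -/
def Subbundle.mapInj [Module.Projective A M] (S : Subbundle A N k) (φ : N →ₗ[A] M)
    (ρ : M →ₗ[A] N) (h : ∀ x, ρ (φ x) = x) : Subbundle A M k where
  sub := S.sub.map φ
  projective_quotient := by
    -- `M / φ(S)` is a direct summand of `(N / S) × M`
    refine Module.Projective.of_split
      ((S.sub.map φ).liftQ ((S.sub.mkQ ∘ₗ ρ).prod (LinearMap.id - φ ∘ₗ ρ)) ?_)
      ((S.sub.mapQ (S.sub.map φ) φ fun x hx => ⟨x, hx, rfl⟩).coprod (S.sub.map φ).mkQ) ?_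
    · rintro _ ⟨x, hx, rfl⟩
      simpa [h] using hx
    · ext m
      change (Submodule.Quotient.mk (φ (ρ m)) : M ⧸ S.sub.map φ) +
        Submodule.Quotient.mk (m - φ (ρ m)) = Submodule.Quotient.mk m
      rw [← Submodule.Quotient.mk_add, add_sub_cancel]
  rank_eq p := (congrFun (Module.rankAtStalk_eq_of_equiv
      (Submodule.equivMapOfInjective φ (Function.LeftInverse.injective h) S.sub)).symm p).trans
    (S.rank_eq p)

theorem Submodule.map_map_eq_of_apply_eq {φ : N →ₗ[A] M} {ρ : M →ₗ[A] N} {T : Submodule A M}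
    (hT : ∀ m ∈ T, φ (ρ m) = m) : (T.map ρ).map φ = T := by
  apply le_antisymm
  · rintro _ ⟨_, ⟨m, hm, rfl⟩, rfl⟩
    rwa [hT m hm]
  · exact fun m hm => ⟨ρ m, ⟨m, hm, rfl⟩, hT m hm⟩

/-- The preimage of a subbundle contained in the image of a split injection `φ`, given as its image
under a splitting `ρ` of `φ`. -/
def Subbundle.comapInj [Module.Projective A M] (T : Subbundle A M k) (φ : N →ₗ[A] M)
    (ρ : M →ₗ[A] N) (h : ∀ x, ρ (φ x) = x) (hT : ∀ m ∈ T.sub, φ (ρ m) = m) :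
    Subbundle A N k where
  sub := T.sub.map ρ
  projective_quotient := by
    refine Module.Projective.of_split
      ((T.sub.map ρ).mapQ T.sub φ ?_) (T.sub.mapQ (T.sub.map ρ) ρ fun x hx => ⟨x, hx, rfl⟩) ?_
    · rintro _ ⟨m, hm, rfl⟩
      rw [Submodule.mem_comap, hT m hm]
      exact hm
    · ext m
      change (Submodule.Quotient.mk (ρ (φ m)) : N ⧸ T.sub.map ρ) = Submodule.Quotient.mk m
      rw [h]
  rank_eq p := (congrFun (Module.rankAtStalk_eq_of_equiv
      ((Submodule.equivMapOfInjective φ (Function.LeftInverse.injective h) _).trans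
        (LinearEquiv.ofEq _ _ (Submodule.map_map_eq_of_apply_eq hT)))) p).trans
    (T.rank_eq p)

theorem finite_projective_of_quotient [Module.Finite A M] [Module.Projective A M]
    (S : Submodule A M) [Module.Projective A (M ⧸ S)] :
    Module.Finite A S ∧ Module.Projective A S := by
  obtain ⟨s, hs⟩ :=
    Module.projective_lifting_property S.mkQ LinearMap.id S.mkQ_surjective
  have hd : ∀ m, m - s (S.mkQ m) ∈ S := fun m => by
    rw [← Submodule.Quotient.eq]; exact (LinearMap.congr_fun hs (S.mkQ m)).symm
  let r : M →ₗ[A] S := (LinearMap.id - s.comp S.mkQ).codRestrict S hd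
  have hr : ∀ m : S, r m = m := fun m => by
    refine Subtype.ext ?_
    have : S.mkQ (m : M) = 0 := by simp
    change (m : M) - s (S.mkQ m) = m
    rw [this]; simp
  exact ⟨Module.Finite.of_surjective r fun m => ⟨m, hr m⟩,
    Module.Projective.of_split S.subtype r (LinearMap.ext hr)⟩

section Surjection

variable (π : N →ₗ[A] M) (ι : M →ₗ[A] N) (v : N) (t : N →ₗ[A] A)

/-- The preimage of a submodule under a split surjection with free kernel of rank one. -/
def comapEquivProd (h₁ : ∀ x, π (ι x) = x) (h₂ : ∀ x, ι (π x) + t x • v = x) (h₃ : t v = 1)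
    (h₄ : π v = 0) (h₅ : ∀ x, t (ι x) = 0) (U : Submodule A M) :
    U.comap π ≃ₗ[A] U × A where
  toFun x := (⟨π x, x.2⟩, t x)
  map_add' x y := by ext <;> simp
  map_smul' a x := by ext <;> simp
  invFun y := ⟨ι y.1 + y.2 • v, by simp [h₁, h₄]⟩
  left_inv x := Subtype.ext (h₂ x)
  right_inv y := by ext <;> simp [h₁, h₃, h₄, h₅]

theorem comap_map_of_mem (h₂ : ∀ x, ι (π x) + t x • v = x) {V : Submodule A N} (hv : v ∈ V) :
    (V.map π).comap π = V := by
  apply le_antisymm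
  · rintro x ⟨y, hy, e⟩
    have h : x = y + (t x - t y) • v := by
      rw [sub_smul]
      conv_lhs => rw [← h₂ x, ← e, eq_sub_of_add_eq (h₂ y)]
      abel
    rw [h]
    exact add_mem hy (V.smul_mem _ hv)
  · exact fun x hx => ⟨x, hx, rfl⟩

variable [Module.Finite A M] [Module.Projective A M]

theorem rankAtStalk_comap (h₁ : ∀ x, π (ι x) = x) (h₂ : ∀ x, ι (π x) + t x • v = x)
    (h₃ : t v = 1) (h₄ : π v = 0) (h₅ : ∀ x, t (ι x) = 0) (U : Submodule A M)
    [Module.Projective A (M ⧸ U)] (p : PrimeSpectrum A) :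
    Module.rankAtStalk (U.comap π) p = Module.rankAtStalk U p + 1 := by
  haveI := p.nontrivial
  haveI := (finite_projective_of_quotient U).1
  haveI := (finite_projective_of_quotient U).2
  rw [Module.rankAtStalk_eq_of_equiv (comapEquivProd π ι v t h₁ h₂ h₃ h₄ h₅ U),
    Module.rankAtStalk_prod, Module.rankAtStalk_self]
  rfl

/-- The preimage of a subbundle under a split surjection with free kernel of rank one. -/
def Subbundle.comapSurj [Module.Projective A N] (U : Subbundle A M k)
    (h₁ : ∀ x, π (ι x) = x) (h₂ : ∀ x, ι (π x) + t x • v = x)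
    (h₃ : t v = 1) (h₄ : π v = 0) (h₅ : ∀ x, t (ι x) = 0) : Subbundle A N (k + 1) where
  sub := U.sub.comap π
  projective_quotient := by
    refine Module.Projective.of_split ((U.sub.comap π).mapQ U.sub π le_rfl)
      (U.sub.mapQ (U.sub.comap π) ι fun x hx => by simpa [h₁] using hx) ?_
    ext x
    simp only [LinearMap.comp_apply, LinearMap.id_apply, Submodule.mkQ_apply,
      Submodule.mapQ_apply]
    refine (Submodule.Quotient.eq _).2 ?_
    simp [h₁]
  rank_eq p := by rw [rankAtStalk_comap π ι v t h₁ h₂ h₃ h₄ h₅, U.rank_eq]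

/-- The image of a subbundle that contains the kernel under a split surjection with free kernel of
rank one. -/
def Subbundle.mapSurj (V : Subbundle A N (k + 1)) (hv : v ∈ V.sub)
    (h₁ : ∀ x, π (ι x) = x) (h₂ : ∀ x, ι (π x) + t x • v = x)
    (h₃ : t v = 1) (h₄ : π v = 0) (h₅ : ∀ x, t (ι x) = 0) : Subbundle A M k := by
  have hproj : Module.Projective A (M ⧸ V.sub.map π) := by
    refine Module.Projective.of_split ((V.sub.map π).mapQ V.sub ι ?_)
      (V.sub.mapQ (V.sub.map π) π fun x hx => ⟨x, hx, rfl⟩) ?_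
    · rintro _ ⟨x, hx, rfl⟩
      have : ι (π x) = x - t x • v := eq_sub_of_add_eq (h₂ x)
      rw [Submodule.mem_comap, this]
      exact sub_mem hx (V.sub.smul_mem _ hv)
    · ext x
      change (Submodule.Quotient.mk (π (ι x)) : M ⧸ V.sub.map π) = Submodule.Quotient.mk x
      rw [h₁]
  exact
  { sub := V.sub.map π
    projective_quotient := hproj
    rank_eq := fun p => by
      have h := rankAtStalk_comap π ι v t h₁ h₂ h₃ h₄ h₅ (V.sub.map π) p
      rw [Module.rankAtStalk_eq_of_equiv (LinearEquiv.ofEq _ _ (comap_map_of_mem π ι v t h₂ hv)),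
        V.rank_eq] at h
      push_cast at h
      omega }

end Surjection

/-- Base change of submodules commutes with images under compatible linear maps. -/
theorem Submodule.map_extend {B N' M' : Type} [CommRing B] [AddCommGroup N'] [Module B N']
    [AddCommGroup M'] [Module B M'] {f : A →+* B} (τ : N →ₛₗ[f] N') (σ : M →ₛₗ[f] M')
    (φ : N →ₗ[A] M) (φ' : N' →ₗ[B] M') (h : ∀ x, σ (φ x) = φ' (τ x)) (S : Submodule A N) :
    (S.map φ).extend σ = (S.extend τ).map φ' := by
  apply le_antisymm
  · refine Submodule.extend_le _ ?_
    rintro _ ⟨x, hx, rfl⟩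
    exact ⟨τ x, S.mem_extend hx, (h x).symm⟩
  · rw [Submodule.map_le_iff_le_comap]
    refine Submodule.extend_le _ fun x hx => ?_
    rw [Submodule.mem_comap, ← h]
    exact Submodule.mem_extend _ ⟨x, hx, rfl⟩

end SubbundleImages

/-! ### The zero locus as a subvariety of a flag variety -/

section Isomorphisms

/-- A natural family of bijections between the sets of points is an isomorphism. -/
theorem exists_iso_of_bijective {X Y : PointFunctor}
    (F : ∀ A : CommAlgCat.{0, 0} ℂ, X.obj A → Y.obj A)
    (hF : ∀ {A B : CommAlgCat.{0, 0} ℂ} (f : A ⟶ B) (x : X.obj A),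
      F B (X.map f x) = Y.map f (F A x))
    (hb : ∀ A, Function.Bijective (F A)) :
    ∃ e : X ≅ Y, ∀ A (x : X.obj A), e.hom.app A x = F A x := by
  let η : X ⟶ Y :=
    { app := fun A => ↾(F A)
      naturality := fun A B f => ConcreteCategory.hom_ext _ _ fun x => hF f x }
  haveI : ∀ A, IsIso (η.app A) := fun A => (bijective_iff_isIso_ofHom (F A)).1 (hb A)
  haveI : IsIso η := NatIso.isIso_of_isIso_app η
  exact ⟨asIso η, fun A x => rfl⟩

variable {A B : CommAlgCat.{0, 0} ℂ} {k n p q r : ℕ}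

/-- The point of the Grassmannian given by a subbundle of `Aⁿ`. -/
def Gr.mk (S : Subbundle A (Fin n → A) k) : (Gr k n).obj A := ⟨PUnit.unit, S⟩

/-- The subbundle of `Aⁿ` given by a point of the Grassmannian. -/
def Gr.subbundle (x : (Gr k n).obj A) : Subbundle A (Fin n → A) k := x.2

theorem Gr.ext {x y : (Gr k n).obj A} (h : Gr.sub x = Gr.sub y) : x = y :=
  congrArg (Sigma.mk PUnit.unit) (Subbundle.ext h)

theorem extMat_comp_of_eq {M : Matrix (Fin p) (Fin q) ℂ} {N : Matrix (Fin q) (Fin r) ℂ}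
    {P : Matrix (Fin p) (Fin r) ℂ} (h : M * N = P) (v : Fin r → A) :
    extMat A M (extMat A N v) = extMat A P v := by
  rw [← extMat_mul, h]

theorem extMat_leftInverse {M : Matrix (Fin p) (Fin q) ℂ} {N : Matrix (Fin q) (Fin p) ℂ}
    (h : M * N = 1) (v : Fin p → A) : extMat A M (extMat A N v) = v := by
  rw [← extMat_mul, h, extMat_one]

theorem extMat_comp_eq_zero {M : Matrix (Fin p) (Fin q) ℂ} {N : Matrix (Fin q) (Fin r) ℂ}
    (h : M * N = 0) (v : Fin r → A) : extMat A M (extMat A N v) = 0 := by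
  rw [← extMat_mul, h, extMat_zero]

theorem extMat_decompose {s : ℕ} {M : Matrix (Fin p) (Fin q) ℂ} {N : Matrix (Fin q) (Fin p) ℂ}
    {P : Matrix (Fin p) (Fin s) ℂ} {Q : Matrix (Fin s) (Fin p) ℂ} (h : M * N + P * Q = 1)
    (v : Fin p → A) : extMat A M (extMat A N v) + extMat A P (extMat A Q v) = v := by
  rw [← extMat_mul, ← extMat_mul, ← extMat_add, h, extMat_one]

theorem map_extMat_extend (f : A ⟶ B) (M : Matrix (Fin p) (Fin q) ℂ)
    (S : Submodule A (Fin q → A)) :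
    (S.extend (piRingHom f.hom.toRingHom q)).map (extMat B M) =
      (S.map (extMat A M)).extend (piRingHom f.hom.toRingHom p) :=
  (Submodule.map_extend _ _ _ _ (extMat_res f M) S).symm

theorem map_map_extMat_eq {M : Matrix (Fin p) (Fin q) ℂ} {N : Matrix (Fin q) (Fin r) ℂ}
    {P : Matrix (Fin p) (Fin r) ℂ} (h : M * N = P) (S : Submodule A (Fin r → A)) :
    (S.map (extMat A N)).map (extMat A M) = S.map (extMat A P) := by
  rw [← Submodule.map_comp]
  congr 1
  exact LinearMap.ext (extMat_comp_of_eq h)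

theorem map_map_extMat_of_eq_one {M : Matrix (Fin p) (Fin q) ℂ} {N : Matrix (Fin q) (Fin p) ℂ}
    (h : M * N = 1) (S : Submodule A (Fin p → A)) :
    (S.map (extMat A N)).map (extMat A M) = S := by
  rw [map_map_extMat_eq h, LinearMap.ext (f := extMat A 1) (g := LinearMap.id) extMat_one,
    Submodule.map_id]

/-- Two decompositions of `ℂ^p` as a direct sum of the same shape differ by an automorphism. -/
theorem exists_automorphism {c : ℕ} {M M' : Matrix (Fin p) (Fin q) ℂ}
    {N N' : Matrix (Fin q) (Fin p) ℂ} {D D' : Matrix (Fin p) (Fin c) ℂ}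
    {C C' : Matrix (Fin c) (Fin p) ℂ} (hNM : N * M = 1) (hCD : C * D = 1) (hND : N * D = 0)
    (hCM : C * M = 0) (h : M * N + D * C = 1) (hNM' : N' * M' = 1) (hCD' : C' * D' = 1)
    (hND' : N' * D' = 0) (hCM' : C' * M' = 0) (h' : M' * N' + D' * C' = 1) :
    ∃ g g' : Matrix (Fin p) (Fin p) ℂ, g * g' = 1 ∧ g' * g = 1 ∧ g * M = M' ∧ g' * M' = M ∧
      g * D = D' ∧ g' * D' = D := by
  have key : ∀ {M M' : Matrix (Fin p) (Fin q) ℂ}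
      {N N' : Matrix (Fin q) (Fin p) ℂ} {D D' : Matrix (Fin p) (Fin c) ℂ}
      {C C' : Matrix (Fin c) (Fin p) ℂ}, N * M = 1 → C * D = 1 → N * D = 0 → C * M = 0 →
      (M' * N + D' * C) * M = M' ∧ (M' * N + D' * C) * D = D' := by
    intro M M' N N' D D' C C' h1 h2 h3 h4
    simp [Matrix.add_mul, Matrix.mul_assoc, h1, h2, h3, h4]
  obtain ⟨h1, h2⟩ := key (M' := M') (N' := N') (D' := D') (C' := C') hNM hCD hND hCM
  obtain ⟨h3, h4⟩ := key (M' := M) (N' := N) (D' := D) (C' := C) hNM' hCD' hND' hCM'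
  refine ⟨M' * N + D' * C, M * N' + D * C', ?_, ?_, h1, h3, h2, h4⟩
  · rw [Matrix.mul_add, ← Matrix.mul_assoc, ← Matrix.mul_assoc, h1, h2, h']
  · rw [Matrix.mul_add, ← Matrix.mul_assoc, ← Matrix.mul_assoc, h3, h4, h]

/-- For a hyperplane inclusion `M : ℂ^{n₂} → ℂ^{n₁}`, the pairs `(U₁, U₂)` with `M(U₂) ⊆ U₁` are
the flags `M(U₂) ⊆ U₁` whose smaller member lies in the hyperplane. -/
theorem nonempty_iso_zeroLocus_dualSection {k₁ k₂ n₁ n₂ : ℕ} (hn : n₁ = n₂ + 1)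
    {M : Matrix (Fin n₁) (Fin n₂) ℂ} {N : Matrix (Fin n₂) (Fin n₁) ℂ} (hNM : N * M = 1)
    {t : Matrix (Fin 1) (Fin n₁) ℂ} {w : Matrix (Fin n₁) (Fin 1) ℂ} (htw : t * w = 1) :
    Nonempty ((QboxUdual k₁ n₁ k₂ n₂).zeroLocus (homSection k₁ n₁ k₂ n₂ M) ≅
      (Fl.dualU₁ k₂ k₁ n₁).zeroLocus (dualSection k₂ k₁ n₁ t)) := by
  obtain ⟨C, D, hND, hCM, hCD, hM⟩ := exists_complement hn hNM
  obtain ⟨N', M', htM', hN'w, hNM', hw⟩ := exists_complement (hn.trans (add_comm _ _)) htw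
  -- `g` moves the image of `M` to the kernel of `t`
  obtain ⟨g, g', hgg', hg'g, hgM, hg'M', -, -⟩ := exists_automorphism hNM hCD hND hCM hM hNM' htw
    hN'w htM' ((add_comm _ _).trans hw)
  have hker : ∀ {A : CommAlgCat.{0, 0} ℂ} (v : Fin n₁ → A), extMat A t v = 0 →
      extMat A M' (extMat A N' v) = v := fun {A} v hv => by
    have := extMat_decompose hw v
    rwa [hv, map_zero, zero_add] at this
  let F : ∀ A : CommAlgCat.{0, 0} ℂ,
      ((QboxUdual k₁ n₁ k₂ n₂).zeroLocus (homSection k₁ n₁ k₂ n₂ M)).obj A →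
      ((Fl.dualU₁ k₂ k₁ n₁).zeroLocus (dualSection k₂ k₁ n₁ t)).obj A := fun A x =>
    ⟨⟨(Gr.mk ((Gr.subbundle x.1.2).mapInj (extMat A M') (extMat A N') (extMat_leftInverse hNM')),
      Gr.mk ((Gr.subbundle x.1.1).mapInj (extMat A g) (extMat A g') (extMat_leftInverse hg'g))),
      by
        rintro _ ⟨u, hu, rfl⟩
        refine ⟨extMat A M u, (homSection_eq_zero_iff M x.1).1 x.2 u hu, ?_⟩
        exact extMat_comp_of_eq hgM u⟩,
      (dualSection_eq_zero_iff t _).2 (by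
        rintro _ ⟨u, _, rfl⟩
        exact extMat_comp_eq_zero htM' u)⟩
  refine Exists.elim (exists_iso_of_bijective F (fun {A B} f x => Subtype.ext <| Subtype.ext <|
    Prod.ext (Gr.ext (map_extMat_extend f M' (Gr.sub x.1.2)))
      (Gr.ext (map_extMat_extend f g (Gr.sub x.1.1)))) fun A => ⟨?_, ?_⟩)
    fun e _ => ⟨e⟩
  · intro x y hxy
    have h1 : (Gr.sub x.1.2).map (extMat A M') = (Gr.sub y.1.2).map (extMat A M') :=
      congrArg (fun z : ((Fl.dualU₁ k₂ k₁ n₁).zeroLocus (dualSection k₂ k₁ n₁ t)).obj A =>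
        Gr.sub z.1.1.1) hxy
    have h2 : (Gr.sub x.1.1).map (extMat A g) = (Gr.sub y.1.1).map (extMat A g) :=
      congrArg (fun z : ((Fl.dualU₁ k₂ k₁ n₁).zeroLocus (dualSection k₂ k₁ n₁ t)).obj A =>
        Gr.sub z.1.1.2) hxy
    refine Subtype.ext (Prod.ext (Gr.ext ?_) (Gr.ext ?_))
    · exact Submodule.map_injective_of_injective
        (Function.LeftInverse.injective (extMat_leftInverse hg'g)) h2
    · exact Submodule.map_injective_of_injective
        (Function.LeftInverse.injective (extMat_leftInverse hNM')) h1
  · rintro ⟨y, hy⟩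
    have hy' := (dualSection_eq_zero_iff t y).1 hy
    have hV₁ : ∀ v ∈ Gr.sub y.1.1, extMat A M' (extMat A N' v) = v := fun v hv =>
      hker v (hy' v hv)
    let x : (GrProd k₁ n₁ k₂ n₂).obj A :=
      (Gr.mk ((Gr.subbundle y.1.2).mapInj (extMat A g') (extMat A g) (extMat_leftInverse hgg')),
        Gr.mk ((Gr.subbundle y.1.1).comapInj (extMat A M') (extMat A N')
          (extMat_leftInverse hNM') hV₁))
    have hx : (homSection k₁ n₁ k₂ n₂ M).1 A x = 0 := by
      refine (homSection_eq_zero_iff M x).2 ?_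
      rintro _ ⟨v, hv, rfl⟩
      refine ⟨v, y.2 hv, ?_⟩
      rw [← extMat_comp_of_eq hg'M', hV₁ v hv]
    refine ⟨⟨x, hx⟩, Subtype.ext (Subtype.ext (Prod.ext (Gr.ext ?_) (Gr.ext ?_)))⟩
    · exact Submodule.map_map_eq_of_apply_eq hV₁
    · exact map_map_extMat_of_eq_one hgg' _

/-- For a projection `M : ℂ^{n₂} → ℂ^{n₁}` from a line, the pairs `(U₁, U₂)` with `M(U₂) ⊆ U₁` are
the flags `U₂ ⊆ M⁻¹(U₁)` whose larger member contains the line. -/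
theorem nonempty_iso_zeroLocus_quotSection {k₁ k₂ n₁ n₂ : ℕ} (hn : n₂ = n₁ + 1)
    {M : Matrix (Fin n₁) (Fin n₂) ℂ} {N : Matrix (Fin n₂) (Fin n₁) ℂ} (hMN : M * N = 1)
    {v : Matrix (Fin n₂) (Fin 1) ℂ} {t : Matrix (Fin 1) (Fin n₂) ℂ} (htv : t * v = 1) :
    Nonempty ((QboxUdual k₁ n₁ k₂ n₂).zeroLocus (homSection k₁ n₁ k₂ n₂ M) ≅
      (Fl.Q₂ k₂ (k₁ + 1) n₂).zeroLocus (quotSection k₂ (k₁ + 1) n₂ v)) := by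
  obtain ⟨C, D, hMD, hCN, hCD, hN⟩ := exists_complement hn hMN
  obtain ⟨π, ι, htι, hπv, hπι, hv⟩ := exists_complement (hn.trans (add_comm _ _)) htv
  have hv' : ι * π + v * t = 1 := (add_comm _ _).trans hv
  -- `g` moves the line spanned by `v` to the kernel of `M`
  obtain ⟨g, g', hgg', hg'g, hgι, hg'N, hgv, hg'D⟩ := exists_automorphism hπι htv hπv htι hv'
    hMN hCD hMD hCN hN
  have hMg : M * g = π := by
    rw [← Matrix.mul_one (M * g), ← hv', Matrix.mul_add, ← Matrix.mul_assoc, ← Matrix.mul_assoc,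
      Matrix.mul_assoc M g ι, Matrix.mul_assoc M g v, hgι, hgv, hMN, hMD, Matrix.one_mul,
      Matrix.zero_mul, add_zero]
  have hπg' : π * g' = M := by rw [← hMg, Matrix.mul_assoc, hgg', Matrix.mul_one]
  -- the coordinate on the line spanned by `v` in the splitting of `A^{n₂}` as `A^{n₁} ⊕ A`
  let τ : ∀ A : CommAlgCat.{0, 0} ℂ, (Fin n₂ → A) →ₗ[A] A := fun A =>
    LinearMap.proj 0 ∘ₗ extMat A t
  have hτ : ∀ {A : CommAlgCat.{0, 0} ℂ} (x : Fin n₂ → A), extMat A t x = τ A x • 1 :=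
    fun x => funext fun i => by
      obtain rfl := Subsingleton.elim i 0
      simp [τ]
  have h₁ : ∀ {A : CommAlgCat.{0, 0} ℂ} (x : Fin n₁ → A), extMat A π (extMat A ι x) = x :=
    extMat_leftInverse hπι
  have h₂ : ∀ {A : CommAlgCat.{0, 0} ℂ} (x : Fin n₂ → A),
      extMat A ι (extMat A π x) + τ A x • extMat A v 1 = x := fun {A} x => by
    rw [← map_smul, ← hτ]
    exact extMat_decompose hv' x
  have h₃ : ∀ {A : CommAlgCat.{0, 0} ℂ}, τ A (extMat A v 1) = 1 := fun {A} =>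
    congrFun (extMat_leftInverse htv (1 : Fin 1 → A)) 0
  have h₄ : ∀ {A : CommAlgCat.{0, 0} ℂ}, extMat A π (extMat A v 1) = 0 := fun {A} =>
    extMat_comp_eq_zero hπv _
  have h₅ : ∀ {A : CommAlgCat.{0, 0} ℂ} (x : Fin n₁ → A), τ A (extMat A ι x) = 0 := fun {A} x =>
    congrFun (extMat_comp_eq_zero htι x) 0
  let F : ∀ A : CommAlgCat.{0, 0} ℂ,
      ((Fl.Q₂ k₂ (k₁ + 1) n₂).zeroLocus (quotSection k₂ (k₁ + 1) n₂ v)).obj A →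
      ((QboxUdual k₁ n₁ k₂ n₂).zeroLocus (homSection k₁ n₁ k₂ n₂ M)).obj A := fun A y =>
    ⟨(Gr.mk ((Gr.subbundle y.1.1.2).mapSurj (extMat A π) (extMat A ι) (extMat A v 1) (τ A)
        ((quotSection_eq_zero_iff v y.1).1 y.2) h₁ h₂ h₃ h₄ h₅),
      Gr.mk ((Gr.subbundle y.1.1.1).mapInj (extMat A g) (extMat A g') (extMat_leftInverse hg'g))),
      (homSection_eq_zero_iff M _).2 (by
        rintro _ ⟨u, hu, rfl⟩
        exact ⟨u, y.1.2 hu, (extMat_comp_of_eq hMg u).symm⟩)⟩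
  refine Exists.elim (exists_iso_of_bijective F (fun {A B} f y => Subtype.ext <|
    Prod.ext (Gr.ext (map_extMat_extend f π (Gr.sub y.1.1.2)))
      (Gr.ext (map_extMat_extend f g (Gr.sub y.1.1.1)))) fun A => ⟨?_, ?_⟩)
    fun e _ => ⟨e.symm⟩
  · intro x y hxy
    have h1 : (Gr.sub x.1.1.2).map (extMat A π) = (Gr.sub y.1.1.2).map (extMat A π) :=
      congrArg (fun z : ((QboxUdual k₁ n₁ k₂ n₂).zeroLocus (homSection k₁ n₁ k₂ n₂ M)).obj A =>
        Gr.sub z.1.1) hxy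
    have h2 : (Gr.sub x.1.1.1).map (extMat A g) = (Gr.sub y.1.1.1).map (extMat A g) :=
      congrArg (fun z : ((QboxUdual k₁ n₁ k₂ n₂).zeroLocus (homSection k₁ n₁ k₂ n₂ M)).obj A =>
        Gr.sub z.1.2) hxy
    refine Subtype.ext (Subtype.ext (Prod.ext (Gr.ext ?_) (Gr.ext ?_)))
    · exact Submodule.map_injective_of_injective
        (Function.LeftInverse.injective (extMat_leftInverse hg'g)) h2
    · rw [← comap_map_of_mem (extMat A π) (extMat A ι) (extMat A v 1) (τ A) h₂
        ((quotSection_eq_zero_iff v x.1).1 x.2), h1]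
      exact comap_map_of_mem (extMat A π) (extMat A ι) (extMat A v 1) (τ A) h₂
        ((quotSection_eq_zero_iff v y.1).1 y.2)
  · rintro ⟨x, hx⟩
    have hx' := (homSection_eq_zero_iff M x).1 hx
    let y : (Fl k₂ (k₁ + 1) n₂).obj A :=
      ⟨(Gr.mk ((Gr.subbundle x.2).mapInj (extMat A g') (extMat A g) (extMat_leftInverse hgg')),
        Gr.mk ((Gr.subbundle x.1).comapSurj (extMat A π) (extMat A ι) (extMat A v 1) (τ A)
          h₁ h₂ h₃ h₄ h₅)), by
        rintro _ ⟨u, hu, rfl⟩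
        change extMat A π (extMat A g' u) ∈ Gr.sub x.1
        rw [extMat_comp_of_eq hπg']
        exact hx' u hu⟩
    have hy : (quotSection k₂ (k₁ + 1) n₂ v).1 A y = 0 := by
      refine (quotSection_eq_zero_iff v y).2 ?_
      change extMat A π (extMat A v 1) ∈ Gr.sub x.1
      rw [h₄]
      exact zero_mem _
    refine ⟨⟨y, hy⟩, Subtype.ext (Prod.ext (Gr.ext ?_) (Gr.ext ?_))⟩
    · exact Submodule.map_comap_eq_of_surjective (Function.RightInverse.surjective h₁) _
    · exact map_map_extMat_of_eq_one hgg' _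

end Isomorphisms

/-! ### The zero locus as a Grassmann bundle -/

section GrassmannBundleIso

variable {A B : CommAlgCat.{0, 0} ℂ} {k₁ n₁ k₂ n₂ c : ℕ}

theorem extMat_add_eq_left {p q r : ℕ} {M : Matrix (Fin p) (Fin q) ℂ}
    {N : Matrix (Fin q) (Fin p) ℂ} {D : Matrix (Fin q) (Fin r) ℂ} (hMN : M * N = 1)
    (hMD : M * D = 0) (u : Fin p → A) (y : Fin r → A) :
    extMat A M (extMat A N u + extMat A D y) = u := by
  rw [map_add, extMat_leftInverse hMN, extMat_comp_eq_zero hMD, add_zero]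

/-- The bundle map `𝒰 ⊕ 𝒪^c → 𝒪^{n₂}` on `Gr(k₁, n₁)` given by matrices `N` and `D`. -/
noncomputable def sumInclusion (N : Matrix (Fin n₂) (Fin n₁) ℂ) (D : Matrix (Fin n₂) (Fin c) ℂ)
    (x : (Gr k₁ n₁).obj A) :
    ((tautU k₁ n₁).directSum (.trivial (Gr k₁ n₁) c)).fiber x →ₗ[A] (Fin n₂ → A) :=
  (extMat A N ∘ₗ (Gr.sub x).subtype).coprod (extMat A D)

theorem sumInclusion_res (N : Matrix (Fin n₂) (Fin n₁) ℂ) (D : Matrix (Fin n₂) (Fin c) ℂ)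
    (f : A ⟶ B) (x : (Gr k₁ n₁).obj A)
    (u : ((tautU k₁ n₁).directSum (.trivial (Gr k₁ n₁) c)).fiber x) :
    piRingHom f.hom.toRingHom n₂ (sumInclusion N D x u) =
      sumInclusion N D ((Gr k₁ n₁).map f x)
        (((tautU k₁ n₁).directSum (.trivial (Gr k₁ n₁) c)).res f rfl u) := by
  obtain ⟨u, y⟩ := u
  exact (map_add (piRingHom f.hom.toRingHom n₂) (extMat A N u.1) (extMat A D y)).trans
    (congrArg₂ _ (extMat_res f N u.1) (extMat_res f D y))

/-- A splitting of `sumInclusion N D` when `M` and `C` split `N` and `D`. -/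
noncomputable def sumRetraction (M : Matrix (Fin n₁) (Fin n₂) ℂ) (C : Matrix (Fin c) (Fin n₂) ℂ)
    (x : (Gr k₁ n₁).obj A) :
    (Fin n₂ → A) →ₗ[A] ((tautU k₁ n₁).directSum (.trivial (Gr k₁ n₁) c)).fiber x :=
  ((Gr.subbundle x).exists_retraction.choose ∘ₗ extMat A M).prod (extMat A C)

theorem sumRetraction_sumInclusion {M : Matrix (Fin n₁) (Fin n₂) ℂ}
    {N : Matrix (Fin n₂) (Fin n₁) ℂ} {C : Matrix (Fin c) (Fin n₂) ℂ}
    {D : Matrix (Fin n₂) (Fin c) ℂ} (hMN : M * N = 1) (hMD : M * D = 0) (hCN : C * N = 0)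
    (hCD : C * D = 1) (x : (Gr k₁ n₁).obj A)
    (u : ((tautU k₁ n₁).directSum (.trivial (Gr k₁ n₁) c)).fiber x) :
    sumRetraction M C x (sumInclusion N D x u) = u := by
  obtain ⟨u, y⟩ := u
  exact Prod.ext ((congrArg _ (extMat_add_eq_left hMN hMD u.1 y)).trans
      ((Gr.subbundle x).exists_retraction.choose_spec u))
    ((congrArg _ (add_comm _ _)).trans (extMat_add_eq_left hCD hCN y u.1))

theorem sumInclusion_sumRetraction {M : Matrix (Fin n₁) (Fin n₂) ℂ}
    {N : Matrix (Fin n₂) (Fin n₁) ℂ} {C : Matrix (Fin c) (Fin n₂) ℂ}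
    {D : Matrix (Fin n₂) (Fin c) ℂ} (h : N * M + D * C = 1) (x : (Gr k₁ n₁).obj A)
    {z : Fin n₂ → A} (hz : extMat A M z ∈ Gr.sub x) :
    sumInclusion N D x (sumRetraction M C x z) = z := by
  have h₁ : (((Gr.subbundle x).exists_retraction.choose (extMat A M z) : Gr.sub x) : Fin n₁ → A) =
      extMat A M z :=
    congrArg Subtype.val ((Gr.subbundle x).exists_retraction.choose_spec ⟨extMat A M z, hz⟩)
  exact (congrArg (fun u => extMat A N u + extMat A D (extMat A C z)) h₁).trans
    (extMat_decompose h z)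

/-- For a surjection `M : ℂ^{n₂} → ℂ^{n₁}` with kernel `ℂ^c`, the pairs `(U₁, U₂)` with
`M(U₂) ⊆ U₁` are the subbundles `U₂` of `M⁻¹(U₁) ≅ U₁ ⊕ ℂ^c`. -/
theorem exists_iso_zeroLocus_grassmannBundle (hn : n₂ = n₁ + c)
    {M : Matrix (Fin n₁) (Fin n₂) ℂ} {N : Matrix (Fin n₂) (Fin n₁) ℂ} (hMN : M * N = 1) :
    ∃ e : (QboxUdual k₁ n₁ k₂ n₂).zeroLocus (homSection k₁ n₁ k₂ n₂ M) ≅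
        grassmannBundle k₂ ((tautU k₁ n₁).directSum (.trivial (Gr k₁ n₁) c)),
      e.hom ≫ grassmannBundleProj k₂ ((tautU k₁ n₁).directSum (.trivial (Gr k₁ n₁) c)) =
        (QboxUdual k₁ n₁ k₂ n₂).zeroLocusι (homSection k₁ n₁ k₂ n₂ M) ≫
          FunctorToTypes.prod.fst := by
  obtain ⟨C, D, hMD, hCN, hCD, h⟩ := exists_complement hn hMN
  have hφ : ∀ {A : CommAlgCat.{0, 0} ℂ} (x : (Gr k₁ n₁).obj A)
      (u : ((tautU k₁ n₁).directSum (.trivial (Gr k₁ n₁) c)).fiber x),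
      sumRetraction M C x (sumInclusion N D x u) = u :=
    sumRetraction_sumInclusion hMN hMD hCN hCD
  let F : ∀ A : CommAlgCat.{0, 0} ℂ,
      (grassmannBundle k₂ ((tautU k₁ n₁).directSum (.trivial (Gr k₁ n₁) c))).obj A →
      ((QboxUdual k₁ n₁ k₂ n₂).zeroLocus (homSection k₁ n₁ k₂ n₂ M)).obj A := fun A y =>
    ⟨(y.1, Gr.mk (y.2.mapInj (sumInclusion N D y.1) (sumRetraction M C y.1) (hφ y.1))),
      (homSection_eq_zero_iff M _).2 (by
        rintro _ ⟨⟨u, z⟩, _, rfl⟩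
        exact (extMat_add_eq_left hMN hMD u.1 z).symm ▸ u.2)⟩
  refine Exists.elim (exists_iso_of_bijective F (fun {A B} f y => Subtype.ext <|
    Prod.ext rfl (Gr.ext (Submodule.map_extend _ _ _ _
      (sumInclusion_res N D f y.1) y.2.sub).symm)) fun A => ⟨?_, ?_⟩)
    fun e he => ⟨e.symm, ?_⟩
  · rintro ⟨x, S⟩ ⟨y, T⟩ hxy
    obtain rfl : x = y := congrArg
      (fun z : ((QboxUdual k₁ n₁ k₂ n₂).zeroLocus (homSection k₁ n₁ k₂ n₂ M)).obj A => z.1.1) hxy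
    have h1 : S.sub.map (sumInclusion N D x) = T.sub.map (sumInclusion N D x) := congrArg
      (fun z : ((QboxUdual k₁ n₁ k₂ n₂).zeroLocus (homSection k₁ n₁ k₂ n₂ M)).obj A =>
        Gr.sub z.1.2) hxy
    exact congrArg (Sigma.mk x) (Subbundle.ext (Submodule.map_injective_of_injective
      (Function.LeftInverse.injective (hφ x)) h1))
  · rintro ⟨⟨x, y⟩, hx⟩
    have hx' : ∀ z ∈ Gr.sub y, sumInclusion N D x (sumRetraction M C x z) = z := fun z hz =>
      sumInclusion_sumRetraction h x ((homSection_eq_zero_iff M (x, y)).1 hx z hz)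
    exact ⟨⟨x, (Gr.subbundle y).comapInj (sumInclusion N D x) (sumRetraction M C x) (hφ x) hx'⟩,
      Subtype.ext (Prod.ext rfl (Gr.ext (Submodule.map_map_eq_of_apply_eq hx')))⟩
  · rw [Iso.symm_hom, Iso.inv_comp_eq]
    exact NatTrans.ext <| funext fun A => ConcreteCategory.hom_ext _ _ fun y =>
      (congrArg (fun z : ((QboxUdual k₁ n₁ k₂ n₂).zeroLocus
        (homSection k₁ n₁ k₂ n₂ M)).obj A => z.1.1) (he A y)).symm

end GrassmannBundleIso

/-! ### Generic sections -/

theorem mainTheorem4 (k₁ n₁ k₂ n₂ : ℕ) :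
    -- n₂ = n₁ - 1
    (k₂ < k₁ → k₁ < n₁ → n₂ + 1 = n₁ →
      ∃ (W : Set (QboxUdual k₁ n₁ k₂ n₂).H0) (W' : Set (Fl.dualU₁ k₂ k₁ n₁).H0),
        IsZariskiOpen W ∧ W.Nonempty ∧ IsZariskiOpen W' ∧ W'.Nonempty ∧
        ∀ s ∈ W, ∀ t ∈ W', Nonempty
          ((QboxUdual k₁ n₁ k₂ n₂).zeroLocus s ≅ (Fl.dualU₁ k₂ k₁ n₁).zeroLocus t)) ∧
    -- n₁ = n₂ - 1
    (k₂ < k₁ → k₁ < n₁ → n₁ + 1 = n₂ →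
      ∃ (W : Set (QboxUdual k₁ n₁ k₂ n₂).H0) (W' : Set (Fl.Q₂ k₂ (k₁ + 1) n₂).H0),
        IsZariskiOpen W ∧ W.Nonempty ∧ IsZariskiOpen W' ∧ W'.Nonempty ∧
        ∀ s ∈ W, ∀ t ∈ W', Nonempty
          ((QboxUdual k₁ n₁ k₂ n₂).zeroLocus s ≅ (Fl.Q₂ k₂ (k₁ + 1) n₂).zeroLocus t)) ∧
    -- n₂ = n₁ + c
    (k₁ ≤ n₁ → k₂ ≤ n₂ → k₁ ≤ k₂ → ∀ c : ℕ, n₂ = n₁ + c →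
      ∃ W : Set (QboxUdual k₁ n₁ k₂ n₂).H0, IsZariskiOpen W ∧ W.Nonempty ∧
        ∀ s ∈ W, ∃ e : (QboxUdual k₁ n₁ k₂ n₂).zeroLocus s ≅
            grassmannBundle k₂ ((tautU k₁ n₁).directSum (.trivial (Gr k₁ n₁) c)),
          e.hom ≫ grassmannBundleProj k₂ ((tautU k₁ n₁).directSum (.trivial (Gr k₁ n₁) c)) =
            (QboxUdual k₁ n₁ k₂ n₂).zeroLocusι s ≫ FunctorToTypes.prod.fst) := by
  refine ⟨fun h₁ h₂ h₃ => ?_, fun h₁ h₂ h₃ => ?_, fun h₁ h₂ _ c hc => ?_⟩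
  · obtain ⟨N, M, hNM⟩ := exists_rightInvertible (show n₂ ≤ n₁ by omega)
    obtain ⟨t, w, htw⟩ := exists_rightInvertible (show 1 ≤ n₁ by omega)
    refine ⟨_, _, (isZariskiOpen_leftInvertible n₁ n₂).image (homSection k₁ n₁ k₂ n₂)
        (homSection_surjective h₂.le (by omega)), ⟨_, M, ⟨N, hNM⟩, rfl⟩,
      (isZariskiOpen_rightInvertible 1 n₁).image (dualSection k₂ k₁ n₁)
        (dualSection_surjective h₁.le h₂.le), ⟨_, t, ⟨w, htw⟩, rfl⟩, ?_⟩
    rintro _ ⟨M, ⟨N, hNM⟩, rfl⟩ _ ⟨t, ⟨w, htw⟩, rfl⟩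
    exact nonempty_iso_zeroLocus_dualSection h₃.symm hNM htw
  · obtain ⟨M, N, hMN⟩ := exists_rightInvertible (show n₁ ≤ n₂ by omega)
    obtain ⟨t, v, htv⟩ := exists_rightInvertible (show 1 ≤ n₂ by omega)
    refine ⟨_, _, (isZariskiOpen_rightInvertible n₁ n₂).image (homSection k₁ n₁ k₂ n₂)
        (homSection_surjective h₂.le (by omega)), ⟨_, M, ⟨N, hMN⟩, rfl⟩,
      (isZariskiOpen_leftInvertible n₂ 1).image (quotSection k₂ (k₁ + 1) n₂)
        (quotSection_surjective (by omega) (by omega)), ⟨_, v, ⟨t, htv⟩, rfl⟩, ?_⟩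
    rintro _ ⟨M, ⟨N, hMN⟩, rfl⟩ _ ⟨v, ⟨t, htv⟩, rfl⟩
    exact nonempty_iso_zeroLocus_quotSection h₃.symm hMN htv
  · obtain ⟨M, N, hMN⟩ := exists_rightInvertible (show n₁ ≤ n₂ by omega)
    refine ⟨_, (isZariskiOpen_rightInvertible n₁ n₂).image (homSection k₁ n₁ k₂ n₂)
      (homSection_surjective h₁ h₂), ⟨_, M, ⟨N, hMN⟩, rfl⟩, ?_⟩
    rintro _ ⟨M, ⟨N, hMN⟩, rfl⟩
    exact exists_iso_zeroLocus_grassmannBundle hc hMN
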